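/- Let $S^4$ be the smooth unit sphere in $\mathbb{R}^5$, and let $\mathcal{K}\subset S^4$ be a knotted surface, that is, a closed smoothly embedded surface, possibly disconnected or non-orientable. A collection of $c$ pairwise disjoint properly embedded $(n-2)$-balls in an $n$-ball $X$ ($n=3,4$) is *trivial* if the balls are simultaneously isotopic into $\partial X$; that is, if there are pairwise disjoint embedded half-balls $H_1,\dots,H_c\subset X$, each modelled on $\{x\in\mathbb{R}^n : |x|\le 2,\ x_n\ge 0\}$, with $H_k\cap\partial X$ the flat face $\{x_n=0\}$ of $H_k$, such that the $k$-th $(n-2)$-ball of the collection is the hemisphere $\{|x|=1,\ x_1=0,\ x_n\ge 0\}$ of $H_k$ (which is isotopic, relative to its boundary, into the flat face through the half-disk $\{|x|\le 1,\ x_1=0,\ x_n\ge 0\}$). The half-balls are smoothly embedded, except that at a corner of $X$ they are only required to be topologically embedded. For $n=3$ this is a *$c$-strand trivial tangle*, for $n=4$ a *trivial $c$-disk system*. The standard genus zero trisection of $S^4$ is $S^4=X_1\cup X_2\cup X_3$ with $X_i=\{x\in S^4 : x_i=\max(x_1,x_2,x_3)\}$, or the image of this decomposition under a diffeomorphism of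 $S^4$: each $X_i$ is a 4-ball (with a corner along $\Sigma$), each $X_i\cap X_j$ with $i\neq j$ is a 3-ball, and $\Sigma=X_1\cap X_2\cap X_3=\partial(X_i\cap X_j)$ is a 2-sphere. A *$(b;c_1,c_2,c_3)$-bridge trisection* of $\mathcal{K}$ is a standard genus zero trisection $S^4=X_1\cup X_2\cup X_3$ such that $(X_i,\mathcal{K}\cap X_i)$ is a trivial $c_i$-disk system for each $i$ and $(X_i\cap X_j,\ \mathcal{K}\cap X_i\cap X_j)$ is a $b$-strand trivial tangle for all $i\ne j$. A *meridian* of $\mathcal{K}$ is a loop that runs once around the boundary circle $\{p\}\times S^1$ of a fibre $\{p\}\times D^2$, $p\in\mathcal{K}$, of a tubular neighbourhood of $\mathcal{K}$. An element of $\pi_1(S^4\setminus\mathcal{K},x_0)$ is *meridional* if it is represented by a meridian, joined to the base point $x_0$ by a path in $S^4\setminus\mathcal{K}$. The *meridional rank* $\mathrm{mrk}(\mathcal{K})$ is the minimum number of generators among the presentations of $\pi_1(S^4\setminus\mathcal{K},x_0)$ all of whose generators are meridional (and $\infty$ if there is no such presentation with finitely many generators). **Statement.** If $\mathcal{K}$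 admits a $(b;c_1,c_2,c_3)$-bridge trisection, then, for every base point $x_0\in S^4\setminus\mathcal{K}$, $$\mathrm{mrk}(\mathcal{K})\le\min\{c_1,c_2,c_3\}.$$ In particular $\pi_1(S^4\setminus\mathcal{K},x_0)$ has a presentation with finitely many generators, all meridional. -/

import Mathlib

open Set
open scoped Manifold ContDiff

/-- The smooth 4-sphere: the unit sphere of `ℝ⁵`, with Mathlib's manifold structure. -/
abbrev FourSphere : Type := Metric.sphere (0 : EuclideanSpace ℝ (Fin 5)) 1

instance fact_finrank_five : Fact (Module.finrank ℝ (EuclideanSpace ℝ (Fin 5)) = 4 + 1) :=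
  ⟨by simp⟩

/-! ### Knotted surfaces -/

/-- A smooth chart of the 4-sphere that flattens `K`: in the coordinates of the chart, `K` is the
coordinate plane on which the last two coordinates vanish. -/
def IsSliceChart (K : Set FourSphere)
    (φ : OpenPartialHomeomorph FourSphere (EuclideanSpace ℝ (Fin 4))) : Prop :=
  φ ∈ IsManifold.maximalAtlas (𝓡 4) ∞ FourSphere ∧
    ∀ p ∈ φ.source, p ∈ K ↔ φ p 2 = 0 ∧ φ p 3 = 0

/-- A knotted surface: a compact smoothly embedded 2-dimensional submanifold (without boundary) of
the 4-sphere. It may be disconnected or non-orientable. -/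
def IsKnottedSurface (K : Set FourSphere) : Prop :=
  IsCompact K ∧ ∀ p ∈ K, ∃ φ, IsSliceChart K φ ∧ p ∈ φ.source

/-! ### The standard genus zero trisection -/

/-- The `i`-th piece of the model trisection of the 4-sphere: the points whose `i`-th coordinate is
the largest of the first three. Each piece is a 4-ball, two of them meet in a 3-ball, and all three
meet in a 2-sphere. -/
def modelPiece (i : Fin 3) : Set FourSphere :=
  {p | ∀ j : Fin 3, p.1 (j.castLE (by norm_num)) ≤ p.1 (i.castLE (by norm_num))}

/-- `X 0 ∪ X 1 ∪ X 2` is the standard genus zero trisection of the 4-sphere, up to a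
diffeomorphism of the 4-sphere. -/
def IsGenusZeroTrisection (X : Fin 3 → Set FourSphere) : Prop :=
  ∃ Φ : Diffeomorph (𝓡 4) (𝓡 4) FourSphere FourSphere ∞, ∀ i, X i = Φ '' modelPiece i

/-! ### Trivial tangles and trivial disk systems -/

/-- The closed half-ball of radius 2 in `ℝⁿ`, `n = m + 2`; its flat face is where the last
coordinate vanishes. -/
def halfBall (m : ℕ) : Set (EuclideanSpace ℝ (Fin (m + 2))) :=
  {x | ‖x‖ ≤ 2 ∧ 0 ≤ x (Fin.last (m + 1))}

/-- The model of a boundary parallel `(n - 2)`-ball in the half-ball: the unit hemisphere in the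
hyperplane where the first coordinate vanishes. It is isotopic, relative to its boundary and through
the half-disk `{x | x 0 = 0, ‖x‖ ≤ 1, 0 ≤ x (Fin.last _)}`, into the flat face. -/
def halfBallDome (m : ℕ) : Set (EuclideanSpace ℝ (Fin (m + 2))) :=
  {x | ‖x‖ = 1 ∧ x 0 = 0 ∧ 0 ≤ x (Fin.last (m + 1))}

/-- `X` is an `n`-ball (`n = m + 2`) in the 4-sphere, `bd` is its boundary, and `bd` has a corner
along `corner`. The set `D ⊆ X` is a union of `c` pairwise disjoint properly embedded `(n - 2)`-balls
that are simultaneously isotopic into `bd`: there are pairwise disjoint embedded half-balls in `X`,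
meeting `bd` exactly in their flat faces, such that `D` consists of the domes of these half-balls,
so that each component is pushed into `bd` inside its own half-ball.
The half-balls are smoothly embedded, except at the corner of `X`. -/
def IsTrivialBallSystem (m : ℕ) (X bd corner D : Set FourSphere) (c : ℕ) : Prop :=
  ∃ e : Fin c → EuclideanSpace ℝ (Fin (m + 2)) → FourSphere,
    (∀ k, ContinuousOn (e k) (halfBall m)) ∧
    (∀ k l, ∀ x ∈ halfBall m, ∀ y ∈ halfBall m, e k x = e l y → k = l ∧ x = y) ∧
    (∀ k, MapsTo (e k) (halfBall m) X) ∧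
    (∀ k, ∀ x ∈ halfBall m, e k x ∈ bd ↔ x (Fin.last (m + 1)) = 0) ∧
    (∀ k, ∀ x ∈ halfBall m, e k x ∉ corner →
      ContMDiffWithinAt 𝓘(ℝ, EuclideanSpace ℝ (Fin (m + 2))) (𝓡 4) ∞ (e k) (halfBall m) x ∧
      Function.Injective
        (mfderivWithin 𝓘(ℝ, EuclideanSpace ℝ (Fin (m + 2))) (𝓡 4) (e k) (halfBall m) x)) ∧
    D = ⋃ k, e k '' halfBallDome m

/-- A trivial tangle with `b` strands in the smooth 3-ball `B` with boundary sphere `bd`. -/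
def IsTrivialTangle (B bd α : Set FourSphere) (b : ℕ) : Prop :=
  IsTrivialBallSystem 1 B bd ∅ α b

/-- A trivial `c`-disk system in the 4-ball `X`, whose boundary has a corner along `corner`. -/
def IsTrivialDiskSystem (X corner D : Set FourSphere) (c : ℕ) : Prop :=
  IsTrivialBallSystem 2 X (frontier X) corner D c

/-! ### Bridge trisections -/

/-- `(S⁴, K) = (X 0, K ∩ X 0) ∪ (X 1, K ∩ X 1) ∪ (X 2, K ∩ X 2)` is a `(b; c 0, c 1, c 2)`-bridge
trisection of `K`. The central 2-sphere is `⋂ k, X k`. -/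
structure IsBridgeTrisection (K : Set FourSphere) (b : ℕ) (c : Fin 3 → ℕ)
    (X : Fin 3 → Set FourSphere) : Prop where
  trisection : IsGenusZeroTrisection X
  disks : ∀ i, IsTrivialDiskSystem (X i) (⋂ k, X k) (K ∩ X i) (c i)
  tangles : ∀ i j, i ≠ j →
    IsTrivialTangle (X i ∩ X j) (⋂ k, X k) ((K ∩ X i) ∩ (K ∩ X j)) b

/-- `K` admits a `(b; c₁, c₂, c₃)`-bridge trisection. -/
def AdmitsBridgeTrisection (K : Set FourSphere) (b c₁ c₂ c₃ : ℕ) : Prop :=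
  ∃ X, IsBridgeTrisection K b ![c₁, c₂, c₃] X

/-! ### Meridians and the meridional rank -/

/-- The point with angle `θ` on the circle of radius `r` around the origin of the plane spanned by
the last two coordinate directions of `ℝ⁴`. -/
noncomputable def normalCircle (r θ : ℝ) : EuclideanSpace ℝ (Fin 4) :=
  !₂[0, 0, r * Real.cos θ, r * Real.sin θ]

/-- A meridian of `K`: a loop in the complement of `K` that runs once around the boundary circle
`{p} × S¹` of a fibre `{p} × D²` of a tubular neighbourhood of `K`, which is described in a chart
that flattens `K`. -/
def IsMeridian (K : Set FourSphere) {q : ↥Kᶜ} (μ : Path q q) : Prop :=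
  ∃ φ, IsSliceChart K φ ∧ ∃ p ∈ K ∩ φ.source, ∃ r : ℝ, 0 < r ∧
    (∀ s ∈ Icc 0 r, ∀ θ : ℝ, φ p + normalCircle s θ ∈ φ.target) ∧
    ∀ t : unitInterval, (μ t : FourSphere) = φ.symm (φ p + normalCircle r (2 * Real.pi * t))

/-- An element of `π₁(S⁴ ∖ K, x₀)` is meridional if it is represented by a meridian of `K`, joined
to the base point by a path in the complement. -/
def IsMeridional (K : Set FourSphere) {x₀ : ↥Kᶜ} (g : FundamentalGroup ↥Kᶜ x₀) : Prop :=
  ∃ (q : ↥Kᶜ) (γ : Path x₀ q) (μ : Path q q), IsMeridian K μ ∧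
    g = FundamentalGroup.fromPath
      (Path.Homotopic.Quotient.mk ((γ.trans μ).trans γ.symm))

/-- `π₁(S⁴ ∖ K, x₀)` has a presentation with `n` generators, all of them meridional. -/
def HasMeridionalPresentation (K : Set FourSphere) (x₀ : ↥Kᶜ) (n : ℕ) : Prop :=
  ∃ (rels : Set (FreeGroup (Fin n))) (f : PresentedGroup rels ≃* FundamentalGroup ↥Kᶜ x₀),
    ∀ i, IsMeridional K (f (PresentedGroup.of i))

/-- The meridional rank: the least number of generators of a meridional presentation of
`π₁(S⁴ ∖ K, x₀)`; it is `⊤` if there is no such presentation with finitely many generators. -/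
noncomputable def meridionalRank (K : Set FourSphere) (x₀ : ↥Kᶜ) : ℕ∞ :=
  ⨅ (n : ℕ) (_ : HasMeridionalPresentation K x₀ n), (n : ℕ∞)

/-! Each piece X_i ∖ K has a fundamental group generated by meridians, and every loop of S⁴ ∖ K can
be moved into any chosen piece. For a trivial disk system, π₁(X_i ∖ K) is generated by c_i
meridians, one around each disk; it is even free on them, but only generation is needed. The disks
are parallel into ∂X_i, so loops of X_i ∖ K can be pushed into ∂X_i ∖ K. The strands are parallel
into Σ, so loops of (X_i ∩ X_j) ∖ K can be pushed into Σ ∖ K. Cutting a loop along the pieces, and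
then along their faces, pushes it into Σ ∖ K, which lies in every X_i (`liesIn_of_isTrivialPair`).
Hence π₁(X_i ∖ K) maps onto π₁(S⁴ ∖ K), and c_i meridians generate the target. A finite generating
family always carries a presentation (`exists_presentation`), which bounds the rank by c_i for each
i.

Both local facts come from one computation, `IsHalfBallSystem.subgroup_eq_top`. The complement of
the domes is covered by the exterior of the unit half-balls and, in each half-ball, by the inner
half-ball and the two sides of the hyperplane of the dome. Paths inside one member are determined up
to homotopy by their endpoints. The only cycle of intersections in a half-ball runs through
exterior, one side, interior and other side, so each half-ball contributes one generator. Drawn in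
the flat face, this generator shows that loops can be pushed into the boundary (`liesIn_boundary`);
drawn around the pole of the dome, it is a meridian (`isMeridian_of_dome`).

Two technical points remain. The half-balls must be open in the piece away from their spherical
parts. In the interior this is the inverse function theorem; at the boundary a connectedness
argument suffices (`exists_isOpen_inter_subset_image_halfBall`), so smoothness at the corner is not
needed. Moreover the pieces are closed, so a path may cross between them infinitely often. Locally
it is replaced by a segment in ℝ⁵, where the pieces are convex cones that cut the segment into
finitely many intervals (`map_convex_of_cover`). -/

/-! ### Path classes -/

namespace PathClass

open Path.Homotopic.Quotient (trans symm refl mk trans_assoc)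

variable {M : Type*} [TopologicalSpace M]

/-- Classes of paths with a representative in the set `A`. -/
def LiesIn (A : Set M) {x y : M} (c : Path.Homotopic.Quotient x y) : Prop :=
  ∃ p : Path x y, (∀ t, p t ∈ A) ∧ mk p = c

theorem symm_trans_rev {x y z : M} (p : Path.Homotopic.Quotient x y)
    (q : Path.Homotopic.Quotient y z) : symm (trans p q) = trans (symm q) (symm p) := by
  induction p using Path.Homotopic.Quotient.ind with | mk p =>
  induction q using Path.Homotopic.Quotient.ind with | mk q =>
  rw [← Path.Homotopic.Quotient.mk_trans, ← Path.Homotopic.Quotient.mk_symm, Path.trans_symm]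
  rfl

theorem symm_symm' {x y : M} (p : Path.Homotopic.Quotient x y) : symm (symm p) = p := by
  induction p using Path.Homotopic.Quotient.ind with | mk p =>
  rw [← Path.Homotopic.Quotient.mk_symm, ← Path.Homotopic.Quotient.mk_symm, Path.symm_symm]

theorem trans_symm_cancel {x y z : M} (p : Path.Homotopic.Quotient x y)
    (q : Path.Homotopic.Quotient x z) : trans p (trans (symm p) q) = q := by
  rw [← trans_assoc]; simp

theorem symm_trans_cancel {x y z : M} (p : Path.Homotopic.Quotient x y)
    (q : Path.Homotopic.Quotient y z) : trans (symm p) (trans p q) = q := by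
  rw [← trans_assoc]; simp

theorem symm_refl' (x : M) : symm (refl x) = refl x := by
  rw [← Path.Homotopic.Quotient.mk_refl, ← Path.Homotopic.Quotient.mk_symm, Path.refl_symm]

namespace LiesIn

variable {A B : Set M} {x y z : M} {c : Path.Homotopic.Quotient x y}
  {d : Path.Homotopic.Quotient y z}

theorem of_path (p : Path x y) (h : ∀ t, p t ∈ A) : LiesIn A (mk p) := ⟨p, h, rfl⟩

theorem refl (h : x ∈ A) : LiesIn A (Path.Homotopic.Quotient.refl x) :=
  ⟨Path.refl x, fun _ => h, rfl⟩

theorem trans (hc : LiesIn A c) (hd : LiesIn A d) : LiesIn A (c.trans d) := by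
  obtain ⟨p, hp, rfl⟩ := hc
  obtain ⟨q, hq, rfl⟩ := hd
  refine ⟨p.trans q, fun t => ?_, rfl⟩
  rw [Path.trans_apply]
  split_ifs
  exacts [hp _, hq _]

theorem symm (hc : LiesIn A c) : LiesIn A c.symm := by
  obtain ⟨p, hp, rfl⟩ := hc
  exact ⟨p.symm, fun t => hp _, rfl⟩

theorem mono (h : A ⊆ B) (hc : LiesIn A c) : LiesIn B c := by
  obtain ⟨p, hp, rfl⟩ := hc
  exact ⟨p, fun t => h (hp t), rfl⟩

theorem source_mem (hc : LiesIn A c) : x ∈ A := by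
  obtain ⟨p, hp, rfl⟩ := hc
  simpa using hp 0

theorem target_mem (hc : LiesIn A c) : y ∈ A := by
  obtain ⟨p, hp, rfl⟩ := hc
  simpa using hp 1

theorem map {N : Type*} [TopologicalSpace N] {B : Set N} (f : C(M, N)) (h : MapsTo f A B)
    (hc : LiesIn A c) : LiesIn B (c.map f) := by
  obtain ⟨p, hp, rfl⟩ := hc
  exact ⟨p.map f.continuous, fun t => h (hp t), rfl⟩

end LiesIn

theorem exists_liesIn_of_joinedIn {A : Set M} {x y : M} (h : JoinedIn A x y) :
    ∃ c : Path.Homotopic.Quotient x y, LiesIn A c :=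
  ⟨mk h.somePath, h.somePath, h.somePath_mem, rfl⟩

/-- A property of path classes that is stable under concatenation and holds for all paths inside
the members of an open cover holds for all path classes. -/
theorem induction_cover {ι : Type*} (W : ι → Set M) (hopen : ∀ a, IsOpen (W a))
    (hcover : ∀ x, ∃ a, x ∈ W a) (P : ∀ {x y : M}, Path.Homotopic.Quotient x y → Prop)
    (htrans : ∀ {x y z : M} (c : Path.Homotopic.Quotient x y) (d : Path.Homotopic.Quotient y z),
      P c → P d → P (trans c d))
    (hbase : ∀ a {x y : M} (p : Path x y), (∀ t, p t ∈ W a) → P (mk p))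
    {x y : M} (c : Path.Homotopic.Quotient x y) : P c := by
  induction c using Path.Homotopic.Quotient.ind with | mk p =>
  obtain ⟨t, ht0, hmono, ⟨n, hn⟩, hsub⟩ := exists_monotone_Icc_subset_open_cover_unitInterval
    (c := fun a => p ⁻¹' W a) (fun a => (hopen a).preimage p.continuous)
    (fun s _ => by simpa using hcover (p s))
  have hpiece : ∀ k, P (mk (p.subpath (t k) (t (k + 1)))) := by
    intro k
    obtain ⟨a, ha⟩ := hsub k
    refine hbase a _ fun s => ?_
    have : p.subpath (t k) (t (k + 1)) s ∈ range (p.subpath (t k) (t (k + 1))) := ⟨s, rfl⟩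
    rw [Path.range_subpath_of_le _ _ _ (hmono (Nat.le_succ k))] at this
    obtain ⟨u, hu, hus⟩ := this
    rw [← hus]
    exact ha hu
  have hall : ∀ k, P (mk (p.subpath (t 0) (t k))) := by
    intro k
    induction k with
    | zero =>
      obtain ⟨a, ha⟩ := hcover (p (t 0))
      refine hbase a _ fun s => ?_
      rw [Path.subpath_self]
      exact ha
    | succ k ih =>
      have h := htrans _ _ ih (hpiece k)
      rw [← Path.Homotopic.Quotient.mk_trans] at h
      rwa [Path.Homotopic.Quotient.eq.2 ⟨Path.Homotopy.subpathTransSubpath p (t 0) (t k) (t (k + 1))⟩]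
        at h
  have h := hall n
  rw [hn n le_rfl, ht0, Path.subpath_zero_one] at h
  -- The subpath from 0 to 1 has endpoints `p 0` and `p 1`, which equal `x` and `y` only
  -- propositionally.
  have key : ∀ {x' y' : M} (hx : x' = x) (hy : y' = y), P (mk (p.cast hx hy)) → P (mk p) := by
    rintro _ _ rfl rfl h
    exact h
  exact key _ _ h

/-- **Van Kampen generation.** Suppose that `M` has an open cover by path connected sets with path
connected pairwise intersections, in each of which any two paths with the same endpoints are homotopic
in `M`. A subgroup of the fundamental group which contains, for a choice of tethers, the loops that
pass through pairwise intersections is the full group. -/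
theorem subgroup_eq_top_of_cover {x₀ : M} {ι : Type*} (W : ι → Set M) (hopen : ∀ a, IsOpen (W a))
    (hcover : ∀ x, ∃ a, x ∈ W a)
    (hconn : ∀ a, ∀ x ∈ W a, ∀ y ∈ W a, JoinedIn (W a) x y)
    (hsc : ∀ a {x y : M} (p q : Path x y), (∀ t, p t ∈ W a) → (∀ t, q t ∈ W a) → p.Homotopic q)
    (hjoin : ∀ a a', ∀ x ∈ W a ∩ W a', ∀ y ∈ W a ∩ W a', JoinedIn (W a ∩ W a') x y)
    (H : Subgroup (FundamentalGroup M x₀)) (b : ι → M) (hb : ∀ a, b a ∈ W a)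
    (η : ∀ a, Path.Homotopic.Quotient x₀ (b a))
    (hcompat : ∀ a a', (W a ∩ W a').Nonempty → ∃ z ∈ W a ∩ W a',
      ∃ (p : Path.Homotopic.Quotient (b a) z) (q : Path.Homotopic.Quotient (b a') z),
        LiesIn (W a) p ∧ LiesIn (W a') q ∧
        FundamentalGroup.fromPath (trans (trans (η a) p) (symm (trans (η a') q))) ∈ H)
    (a₀ : ι) (p₀ : Path.Homotopic.Quotient (b a₀) x₀) (hp₀ : LiesIn (W a₀) p₀)
    (h₀ : FundamentalGroup.fromPath (trans (η a₀) p₀) ∈ H) : H = ⊤ := by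
  -- The group product `g * h` is the path `h` followed by `g`, so the factors appear in reversed
  -- order.
  have mul : ∀ c d : Path.Homotopic.Quotient x₀ x₀, FundamentalGroup.fromPath c ∈ H →
      FundamentalGroup.fromPath d ∈ H → FundamentalGroup.fromPath (trans c d) ∈ H :=
    fun c d hc hd => H.mul_mem hd hc
  have uniq : ∀ a {x y : M} (p q : Path.Homotopic.Quotient x y), LiesIn (W a) p →
      LiesIn (W a) q → p = q := by
    rintro a x y _ _ ⟨p, hp, rfl⟩ ⟨q, hq, rfl⟩
    exact Path.Homotopic.Quotient.eq.2 (hsc a p q hp hq)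
  -- `hcompat` supplies a single point of each intersection. As the intersection is path connected
  -- and paths in a member are unique up to homotopy, the same holds for every point and every
  -- choice of paths.
  have compat : ∀ a a' {x : M} (p : Path.Homotopic.Quotient (b a) x)
      (q : Path.Homotopic.Quotient (b a') x), LiesIn (W a) p → LiesIn (W a') q →
      FundamentalGroup.fromPath (trans (trans (η a) p) (symm (trans (η a') q))) ∈ H := by
    intro a a' x p q hp hq
    obtain ⟨z, hz, p', q', hp', hq', h⟩ := hcompat a a' ⟨x, hp.target_mem, hq.target_mem⟩
    obtain ⟨s, hs⟩ := exists_liesIn_of_joinedIn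
      (hjoin a a' z hz x ⟨hp.target_mem, hq.target_mem⟩)
    rw [uniq a p (trans p' s) hp (hp'.trans (hs.mono inter_subset_left)),
      uniq a' q (trans q' s) hq (hq'.trans (hs.mono inter_subset_right))]
    convert h using 1
    simp [symm_trans_rev, trans_assoc, trans_symm_cancel]
  -- Closing up an arbitrary path by tethers at both ends gives a property that survives
  -- concatenation: insert a tether to the intermediate point and its inverse.
  have key : ∀ {x y : M} (c : Path.Homotopic.Quotient x y), ∀ a a' (p : Path.Homotopic.Quotient (b a) x)
      (q : Path.Homotopic.Quotient (b a') y), LiesIn (W a) p → LiesIn (W a') q →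
      FundamentalGroup.fromPath (trans (trans (η a) p) (trans c (symm (trans (η a') q)))) ∈ H := by
    intro x y c
    refine induction_cover W hopen hcover (fun {x y} c => ∀ a a' (p : Path.Homotopic.Quotient (b a) x)
      (q : Path.Homotopic.Quotient (b a') y), LiesIn (W a) p → LiesIn (W a') q →
      FundamentalGroup.fromPath (trans (trans (η a) p) (trans c (symm (trans (η a') q)))) ∈ H)
      ?_ ?_ c
    · intro x y z c d hc hd a a' p q hp hq
      obtain ⟨a'', ha''⟩ := hcover y
      obtain ⟨s, hs⟩ := exists_liesIn_of_joinedIn (hconn a'' _ (hb a'') y ha'')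
      convert mul _ _ (hc a a'' p s hp hs) (hd a'' a' s q hs hq) using 1
      simp [symm_trans_rev, trans_assoc, symm_trans_cancel]
    · intro a'' x y c hc a a' p q hp hq
      have hx : x ∈ W a'' := by simpa using hc 0
      have hy : y ∈ W a'' := by simpa using hc 1
      obtain ⟨s, hs⟩ := exists_liesIn_of_joinedIn (hconn a'' _ (hb a'') x hx)
      have hc' := LiesIn.of_path c hc
      convert mul _ _ (compat a a'' p s hp hs)
        (compat a'' a' (trans s (mk c)) q (hs.trans hc') hq) using 1
      simp [symm_trans_rev, trans_assoc, symm_trans_cancel]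
  -- The loop `η a₀ · p₀` need not be trivial, but it lies in `H`, so conjugating by it does no
  -- harm.
  refine eq_top_iff.2 fun c _ => ?_
  have h := key c a₀ a₀ p₀ p₀ hp₀ hp₀
  convert mul _ _ (mul _ _ (H.inv_mem h₀) h) h₀ using 1
  change c = ((trans (η a₀) p₀).symm.trans _).trans _
  simp [symm_trans_rev, trans_assoc, symm_trans_cancel]

/-- If the path classes in `T` are generated by those in the strata `Z a`, if every loop in a stratum
can be pushed into `S ⊆ T`, and if the strata are suitably connected, then every loop in `T` can be
pushed into `S`. -/
theorem liesIn_of_strata {x₀ : M} {ι : Type*} (Z : ι → Set M) (S T : Set M)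
    (hpush : ∀ a (c : Path.Homotopic.Quotient x₀ x₀), LiesIn (Z a) c → LiesIn S c)
    (hconn : ∀ x ∈ T, ∃ p : Path.Homotopic.Quotient x₀ x, ∀ a, x ∈ Z a → LiesIn (Z a) p)
    (hgen : ∀ (P : ∀ {x y : M}, Path.Homotopic.Quotient x y → Prop),
      (∀ {x y z : M} (c : Path.Homotopic.Quotient x y) (d : Path.Homotopic.Quotient y z),
        y ∈ T → P c → P d → P (trans c d)) →
      (∀ a {x y : M} (c : Path.Homotopic.Quotient x y), LiesIn (Z a) c → P c) →
      ∀ {x y : M} (c : Path.Homotopic.Quotient x y), LiesIn T c → P c)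
    (hT : ∀ a, x₀ ∈ Z a)
    (c : Path.Homotopic.Quotient x₀ x₀) (hc : LiesIn T c) : LiesIn S c := by
  -- A tether that lies in every stratum containing its endpoint turns a path in one stratum into a
  -- loop in that stratum, to which `hpush` applies.
  have key := hgen (fun {x y} c => ∀ (p : Path.Homotopic.Quotient x₀ x)
      (q : Path.Homotopic.Quotient x₀ y), (∀ a, x ∈ Z a → LiesIn (Z a) p) →
      (∀ a, y ∈ Z a → LiesIn (Z a) q) → LiesIn S (trans p (trans c (symm q)))) ?_ ?_ c hc
    (refl x₀) (refl x₀) (fun a _ => LiesIn.refl (hT a)) (fun a _ => LiesIn.refl (hT a))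
  · simpa [symm_refl'] using key
  · intro x y z c d hy hc hd p q hp hq
    obtain ⟨s, hs⟩ := hconn y hy
    have := (hc p s hp hs).trans (hd s q hs hq)
    simpa [trans_assoc, symm_trans_cancel] using this
  · intro a x y c hc p q hp hq
    exact hpush a _ ((hp a hc.source_mem).trans (hc.trans (hq a hc.target_mem).symm))

end PathClass

/-! ### Systems of half-balls in a topological space -/

/-- Pairwise disjoint embedded half-balls, open away from their spherical parts. -/
structure IsHalfBallSystem {m c : ℕ} {Y : Type*} [TopologicalSpace Y]
    (e : Fin c → EuclideanSpace ℝ (Fin (m + 2)) → Y) : Prop where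
  continuousOn : ∀ k, ContinuousOn (e k) (halfBall m)
  injective : ∀ k l, ∀ x ∈ halfBall m, ∀ y ∈ halfBall m, e k x = e l y → k = l ∧ x = y
  isOpen_image : ∀ k, IsOpen (e k '' {x | x ∈ halfBall m ∧ ‖x‖ < 2})

theorem convex_halfBall (m : ℕ) : Convex ℝ (halfBall m) := by
  have h1 : Convex ℝ {x : EuclideanSpace ℝ (Fin (m + 2)) | ‖x‖ ≤ 2} := by
    simpa [Metric.closedBall, dist_zero_right] using
      convex_closedBall (0 : EuclideanSpace ℝ (Fin (m + 2))) 2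
  exact h1.inter (convex_halfSpace_ge (f := fun x : EuclideanSpace ℝ (Fin (m + 2)) =>
    x (Fin.last (m + 1))) ⟨fun _ _ => rfl, fun _ _ => rfl⟩ 0)

theorem isCompact_halfBall (m : ℕ) : IsCompact (halfBall m) := by
  have h1 : {x : EuclideanSpace ℝ (Fin (m + 2)) | ‖x‖ ≤ 2} = Metric.closedBall 0 2 := by
    ext x; simp
  have h2 : IsClosed {x : EuclideanSpace ℝ (Fin (m + 2)) | 0 ≤ x (Fin.last (m + 1))} :=
    isClosed_le continuous_const (by fun_prop)
  have : halfBall m = Metric.closedBall 0 2 ∩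
      {x : EuclideanSpace ℝ (Fin (m + 2)) | 0 ≤ x (Fin.last (m + 1))} := by
    rw [← h1]; rfl
  rw [this]
  exact (isCompact_closedBall _ _).inter_right h2

/-- Three convex pieces of the half-ball: the inner half-ball bounded by the dome, and the two sides
of the hyperplane that contains the dome. -/
def halfBallPiece (m : ℕ) : Fin 3 → Set (EuclideanSpace ℝ (Fin (m + 2)))
  | 0 => {x | x ∈ halfBall m ∧ ‖x‖ < 1}
  | 1 => {x | x ∈ halfBall m ∧ ‖x‖ < 2 ∧ 0 < x 0}
  | 2 => {x | x ∈ halfBall m ∧ ‖x‖ < 2 ∧ x 0 < 0}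

theorem convex_norm_lt {E : Type*} [SeminormedAddCommGroup E] [NormedSpace ℝ E] (r : ℝ) :
    Convex ℝ {x : E | ‖x‖ < r} := by
  simpa [Metric.ball, dist_zero_right] using convex_ball (0 : E) r

theorem convex_halfBallPiece (m : ℕ) (s : Fin 3) : Convex ℝ (halfBallPiece m s) := by
  have hlin : IsLinearMap ℝ (fun x : EuclideanSpace ℝ (Fin (m + 2)) => x 0) :=
    ⟨fun _ _ => rfl, fun _ _ => rfl⟩
  fin_cases s
  · exact (convex_halfBall m).inter (convex_norm_lt 1)
  · exact (convex_halfBall m).inter ((convex_norm_lt 2).inter (convex_halfSpace_gt hlin 0))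
  · exact (convex_halfBall m).inter ((convex_norm_lt 2).inter (convex_halfSpace_lt hlin 0))

theorem halfBallPiece_subset (m : ℕ) (s : Fin 3) : halfBallPiece m s ⊆ halfBall m := by
  fin_cases s <;> exact fun x hx => hx.1

theorem halfBallDome_subset (m : ℕ) : halfBallDome m ⊆ halfBall m := by
  rintro x ⟨h1, -, h3⟩
  exact ⟨by rw [h1]; norm_num, h3⟩

theorem disjoint_halfBallPiece_dome {m : ℕ} {s : Fin 3} {x : EuclideanSpace ℝ (Fin (m + 2))}
    (hx : x ∈ halfBallPiece m s) : x ∉ halfBallDome m := by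
  rintro ⟨h1, h2, -⟩
  fin_cases s
  · exact hx.2.ne h1
  · exact hx.2.2.ne' h2
  · exact hx.2.2.ne h2

/-- The part of a path connected cone between two spheres is path connected. -/
theorem isPathConnected_shell {E : Type*} [NormedAddCommGroup E] [NormedSpace ℝ E] {C : Set E}
    (hC : IsPathConnected C) (h0 : (0 : E) ∉ C) (hcone : ∀ x ∈ C, ∀ r : ℝ, 0 < r → r • x ∈ C)
    {a b : ℝ} (ha : 0 ≤ a) (hab : a < b) : IsPathConnected {x | x ∈ C ∧ a < ‖x‖ ∧ ‖x‖ < b} := by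
  have hI : IsPathConnected (Ioo a b) :=
    (convex_Ioo a b).isPathConnected (nonempty_Ioo.2 hab)
  -- Polar coordinates: the shell is the image of `C ×ˢ Ioo a b` under rescaling to a prescribed
  -- norm.
  have : {x | x ∈ C ∧ a < ‖x‖ ∧ ‖x‖ < b} = (fun z : E × ℝ => (z.2 / ‖z.1‖) • z.1) '' (C ×ˢ Ioo a b) := by
    ext x
    constructor
    · rintro ⟨hx, h1, h2⟩
      have hx0 : ‖x‖ ≠ 0 := by linarith
      exact ⟨(x, ‖x‖), ⟨hx, h1, h2⟩, by simp [hx0]⟩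
    · rintro ⟨⟨y, r⟩, ⟨hy, h1, h2⟩, rfl⟩
      have hy0 : 0 < ‖y‖ := norm_pos_iff.2 (fun h => h0 (h ▸ hy))
      have hr : 0 < r := lt_of_le_of_lt ha h1
      have hn : ‖(r / ‖y‖) • y‖ = r := by
        rw [norm_smul, Real.norm_of_nonneg (by positivity), div_mul_cancel₀ _ hy0.ne']
      refine ⟨hcone y hy _ (by positivity), ?_⟩
      simp only [hn]
      exact ⟨h1, h2⟩
  rw [this]
  refine (hC.prod hI).image' ?_
  refine ContinuousOn.smul (ContinuousOn.div continuousOn_snd (by fun_prop) ?_) continuousOn_fst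
  rintro ⟨y, r⟩ ⟨hy, -⟩
  exact norm_ne_zero_iff.2 (fun h => h0 (h ▸ hy))

/-- Two paths inside a simply connected subset are homotopic. -/
theorem IsSimplyConnected.homotopic_of_mem {M : Type*} [TopologicalSpace M] {A : Set M}
    (hA : IsSimplyConnected A) {x y : M} (p q : Path x y) (hp : ∀ t, p t ∈ A)
    (hq : ∀ t, q t ∈ A) : p.Homotopic q := by
  have := hA.simplyConnectedSpace
  have hx : x ∈ A := by simpa using hp 0
  have hy : y ∈ A := by simpa using hp 1
  let p' : Path (⟨x, hx⟩ : A) ⟨y, hy⟩ :=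
    ⟨⟨fun t => ⟨p t, hp t⟩, by fun_prop⟩, by simp, by simp⟩
  let q' : Path (⟨x, hx⟩ : A) ⟨y, hy⟩ :=
    ⟨⟨fun t => ⟨q t, hq t⟩, by fun_prop⟩, by simp, by simp⟩
  have h := (SimplyConnectedSpace.paths_homotopic p' q').map ⟨Subtype.val, continuous_subtype_val⟩
  exact h

namespace IsHalfBallSystem

variable {m c : ℕ} {Y : Type*} [TopologicalSpace Y]
  {e : Fin c → EuclideanSpace ℝ (Fin (m + 2)) → Y}

/-- The union of the domes. -/
def domes (e : Fin c → EuclideanSpace ℝ (Fin (m + 2)) → Y) : Set Y := ⋃ k, e k '' halfBallDome m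

/-- The complement of the concentric half-balls of radius `r`. -/
def outside (e : Fin c → EuclideanSpace ℝ (Fin (m + 2)) → Y) (r : ℝ) : Set Y :=
  {y | ∀ k, ∀ x ∈ halfBall m, e k x = y → r < ‖x‖}

section
variable (he : IsHalfBallSystem e)
include he

theorem mem_image_iff {k : Fin c} {A : Set (EuclideanSpace ℝ (Fin (m + 2)))} (hA : A ⊆ halfBall m)
    {x : EuclideanSpace ℝ (Fin (m + 2))} (hx : x ∈ halfBall m) : e k x ∈ e k '' A ↔ x ∈ A := by
  refine ⟨?_, fun h => ⟨x, h, rfl⟩⟩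
  rintro ⟨y, hy, hyx⟩
  rwa [← (he.injective k k y (hA hy) x hx hyx).2]

theorem mem_outside_iff {k : Fin c} {x : EuclideanSpace ℝ (Fin (m + 2))} (hx : x ∈ halfBall m)
    {r : ℝ} : e k x ∈ outside e r ↔ r < ‖x‖ := by
  refine ⟨fun h => h k x hx rfl, fun h l y hy hyx => ?_⟩
  rwa [(he.injective l k y hy x hx hyx).2]

theorem mem_domes_iff {k : Fin c} {x : EuclideanSpace ℝ (Fin (m + 2))} (hx : x ∈ halfBall m) :
    e k x ∈ domes e ↔ x ∈ halfBallDome m := by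
  refine ⟨fun h => ?_, fun h => mem_iUnion.2 ⟨k, x, h, rfl⟩⟩
  obtain ⟨l, y, hy, hyx⟩ := mem_iUnion.1 h
  rwa [← (he.injective l k y (halfBallDome_subset m hy) x hx hyx).2]

omit [TopologicalSpace Y] he in
theorem outside_subset {r : ℝ} (hr : 1 ≤ r) : outside e r ⊆ (domes e)ᶜ := by
  intro y hy h
  obtain ⟨k, x, hx, rfl⟩ := mem_iUnion.1 h
  have := hy k x (halfBallDome_subset m hx) rfl
  linarith [hx.1]

theorem image_subset_compl_domes {k : Fin c} {A : Set (EuclideanSpace ℝ (Fin (m + 2)))}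
    (hA : A ⊆ halfBall m) (h : ∀ x ∈ A, x ∉ halfBallDome m) : e k '' A ⊆ (domes e)ᶜ := by
  rintro _ ⟨x, hx, rfl⟩ hd
  exact h x hx ((he.mem_domes_iff (hA hx)).1 hd)

variable [T2Space Y]

theorem isClosed_image {k : Fin c} {A : Set (EuclideanSpace ℝ (Fin (m + 2)))}
    (hA : IsClosed A) : IsClosed (e k '' (halfBall m ∩ A)) :=
  (((isCompact_halfBall m).inter_right hA).image_of_continuousOn
    ((he.continuousOn k).mono inter_subset_left)).isClosed

/-- By injectivity the image is the open image of the half-ball without its spherical part, minus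
the compact image of the complement of `U`. -/
theorem isOpen_image_inter {k : Fin c} {U : Set (EuclideanSpace ℝ (Fin (m + 2)))}
    (hU : IsOpen U) : IsOpen (e k '' {x | x ∈ halfBall m ∧ ‖x‖ < 2 ∧ x ∈ U}) := by
  have : e k '' {x | x ∈ halfBall m ∧ ‖x‖ < 2 ∧ x ∈ U} =
      e k '' {x | x ∈ halfBall m ∧ ‖x‖ < 2} \ e k '' (halfBall m ∩ Uᶜ) := by
    ext y
    constructor
    · rintro ⟨x, ⟨h1, h2, h3⟩, rfl⟩
      exact ⟨⟨x, ⟨h1, h2⟩, rfl⟩, fun h => ((he.mem_image_iff inter_subset_left h1).1 h).2 h3⟩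
    · rintro ⟨⟨x, ⟨h1, h2⟩, rfl⟩, h⟩
      exact ⟨x, ⟨h1, h2, by_contra fun h3 => h ⟨x, ⟨h1, h3⟩, rfl⟩⟩, rfl⟩
  rw [this]
  exact (he.isOpen_image k).sdiff (he.isClosed_image hU.isClosed_compl)

theorem isOpen_image_piece (k : Fin c) (s : Fin 3) : IsOpen (e k '' halfBallPiece m s) := by
  have h0 : Continuous (fun x : EuclideanSpace ℝ (Fin (m + 2)) => x 0) := by fun_prop
  fin_cases s
  · have : halfBallPiece m 0 = {x | x ∈ halfBall m ∧ ‖x‖ < 2 ∧ x ∈ {x | ‖x‖ < 1}} := by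
      ext x
      exact ⟨fun h => ⟨h.1, lt_trans h.2 (by norm_num), h.2⟩, fun h => ⟨h.1, h.2.2⟩⟩
    change IsOpen (e k '' halfBallPiece m 0)
    rw [this]
    exact he.isOpen_image_inter (isOpen_lt continuous_norm continuous_const)
  · exact he.isOpen_image_inter (isOpen_lt continuous_const h0)
  · exact he.isOpen_image_inter (isOpen_lt h0 continuous_const)

theorem isOpen_outside (r : ℝ) : IsOpen (outside e r) := by
  have : outside e r = (⋃ k, e k '' (halfBall m ∩ {x | ‖x‖ ≤ r}))ᶜ := by
    ext y
    simp only [outside, mem_ofPred_eq, mem_compl_iff, mem_iUnion, not_exists]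
    constructor
    · rintro h k ⟨x, ⟨hx, hr⟩, rfl⟩
      exact absurd (h k x hx rfl) (not_lt.2 hr)
    · rintro h k x hx rfl
      by_contra hr
      exact h k ⟨x, ⟨hx, not_lt.1 hr⟩, rfl⟩
  rw [this, isOpen_compl_iff]
  exact isClosed_iUnion_of_finite fun k =>
    he.isClosed_image (isClosed_le continuous_norm continuous_const)

/-- Continuous functions on the half-balls that match a continuous function on the spherical parts
glue to a continuous function. -/
theorem exists_glue {Z : Type*} [TopologicalSpace Z]
    (h : Fin c → EuclideanSpace ℝ (Fin (m + 2)) → Z) (hh : ∀ k, ContinuousOn (h k) (halfBall m))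
    (j : C(Y, Z)) (hj : ∀ k, ∀ x ∈ halfBall m, ‖x‖ = 2 → h k x = j (e k x)) :
    ∃ f : C(Y, Z), (∀ k, ∀ x ∈ halfBall m, f (e k x) = h k x) ∧
      ∀ y, (∀ k, ∀ x ∈ halfBall m, e k x ≠ y) → f y = j y := by
  classical
  let f : Y → Z := fun y => if hy : ∃ kx : Fin c × EuclideanSpace ℝ (Fin (m + 2)),
    kx.2 ∈ halfBall m ∧ e kx.1 kx.2 = y then h hy.choose.1 hy.choose.2 else j y
  have f1 : ∀ k, ∀ x ∈ halfBall m, f (e k x) = h k x := by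
    intro k x hx
    have hy : ∃ kx : Fin c × EuclideanSpace ℝ (Fin (m + 2)),
      kx.2 ∈ halfBall m ∧ e kx.1 kx.2 = e k x := ⟨(k, x), hx, rfl⟩
    have := he.injective _ _ _ hy.choose_spec.1 _ hx hy.choose_spec.2
    simp only [f, dif_pos hy]
    rw [this.1, this.2]
  have f2 : ∀ y, (∀ k, ∀ x ∈ halfBall m, e k x ≠ y) → f y = j y := by
    intro y hy
    have : ¬ ∃ kx : Fin c × EuclideanSpace ℝ (Fin (m + 2)),
      kx.2 ∈ halfBall m ∧ e kx.1 kx.2 = y := fun ⟨kx, h1, h2⟩ => hy _ _ h1 h2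
    simp only [f, dif_neg this]
  refine ⟨⟨f, ?_⟩, f1, f2⟩
  -- A finite closed cover: the compact half-balls, and the complement of their open parts. The two
  -- formulas overlap on the spherical parts only.
  let F : Option (Fin c) → Set Y := fun o => o.elim (⋃ k, e k '' {x | x ∈ halfBall m ∧ ‖x‖ < 2})ᶜ
    (fun k => e k '' (halfBall m ∩ univ))
  refine LocallyFinite.continuous (f := F) (locallyFinite_of_finite F) ?_ ?_ ?_
  · refine eq_univ_of_forall fun y => mem_iUnion.2 ?_
    by_cases hy : y ∈ ⋃ k, e k '' {x | x ∈ halfBall m ∧ ‖x‖ < 2}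
    · obtain ⟨k, x, hx, rfl⟩ := mem_iUnion.1 hy
      exact ⟨some k, x, ⟨hx.1, trivial⟩, rfl⟩
    · exact ⟨none, hy⟩
  · rintro (_ | k)
    · exact (isOpen_iUnion fun k => he.isOpen_image k).isClosed_compl
    · exact he.isClosed_image isClosed_univ
  · rintro (_ | k)
    · refine j.continuous.continuousOn.congr fun y hy => ?_
      by_cases h' : ∀ k, ∀ x ∈ halfBall m, e k x ≠ y
      · exact f2 y h'
      · push Not at h'
        obtain ⟨k, x, hx, rfl⟩ := h'
        rw [f1 k x hx]
        refine hj k x hx (le_antisymm hx.1 (not_lt.1 fun hlt => hy (mem_iUnion.2 ⟨k, x, ⟨hx, hlt⟩, rfl⟩)))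
    · rw [continuousOn_iff_isClosed]
      intro t ht
      obtain ⟨u, hu, hut⟩ := continuousOn_iff_isClosed.1 (hh k) t ht
      refine ⟨e k '' (halfBall m ∩ u), he.isClosed_image hu, ?_⟩
      ext y
      constructor
      · rintro ⟨hy, x, ⟨hx, -⟩, rfl⟩
        rw [mem_preimage, f1 k x hx] at hy
        exact ⟨⟨x, ⟨hx, (hut.subset ⟨hy, hx⟩).1⟩, rfl⟩, x, ⟨hx, trivial⟩, rfl⟩
      · rintro ⟨⟨x, ⟨hx, hxu⟩, rfl⟩, -⟩
        refine ⟨?_, x, ⟨hx, trivial⟩, rfl⟩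
        rw [mem_preimage, f1 k x hx]
        exact (hut.symm.subset ⟨hxu, hx⟩).1

/-- On the compact half-ball `e k` is an embedding into a Hausdorff space, so images of convex sets
are contractible. -/
theorem isSimplyConnected_image {k : Fin c} {A : Set (EuclideanSpace ℝ (Fin (m + 2)))}
    (hA : A ⊆ halfBall m) (hconv : Convex ℝ A) (hne : A.Nonempty) :
    IsSimplyConnected (e k '' A) := by
  have : CompactSpace (halfBall m) := isCompact_iff_compactSpace.1 (isCompact_halfBall m)
  have hemb : Topology.IsEmbedding ((halfBall m).domRestrict (e k)) := by
    refine (Continuous.isClosedEmbedding (continuousOn_iff_continuous_domRestrict.1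
      (he.continuousOn k)) ?_).isEmbedding
    intro x y hxy
    exact Subtype.ext (he.injective k k x x.2 y y.2 hxy).2
  have h1 : e k '' A = (halfBall m).domRestrict (e k) '' (Subtype.val ⁻¹' A) := by
    ext y
    constructor
    · rintro ⟨x, hx, rfl⟩
      exact ⟨⟨x, hA hx⟩, hx, rfl⟩
    · rintro ⟨x, hx, rfl⟩
      exact ⟨x, hx, rfl⟩
  rw [h1, hemb.isSimplyConnected_image, ← Topology.IsEmbedding.subtypeVal.isSimplyConnected_image,
    Subtype.image_preimage_coe, inter_eq_right.2 hA]
  have := hconv.contractibleSpace hne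
  exact (inferInstance : SimplyConnectedSpace A)

end

end IsHalfBallSystem

/-! ### Pushing into the exterior of the unit half-balls -/

/-- Raise the last coordinate of a point of the half-ball to push it out of the ball of radius `R`. -/
noncomputable def raise (m : ℕ) (R : ℝ) (x : EuclideanSpace ℝ (Fin (m + 2))) :
    EuclideanSpace ℝ (Fin (m + 2)) :=
  x + (Real.sqrt (max (R ^ 2 - ‖x‖ ^ 2 + x (Fin.last (m + 1)) ^ 2) (x (Fin.last (m + 1)) ^ 2))
    - x (Fin.last (m + 1))) • EuclideanSpace.single (Fin.last (m + 1)) 1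

theorem continuous_raise (m : ℕ) (R : ℝ) : Continuous (raise m R) := by
  unfold raise; fun_prop

theorem norm_sq_add_smul_single {m : ℕ} (x : EuclideanSpace ℝ (Fin (m + 2))) (s : ℝ) :
    ‖x + (s - x (Fin.last (m + 1))) • EuclideanSpace.single (Fin.last (m + 1)) (1 : ℝ)‖ ^ 2 =
      ‖x‖ ^ 2 - x (Fin.last (m + 1)) ^ 2 + s ^ 2 := by
  rw [norm_add_sq_real, norm_smul, inner_smul_right, EuclideanSpace.inner_single_right]
  simp
  ring

/-- The square root in `raise` is chosen for this formula: points of norm at least `R` stay put, and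
all others land on the sphere of radius `R`. -/
theorem norm_sq_raise {m : ℕ} (R : ℝ) (x : EuclideanSpace ℝ (Fin (m + 2))) :
    ‖raise m R x‖ ^ 2 = max (R ^ 2) (‖x‖ ^ 2) := by
  rw [raise, norm_sq_add_smul_single, Real.sq_sqrt (le_max_of_le_right (sq_nonneg _)),
    add_comm, max_add]
  congr 1 <;> ring

theorem raise_mem {m : ℕ} {R : ℝ} (hR0 : 0 ≤ R) (hR : R ≤ 2) {x : EuclideanSpace ℝ (Fin (m + 2))}
    (hx : x ∈ halfBall m) : raise m R x ∈ halfBall m := by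
  constructor
  · have h := norm_sq_raise R x
    have h1 : ‖x‖ ^ 2 ≤ 2 ^ 2 := pow_le_pow_left₀ (norm_nonneg _) hx.1 2
    have h2 : R ^ 2 ≤ 2 ^ 2 := pow_le_pow_left₀ hR0 hR 2
    exact le_of_sq_le_sq (h.trans_le (max_le h2 h1)) (by norm_num)
  · simp [raise, Real.sqrt_nonneg]

theorem raise_eq_self {m : ℕ} {R : ℝ} (hR0 : 0 ≤ R) {x : EuclideanSpace ℝ (Fin (m + 2))}
    (hx : x ∈ halfBall m) (hRx : R ≤ ‖x‖) : raise m R x = x := by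
  have h : R ^ 2 ≤ ‖x‖ ^ 2 := pow_le_pow_left₀ hR0 hRx 2
  rw [raise, max_eq_right (by linarith), Real.sqrt_sq hx.2]
  simp

theorem le_norm_raise {m : ℕ} {R : ℝ} (x : EuclideanSpace ℝ (Fin (m + 2))) :
    R ≤ ‖raise m R x‖ :=
  le_of_sq_le_sq ((le_max_left _ _).trans_eq (norm_sq_raise R x).symm) (norm_nonneg _)

namespace IsHalfBallSystem

open Path.Homotopic.Quotient (trans symm refl mk trans_assoc)
open PathClass

variable {m c : ℕ} {Y : Type*} [TopologicalSpace Y] [T2Space Y]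
  {e : Fin c → EuclideanSpace ℝ (Fin (m + 2)) → Y}

section
variable (he : IsHalfBallSystem e)
include he

/-- The norm in half-ball coordinates extends by the constant 2, its value on the spherical parts.
Having the exteriors as superlevel sets of a continuous function gives compact sets a definite
distance from the unit half-balls. -/
theorem exists_radius : ∃ g : C(Y, ℝ), (∀ k, ∀ x ∈ halfBall m, g (e k x) = ‖x‖) ∧
    ∀ r < 2, ∀ y, y ∈ outside e r ↔ r < g y := by
  obtain ⟨g, hg1, hg2⟩ := he.exists_glue (fun _ x => ‖x‖) (fun _ => by fun_prop)
    (ContinuousMap.const Y 2) (fun _ _ _ h => h)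
  refine ⟨g, hg1, fun r hr y => ?_⟩
  by_cases h' : ∀ k, ∀ x ∈ halfBall m, e k x ≠ y
  · rw [hg2 y h']
    exact ⟨fun _ => hr, fun _ k x hx h => absurd h (h' k x hx)⟩
  · push Not at h'
    obtain ⟨k, x, hx, rfl⟩ := h'
    rw [hg1 k x hx, he.mem_outside_iff hx]

/-- Raise inside the half-balls and do nothing elsewhere; `R ≤ 2` makes the two agree on the
spherical parts. The radius is left free because the exterior is open: no single `R > 1` gives a map
fixing all of it. -/
theorem exists_push {R : ℝ} (hR0 : 1 < R) (hR : R ≤ 2) : ∃ f : C(Y, Y),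
    (∀ y, f y ∈ outside e 1) ∧ ∀ y, (∀ s < R, y ∈ outside e s) → f y = y := by
  obtain ⟨f, hf1, hf2⟩ := he.exists_glue (fun k x => e k (raise m R x))
    (fun k => (he.continuousOn k).comp (continuous_raise m R).continuousOn
      (fun x hx => raise_mem (by linarith) hR hx))
    (ContinuousMap.id Y) (fun k x hx h => by
      rw [raise_eq_self (by linarith) hx (by linarith)]; rfl)
  refine ⟨f, fun y => ?_, fun y hy => ?_⟩
  · by_cases h' : ∀ k, ∀ x ∈ halfBall m, e k x ≠ y
    · rw [hf2 y h']
      exact fun k x hx h => absurd h (h' k x hx)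
    · push Not at h'
      obtain ⟨k, x, hx, rfl⟩ := h'
      rw [hf1 k x hx, he.mem_outside_iff (raise_mem (by linarith) hR hx)]
      exact lt_of_lt_of_le hR0 (le_norm_raise x)
  · by_cases h' : ∀ k, ∀ x ∈ halfBall m, e k x ≠ y
    · exact hf2 y h'
    · push Not at h'
      obtain ⟨k, x, hx, rfl⟩ := h'
      rw [hf1 k x hx, raise_eq_self (by linarith) hx]
      exact le_of_forall_lt fun s hs => hy s hs k x hx rfl

/-- A compact part of the exterior of the unit half-balls is fixed by a map of the whole space into
the exterior. -/
theorem exists_push_of_isCompact {S : Set Y} (hS : IsCompact S) (hS1 : S ⊆ outside e 1) :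
    ∃ f : C(Y, Y), (∀ y, f y ∈ outside e 1) ∧ ∀ y ∈ S, f y = y := by
  obtain ⟨g, -, hg⟩ := he.exists_radius
  have : ∃ R, 1 < R ∧ R ≤ 2 ∧ ∀ y ∈ S, R ≤ g y := by
    rcases S.eq_empty_or_nonempty with rfl | hne
    · exact ⟨2, by norm_num, le_rfl, by simp⟩
    · obtain ⟨y₀, hy₀, hmin⟩ := hS.exists_isMinOn hne g.continuous.continuousOn
      refine ⟨min (g y₀) 2, lt_min ((hg 1 (by norm_num) y₀).1 (hS1 hy₀)) (by norm_num),
        min_le_right _ _, fun y hy => (min_le_left _ _).trans (hmin hy)⟩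
  obtain ⟨R, hR1, hR2, hR⟩ := this
  obtain ⟨f, hf1, hf2⟩ := he.exists_push hR1 hR2
  exact ⟨f, hf1, fun y hy => hf2 y fun s hs =>
    (hg s (by linarith) y).2 (lt_of_lt_of_le hs (hR y hy))⟩

/-- Compose a path of `Y` with a push that fixes its two endpoints. -/
theorem isPathConnected_outside [PathConnectedSpace Y] (hne : (outside e 1).Nonempty) :
    IsPathConnected (outside e 1) := by
  obtain ⟨a, ha⟩ := hne
  refine ⟨a, ha, fun {b} hb => ?_⟩
  obtain ⟨f, hf, hfix⟩ := he.exists_push_of_isCompact (S := {a, b}) (by simp)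
    (by rintro y (rfl | rfl) <;> assumption)
  let p := ((PathConnectedSpace.somePath a b).map f.continuous).cast
    (hfix a (by simp)).symm (hfix b (by simp)).symm
  exact ⟨p, fun t => hf _⟩

/-- Compose a homotopy in `Y` with a push that fixes both paths. The result avoids the domes. -/
theorem homotopic_outside [SimplyConnectedSpace Y] {x y : ↥(domes e)ᶜ} (p q : Path x y)
    (hp : ∀ t, (p t : Y) ∈ outside e 1) (hq : ∀ t, (q t : Y) ∈ outside e 1) : p.Homotopic q := by
  obtain ⟨f, hf, hfix⟩ := he.exists_push_of_isCompact
    (S := range (fun t => (p t : Y)) ∪ range (fun t => (q t : Y)))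
    ((isCompact_range (by fun_prop)).union (isCompact_range (by fun_prop)))
    (by rintro y (⟨t, rfl⟩ | ⟨t, rfl⟩); exacts [hp t, hq t])
  obtain ⟨F⟩ := SimplyConnectedSpace.paths_homotopic (p.map continuous_subtype_val)
    (q.map continuous_subtype_val)
  have hpt : ∀ t, f (p t) = p t := fun t => hfix _ (Or.inl ⟨t, rfl⟩)
  have hqt : ∀ t, f (q t) = q t := fun t => hfix _ (Or.inr ⟨t, rfl⟩)
  refine ⟨⟨⟨⟨fun z => ⟨f (F z), outside_subset le_rfl (hf _)⟩, by fun_prop⟩, ?_, ?_⟩, ?_⟩⟩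
  · intro t
    apply Subtype.ext
    simpa using hpt t
  · intro t
    apply Subtype.ext
    simpa using hqt t
  · rintro s t (rfl | rfl)
    · apply Subtype.ext
      simpa using hpt 0
    · apply Subtype.ext
      simpa using hpt 1

end

/-! ### Generators of the fundamental group of the complement of the domes -/

/-- The cover of the complement of the domes by the exterior of the unit half-balls and the images of
the convex pieces of the half-balls. -/
def cover (e : Fin c → EuclideanSpace ℝ (Fin (m + 2)) → Y) : Option (Fin c × Fin 3) → Set Y
  | none => outside e 1
  | some (k, s) => e k '' halfBallPiece m s

section
variable (he : IsHalfBallSystem e)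
include he

omit [T2Space Y] in
theorem cover_subset (a : Option (Fin c × Fin 3)) : cover e a ⊆ (domes e)ᶜ := by
  rcases a with _ | ⟨k, s⟩
  · exact outside_subset le_rfl
  · exact he.image_subset_compl_domes (halfBallPiece_subset m s)
      (fun x hx => disjoint_halfBallPiece_dome hx)

theorem isOpen_cover (a : Option (Fin c × Fin 3)) : IsOpen (cover e a) := by
  rcases a with _ | ⟨k, s⟩
  exacts [he.isOpen_outside 1, he.isOpen_image_piece k s]

omit [T2Space Y] in
theorem exists_mem_cover {y : Y} (hy : y ∉ domes e) : ∃ a, y ∈ cover e a := by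
  by_cases h' : y ∈ outside e 1
  · exact ⟨none, h'⟩
  · simp only [outside, mem_ofPred_eq, not_forall, not_lt] at h'
    obtain ⟨k, x, hx, rfl, h1⟩ := h'
    rw [he.mem_domes_iff hx] at hy
    rcases lt_trichotomy (x 0) 0 with h0 | h0 | h0
    · exact ⟨some (k, 2), x, ⟨hx, lt_of_le_of_lt h1 (by norm_num), h0⟩, rfl⟩
    -- On the hyperplane of the dome, a point of norm at most 1 off the dome has norm less than 1.
    · refine ⟨some (k, 0), x, ⟨hx, lt_of_le_of_ne h1 fun h => hy ⟨h, h0, hx.2⟩⟩, rfl⟩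
    · exact ⟨some (k, 1), x, ⟨hx, lt_of_le_of_lt h1 (by norm_num), h0⟩, rfl⟩

theorem homotopic_of_mem_cover [SimplyConnectedSpace Y] (a : Option (Fin c × Fin 3))
    {x y : ↥(domes e)ᶜ} (p q : Path x y) (hp : ∀ t, (p t : Y) ∈ cover e a)
    (hq : ∀ t, (q t : Y) ∈ cover e a) : p.Homotopic q := by
  rcases a with _ | ⟨k, s⟩
  · exact he.homotopic_outside p q hp hq
  · refine IsSimplyConnected.homotopic_of_mem (A := Subtype.val ⁻¹' cover e (some (k, s))) ?_
      p q hp hq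
    rw [← Topology.IsEmbedding.subtypeVal.isSimplyConnected_image, Subtype.image_preimage_coe,
      inter_eq_right.2 (he.cover_subset _)]
    refine he.isSimplyConnected_image (halfBallPiece_subset m s) (convex_halfBallPiece m s) ?_
    obtain ⟨z, hz, -⟩ := hp 0
    exact ⟨z, hz⟩

-- The inner half-ball misses the exterior, and a side meets it in the shell `1 < ‖x‖ < 2` of a
-- convex cone.
omit [T2Space Y] in
theorem isPathConnected_piece_inter_outside {k : Fin c} {s : Fin 3}
    (hne : (e k '' halfBallPiece m s ∩ outside e 1).Nonempty) :
    IsPathConnected (e k '' halfBallPiece m s ∩ outside e 1) := by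
  have hs : s ≠ 0 := by
    rintro rfl
    obtain ⟨_, ⟨x, hx, rfl⟩, h⟩ := hne
    have := (he.mem_outside_iff hx.1).1 h
    linarith [hx.2]
  obtain ⟨C, hC, hC0, hCc, hCs⟩ : ∃ C : Set (EuclideanSpace ℝ (Fin (m + 2))), Convex ℝ C ∧
      (0 : EuclideanSpace ℝ (Fin (m + 2))) ∉ C ∧ (∀ x ∈ C, ∀ r : ℝ, 0 < r → r • x ∈ C) ∧
      ∀ x, (x ∈ halfBallPiece m s ∧ 1 < ‖x‖) ↔ x ∈ C ∧ 1 < ‖x‖ ∧ ‖x‖ < 2 := by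
    have hlin : ∀ i, IsLinearMap ℝ (fun x : EuclideanSpace ℝ (Fin (m + 2)) => x i) :=
      fun i => ⟨fun _ _ => rfl, fun _ _ => rfl⟩
    fin_cases s
    · exact absurd rfl hs
    · refine ⟨{x | 0 ≤ x (Fin.last (m + 1))} ∩ {x | 0 < x 0},
        (convex_halfSpace_ge (hlin _) 0).inter (convex_halfSpace_gt (hlin 0) 0), by simp, ?_, ?_⟩
      · rintro x ⟨h1, h2⟩ r hr
        exact ⟨mul_nonneg hr.le h1, mul_pos hr h2⟩
      · intro x
        exact ⟨fun ⟨⟨h1, h2, h3⟩, h4⟩ => ⟨⟨h1.2, h3⟩, h4, h2⟩,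
          fun ⟨⟨h1, h3⟩, h4, h2⟩ => ⟨⟨⟨h2.le, h1⟩, h2, h3⟩, h4⟩⟩
    · refine ⟨{x | 0 ≤ x (Fin.last (m + 1))} ∩ {x | x 0 < 0},
        (convex_halfSpace_ge (hlin _) 0).inter (convex_halfSpace_lt (hlin 0) 0), by simp, ?_, ?_⟩
      · rintro x ⟨h1, h2⟩ r hr
        exact ⟨mul_nonneg hr.le h1, mul_neg_of_pos_of_neg hr h2⟩
      · intro x
        exact ⟨fun ⟨⟨h1, h2, h3⟩, h4⟩ => ⟨⟨h1.2, h3⟩, h4, h2⟩,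
          fun ⟨⟨h1, h3⟩, h4, h2⟩ => ⟨⟨⟨h2.le, h1⟩, h2, h3⟩, h4⟩⟩
  have heq : e k '' halfBallPiece m s ∩ outside e 1 =
      e k '' {x | x ∈ C ∧ 1 < ‖x‖ ∧ ‖x‖ < 2} := by
    ext y
    constructor
    · rintro ⟨⟨x, hx, rfl⟩, h⟩
      exact ⟨x, (hCs x).1 ⟨hx, (he.mem_outside_iff (halfBallPiece_subset m s hx)).1 h⟩, rfl⟩
    · rintro ⟨x, hx, rfl⟩
      have := (hCs x).2 hx
      exact ⟨⟨x, this.1, rfl⟩, (he.mem_outside_iff (halfBallPiece_subset m s this.1)).2 this.2⟩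
  have hCne : C.Nonempty := by
    rw [heq] at hne
    obtain ⟨_, x, hx, -⟩ := hne
    exact ⟨x, hx.1⟩
  rw [heq]
  refine (isPathConnected_shell (hC.isPathConnected hCne) hC0 hCc zero_le_one
    one_lt_two).image' ((he.continuousOn k).mono fun x hx => ?_)
  exact halfBallPiece_subset m s ((hCs x).2 hx).1

/-- Pieces of different half-balls are disjoint, and two pieces of the same half-ball meet in the
image of a convex set. -/
theorem isPathConnected_cover_inter [PathConnectedSpace Y] (a a' : Option (Fin c × Fin 3))
    (hne : (cover e a ∩ cover e a').Nonempty) : IsPathConnected (cover e a ∩ cover e a') := by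
  rcases a with _ | ⟨k, s⟩ <;> rcases a' with _ | ⟨l, s'⟩
  · simp only [cover, inter_self] at hne ⊢
    exact he.isPathConnected_outside hne
  · rw [inter_comm] at hne ⊢
    exact he.isPathConnected_piece_inter_outside hne
  · exact he.isPathConnected_piece_inter_outside hne
  · obtain rfl : k = l := by
      obtain ⟨_, ⟨x, hx, rfl⟩, ⟨y, hy, hyx⟩⟩ := hne
      exact (he.injective _ _ _ (halfBallPiece_subset m _ hy) _ (halfBallPiece_subset m _ hx)
        hyx).1.symm
    have heq : cover e (some (k, s)) ∩ cover e (some (k, s')) =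
        e k '' (halfBallPiece m s ∩ halfBallPiece m s') := by
      ext y
      constructor
      · rintro ⟨⟨x, hx, rfl⟩, ⟨x', hx', hxx'⟩⟩
        obtain rfl := (he.injective _ _ _ (halfBallPiece_subset m _ hx') _
          (halfBallPiece_subset m _ hx) hxx').2
        exact ⟨x', ⟨hx, hx'⟩, rfl⟩
      · rintro ⟨x, ⟨hx, hx'⟩, rfl⟩
        exact ⟨⟨x, hx, rfl⟩, ⟨x, hx', rfl⟩⟩
    rw [heq] at hne ⊢
    exact (((convex_halfBallPiece m s).inter (convex_halfBallPiece m s')).isPathConnected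
      hne.of_image).image' ((he.continuousOn k).mono
        (inter_subset_left.trans (halfBallPiece_subset m s)))

theorem joinedIn_cover_inter [PathConnectedSpace Y] (a a' : Option (Fin c × Fin 3))
    {x y : ↥(domes e)ᶜ} (hx : (x : Y) ∈ cover e a ∩ cover e a')
    (hy : (y : Y) ∈ cover e a ∩ cover e a') :
    JoinedIn (Subtype.val ⁻¹' (cover e a ∩ cover e a')) x y :=
  ((he.isPathConnected_cover_inter a a' ⟨_, hx⟩).preimage_coe
    (inter_subset_left.trans (he.cover_subset a))).joinedIn _ hx _ hy

/-- **The fundamental group of the complement of the domes** is generated by one loop for each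
half-ball, which passes through the exterior, the left side, the interior and the right side. -/
theorem subgroup_eq_top [SimplyConnectedSpace Y] {x₀ : ↥(domes e)ᶜ} (hx₀ : (x₀ : Y) ∈ outside e 1)
    (H : Subgroup (FundamentalGroup ↥(domes e)ᶜ x₀))
    (hH : ∀ k, ∃ (q q' z z' : ↥(domes e)ᶜ) (η : Path.Homotopic.Quotient x₀ q)
      (c₁ : Path.Homotopic.Quotient q q') (c₂ : Path.Homotopic.Quotient q' z)
      (c₃ : Path.Homotopic.Quotient z z') (c₄ : Path.Homotopic.Quotient z' q),
      LiesIn (Subtype.val ⁻¹' outside e 1) η ∧ LiesIn (Subtype.val ⁻¹' outside e 1) c₁ ∧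
      LiesIn (Subtype.val ⁻¹' (e k '' halfBallPiece m 2)) c₂ ∧
      LiesIn (Subtype.val ⁻¹' (e k '' halfBallPiece m 0)) c₃ ∧
      LiesIn (Subtype.val ⁻¹' (e k '' halfBallPiece m 1)) c₄ ∧
      FundamentalGroup.fromPath (trans (trans η (trans c₁ (trans c₂ (trans c₃ c₄)))) (symm η)) ∈ H) :
    H = ⊤ := by
  choose q q' z z' η c₁ c₂ c₃ c₄ hη h₁ h₂ h₃ h₄ hmem using hH
  -- Tethers along a spanning tree of the nerve: piece 1 is reached from the exterior by `η`, piece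
  -- 2 by `η` and `c₁`, and piece 0 from piece 1 by going back along `c₄`. Intersections on the tree
  -- then give trivial loops.
  let b : Option (Fin c × Fin 3) → ↥(domes e)ᶜ
    | none => x₀
    | some (k, 0) => z' k
    | some (k, 1) => q k
    | some (k, 2) => q' k
  let θ : ∀ a, Path.Homotopic.Quotient x₀ (b a)
    | none => refl x₀
    | some (k, 0) => trans (η k) (symm (c₄ k))
    | some (k, 1) => η k
    | some (k, 2) => trans (η k) (c₁ k)
  have hb : ∀ a, (b a : Y) ∈ cover e a
    | none => hx₀
    | some (k, 0) => (h₃ k).target_mem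
    | some (k, 1) => (h₄ k).target_mem
    | some (k, 2) => (h₂ k).source_mem
  let Good : Option (Fin c × Fin 3) → Option (Fin c × Fin 3) → Prop := fun a a' =>
    ∃ w ∈ Subtype.val ⁻¹' cover e a ∩ Subtype.val ⁻¹' cover e a',
      ∃ (p : Path.Homotopic.Quotient (b a) w) (q : Path.Homotopic.Quotient (b a') w),
        LiesIn (Subtype.val ⁻¹' cover e a) p ∧ LiesIn (Subtype.val ⁻¹' cover e a') q ∧
        FundamentalGroup.fromPath (trans (trans (θ a) p) (symm (trans (θ a') q))) ∈ H
  have good_refl : ∀ a, Good a a := fun a => by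
    refine ⟨b a, ⟨hb a, hb a⟩, refl _, refl _, LiesIn.refl (hb a), LiesIn.refl (hb a), ?_⟩
    convert H.one_mem using 1
    simp
    rfl
  have good_symm : ∀ a a', Good a a' → Good a' a := by
    rintro a a' ⟨w, hw, p, q, hp, hq, h⟩
    refine ⟨w, hw.symm, q, p, hq, hp, ?_⟩
    convert H.inv_mem h using 1
    change _ = ((trans (θ a) p).trans _).symm
    simp [symm_trans_rev, symm_symm', trans_assoc]
  have good_one : ∀ {a a'} {w : ↥(domes e)ᶜ} (p : Path.Homotopic.Quotient (b a) w)
      (q : Path.Homotopic.Quotient (b a') w), LiesIn (Subtype.val ⁻¹' cover e a) p →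
      LiesIn (Subtype.val ⁻¹' cover e a') q → trans (θ a) p = trans (θ a') q → Good a a' := by
    intro a a' w p q hp hq h
    refine ⟨w, ⟨hp.target_mem, hq.target_mem⟩, p, q, hp, hq, ?_⟩
    convert H.one_mem using 1
    rw [h]
    simp
    rfl
  have good_outside : ∀ k s, s ≠ 0 → Good none (some (k, s)) := by
    intro k s hs
    fin_cases s
    · exact absurd rfl hs
    · exact good_one (a' := some (k, 1)) (η k) (refl _) (hη k) (LiesIn.refl (hb (some (k, 1))))
        (by simp [θ])
    · exact good_one (a' := some (k, 2)) (trans (η k) (c₁ k)) (refl _) ((hη k).trans (h₁ k))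
        (LiesIn.refl (hb (some (k, 2)))) (by simp [θ])
  have not_zero : ∀ k s, (cover e none ∩ cover e (some (k, s))).Nonempty → s ≠ 0 := by
    rintro k _ ⟨_, h, ⟨x, hx, rfl⟩⟩ rfl
    have := (he.mem_outside_iff hx.1).1 h
    linarith [hx.2]
  have good_piece : ∀ k s s', s < s' →
      (cover e (some (k, s)) ∩ cover e (some (k, s'))).Nonempty → Good (some (k, s)) (some (k, s')) := by
    intro k s s' hlt hne
    have hs : s = 0 ∧ s' = 1 ∨ s = 0 ∧ s' = 2 ∨ s = 1 ∧ s' = 2 := by omega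
    rcases hs with ⟨rfl, rfl⟩ | ⟨rfl, rfl⟩ | ⟨rfl, rfl⟩
    · exact good_one (a := some (k, 0)) (a' := some (k, 1)) (refl _) (symm (c₄ k))
        (LiesIn.refl (hb (some (k, 0)))) (h₄ k).symm (by simp [θ])
    -- The remaining edge, between pieces 0 and 2, closes the cycle; its loop is the given
    -- generator.
    · refine good_symm _ _ ⟨z k, ⟨(h₂ k).target_mem, (h₃ k).source_mem⟩, c₂ k, symm (c₃ k), h₂ k,
        (h₃ k).symm, ?_⟩
      convert hmem k using 1
      simp [θ, symm_trans_rev, symm_symm', trans_assoc]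
    -- The two sides of the hyperplane do not meet.
    · obtain ⟨_, ⟨x, hx, rfl⟩, ⟨y, hy, hxy⟩⟩ := hne
      obtain rfl := (he.injective _ _ _ (halfBallPiece_subset m _ hy) _
        (halfBallPiece_subset m _ hx) hxy).2
      exact absurd hy.2.2 (lt_asymm hx.2.2)
  refine subgroup_eq_top_of_cover (fun a => Subtype.val ⁻¹' cover e a)
    (fun a => (he.isOpen_cover a).preimage continuous_subtype_val)
    (fun y => he.exists_mem_cover y.2) ?_
    (fun a x y p q hp hq => he.homotopic_of_mem_cover a p q hp hq) ?_ H b hb θ ?_ none (refl x₀)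
    (LiesIn.refl hx₀) ?_
  · intro a x hx y hy
    have := he.joinedIn_cover_inter a a ⟨hx, hx⟩ ⟨hy, hy⟩
    rwa [inter_self] at this
  · intro a a' x hx y hy
    exact he.joinedIn_cover_inter a a' hx hy
  · rintro a a' ⟨w, hw⟩
    rcases a with _ | ⟨k, s⟩ <;> rcases a' with _ | ⟨l, s'⟩
    · exact good_refl _
    · exact good_outside l s' (not_zero _ _ ⟨w, hw⟩)
    · exact good_symm _ _ (good_outside k s (not_zero _ _ ⟨w, hw.symm⟩))
    · obtain rfl : k = l := by
        obtain ⟨⟨x, hx, hxw⟩, ⟨y, hy, hyw⟩⟩ := hw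
        exact (he.injective _ _ _ (halfBallPiece_subset m _ hx) _ (halfBallPiece_subset m _ hy)
          (hxw.trans hyw.symm)).1
      rcases lt_trichotomy s s' with h | rfl | h
      · exact good_piece k s s' h ⟨w, hw⟩
      · exact good_refl _
      · exact good_symm _ _ (good_piece k s' s h ⟨w, hw.symm⟩)
  · convert H.one_mem using 1
    simp [θ]
    rfl

end

end IsHalfBallSystem

/-! ### Cutting paths, and pushing loops into the boundary -/

namespace PathClass

open Path.Homotopic.Quotient (trans symm refl mk trans_assoc)

variable {M : Type*} [TopologicalSpace M]

/-- The loops that can be pushed into `A`. -/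
def subgroupLiesIn (A : Set M) {x : M} (hx : x ∈ A) : Subgroup (FundamentalGroup M x) where
  carrier := {c | LiesIn A (FundamentalGroup.toPath c)}
  mul_mem' := fun hc hd => LiesIn.trans hd hc
  one_mem' := LiesIn.refl hx
  inv_mem' := fun hc => LiesIn.symm hc

/-- Cut a path into four pieces. -/
theorem exists_split {x y : M} (p : Path x y) (t₁ t₂ t₃ : unitInterval) (h₁₂ : t₁ ≤ t₂)
    (h₂₃ : t₂ ≤ t₃) : ∃ (c₁ : Path.Homotopic.Quotient x (p t₁))
      (c₂ : Path.Homotopic.Quotient (p t₁) (p t₂)) (c₃ : Path.Homotopic.Quotient (p t₂) (p t₃))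
      (c₄ : Path.Homotopic.Quotient (p t₃) y), mk p = trans c₁ (trans c₂ (trans c₃ c₄)) ∧
      (∀ S : Set M, (∀ t, t ≤ t₁ → p t ∈ S) → LiesIn S c₁) ∧
      (∀ S : Set M, (∀ t, t₁ ≤ t → t ≤ t₂ → p t ∈ S) → LiesIn S c₂) ∧
      (∀ S : Set M, (∀ t, t₂ ≤ t → t ≤ t₃ → p t ∈ S) → LiesIn S c₃) ∧
      (∀ S : Set M, (∀ t, t₃ ≤ t → p t ∈ S) → LiesIn S c₄) := by
  have hsub : ∀ (S : Set M) (a b : unitInterval), a ≤ b → (∀ t, a ≤ t → t ≤ b → p t ∈ S) →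
      LiesIn S (mk (p.subpath a b)) := by
    intro S a b hab h
    refine LiesIn.of_path _ fun s => ?_
    have hs : p.subpath a b s ∈ range (p.subpath a b) := ⟨s, rfl⟩
    rw [Path.range_subpath_of_le _ _ _ hab] at hs
    obtain ⟨u, hu, hus⟩ := hs
    rw [← hus]
    exact h u hu.1 hu.2
  have hcat : ∀ a b d : unitInterval, trans (mk (p.subpath a b)) (mk (p.subpath b d)) =
      mk (p.subpath a d) := fun a b d =>
    Path.Homotopic.Quotient.eq.2 ⟨Path.Homotopy.subpathTransSubpath p a b d⟩
  have key : ∀ {a b : M} (ha : a = x) (hb : b = y) (c₁ : Path.Homotopic.Quotient a (p t₁))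
      (c₂ : Path.Homotopic.Quotient (p t₁) (p t₂)) (c₃ : Path.Homotopic.Quotient (p t₂) (p t₃))
      (c₄ : Path.Homotopic.Quotient (p t₃) b),
      mk (p.cast ha hb) = trans c₁ (trans c₂ (trans c₃ c₄)) →
      ∃ (c₁' : Path.Homotopic.Quotient x (p t₁)) (c₄' : Path.Homotopic.Quotient (p t₃) y),
        mk p = trans c₁' (trans c₂ (trans c₃ c₄')) ∧
        (∀ S : Set M, LiesIn S c₁ → LiesIn S c₁') ∧ (∀ S : Set M, LiesIn S c₄ → LiesIn S c₄') := by
    rintro _ _ rfl rfl c₁ c₂ c₃ c₄ h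
    exact ⟨c₁, c₄, h, fun _ => id, fun _ => id⟩
  obtain ⟨c₁, c₄, h, h1, h4⟩ := key p.source p.target (mk (p.subpath 0 t₁))
    (mk (p.subpath t₁ t₂)) (mk (p.subpath t₂ t₃)) (mk (p.subpath t₃ 1))
    (by rw [hcat, hcat, hcat, Path.subpath_zero_one])
  exact ⟨c₁, _, _, c₄, h, fun S hS => h1 S (hsub S _ _ unitInterval.nonneg' fun t _ ht => hS t ht),
    fun S hS => hsub S _ _ h₁₂ hS, fun S hS => hsub S _ _ h₂₃ hS,
    fun S hS => h4 S (hsub S _ _ unitInterval.le_one' fun t ht _ => hS t ht)⟩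

end PathClass

/-- The face of the half-ball, away from its centre, is path connected as a cone. -/
theorem isPathConnected_flat {m : ℕ} (hm : 1 ≤ m) :
    IsPathConnected {x : EuclideanSpace ℝ (Fin (m + 2)) | x (Fin.last (m + 1)) = 0 ∧ x ≠ 0} := by
  have h1 : IsPathConnected ({0}ᶜ : Set (Fin (m + 1) → ℝ)) :=
    isPathConnected_compl_singleton_of_one_lt_rank (by simp; omega) 0
  let f : (Fin (m + 1) → ℝ) → EuclideanSpace ℝ (Fin (m + 2)) :=
    fun x => WithLp.toLp 2 (Fin.snoc (α := fun _ => ℝ) x 0)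
  have hf : Continuous f := by
    refine (PiLp.continuous_toLp 2 _).comp (continuous_pi fun i => ?_)
    refine Fin.lastCases ?_ (fun j => ?_) i
    · simpa using continuous_const
    · simpa using continuous_apply j
  convert h1.image hf
  ext x
  constructor
  · rintro ⟨hx, hx0⟩
    refine ⟨fun i => x i.castSucc, fun h => hx0 ?_, ?_⟩
    · ext i
      refine Fin.lastCases hx (fun j => ?_) i
      exact congrFun h j
    · ext i
      refine Fin.lastCases ?_ (fun j => ?_) i
      · simp [f, hx]
      · simp [f]
  · rintro ⟨y, hy, rfl⟩
    refine ⟨by simp [f], fun h => hy ?_⟩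
    funext j
    simpa [f] using congrArg (fun z : EuclideanSpace ℝ (Fin (m + 2)) => z j.castSucc) h

theorem convex_flat (m : ℕ) :
    Convex ℝ {x : EuclideanSpace ℝ (Fin (m + 2)) | x (Fin.last (m + 1)) = 0} :=
  convex_hyperplane ⟨fun _ _ => rfl, fun _ _ => rfl⟩ 0

namespace IsHalfBallSystem

open Path.Homotopic.Quotient (trans symm refl trans_assoc)
open PathClass

variable {m c : ℕ} {Y : Type*} [TopologicalSpace Y]
  {e : Fin c → EuclideanSpace ℝ (Fin (m + 2)) → Y}

/-- A point on the axis normal to the hyperplane of the dome. -/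
noncomputable def axis (m : ℕ) (r : ℝ) : EuclideanSpace ℝ (Fin (m + 2)) := EuclideanSpace.single 0 r

theorem norm_axis (m : ℕ) (r : ℝ) : ‖axis m r‖ = |r| := by simp [axis]

theorem axis_last (m : ℕ) (r : ℝ) : axis m r (Fin.last (m + 1)) = 0 := by
  simp [axis, Fin.ext_iff]

theorem axis_zero (m : ℕ) (r : ℝ) : axis m r 0 = r := by simp [axis]

theorem axis_mem {m : ℕ} {r : ℝ} (hr : |r| ≤ 2) : axis m r ∈ halfBall m :=
  ⟨by rwa [norm_axis], (axis_last m r).ge⟩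

theorem axis_half_mem (m : ℕ) : axis m (1 / 2) ∈ halfBallPiece m 0 :=
  ⟨axis_mem (by norm_num [abs_of_pos]), by rw [norm_axis]; norm_num [abs_of_pos]⟩

theorem axis_neg_half_mem (m : ℕ) : axis m (-(1 / 2)) ∈ halfBallPiece m 0 :=
  ⟨axis_mem (by norm_num [abs_of_pos]), by rw [norm_axis]; norm_num [abs_of_pos]⟩

theorem axis_pos_mem {m : ℕ} {r : ℝ} (h0 : 0 < r) (h2 : r < 2) : axis m r ∈ halfBallPiece m 1 :=
  ⟨axis_mem (by rw [abs_of_pos h0]; exact h2.le), by rwa [norm_axis, abs_of_pos h0],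
    by rwa [axis_zero]⟩

theorem axis_neg_mem {m : ℕ} {r : ℝ} (h0 : 0 < r) (h2 : r < 2) : axis m (-r) ∈ halfBallPiece m 2 :=
  ⟨axis_mem (by rw [abs_neg, abs_of_pos h0]; exact h2.le), by rwa [norm_axis, abs_neg, abs_of_pos h0],
    by rw [axis_zero]; linarith⟩

section
variable (he : IsHalfBallSystem e)
include he

/-- Points of a convex part of a piece are joined inside its image. -/
theorem joinedIn_image_piece {T : Set Y} {F : Set (EuclideanSpace ℝ (Fin (m + 2)))}
    (hF : Convex ℝ F) (hT : ∀ k, ∀ x ∈ halfBall m, x ∈ F → e k x ∈ T) (k : Fin c) (s : Fin 3)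
    {x y : EuclideanSpace ℝ (Fin (m + 2))} (hx : x ∈ halfBallPiece m s) (hy : y ∈ halfBallPiece m s)
    (hxF : x ∈ F) (hyF : y ∈ F) : JoinedIn (e k '' halfBallPiece m s ∩ T) (e k x) (e k y) := by
  have h1 : JoinedIn (halfBallPiece m s ∩ F) x y :=
    JoinedIn.of_segment_subset (((convex_halfBallPiece m s).inter hF).segment_subset ⟨hx, hxF⟩
      ⟨hy, hyF⟩)
  refine (h1.map_continuousOn ((he.continuousOn k).mono
    (inter_subset_left.trans (halfBallPiece_subset m s)))).mono ?_
  rintro _ ⟨z, hz, rfl⟩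
  exact ⟨⟨z, hz.1, rfl⟩, hT k z (halfBallPiece_subset m s hz.1) hz.2⟩

/-- Every piece can be reached from the exterior along the axis, which lies in `F`: the sides from
the points `±3/2`, the inner half-ball through side 1 and the point `1/2`. The cases of interest are
the whole space, and the boundary with `F` the flat hyperplane. -/
theorem isPathConnected_inter_compl {T : Set Y} {F : Set (EuclideanSpace ℝ (Fin (m + 2)))}
    (hF : Convex ℝ F) (hT : ∀ k, ∀ x ∈ halfBall m, (e k x ∈ T ↔ x ∈ F)) (hFa : ∀ r, axis m r ∈ F)
    (hO : IsPathConnected (T ∩ outside e 1)) : IsPathConnected (T ∩ (domes e)ᶜ) := by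
  have hsub : T ∩ outside e 1 ⊆ T ∩ (domes e)ᶜ := inter_subset_inter_right _ (outside_subset le_rfl)
  have hpiece : ∀ k s, e k '' halfBallPiece m s ∩ T ⊆ T ∩ (domes e)ᶜ := fun k s y hy =>
    ⟨hy.2, he.cover_subset (some (k, s)) hy.1⟩
  have hT' := fun k x hx hxF => (hT k x hx).2 hxF
  obtain ⟨a, ha, hja⟩ := hO
  refine ⟨a, hsub ha, fun {y} hy => ?_⟩
  have hout : ∀ k r, 1 < |r| → |r| < 2 → JoinedIn (T ∩ (domes e)ᶜ) a (e k (axis m r)) := by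
    intro k r h1 h2
    refine (hja ⟨(hT k _ (axis_mem h2.le)).2 (hFa r), ?_⟩).mono hsub
    rw [he.mem_outside_iff (axis_mem h2.le), norm_axis]
    exact h1
  obtain ⟨_ | ⟨k, s⟩, hcov⟩ := he.exists_mem_cover hy.2
  · exact (hja ⟨hy.1, hcov⟩).mono hsub
  · obtain ⟨x, hx, rfl⟩ := hcov
    have hxF : x ∈ F := (hT k x (halfBallPiece_subset m s hx)).1 hy.1
    fin_cases s
    · have h1 := he.joinedIn_image_piece hF hT' k 1 (axis_pos_mem (r := 3 / 2) (by norm_num)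
        (by norm_num)) (axis_pos_mem (r := 1 / 2) (by norm_num) (by norm_num)) (hFa _) (hFa _)
      have h2 := he.joinedIn_image_piece hF hT' k 0 (axis_half_mem m) hx (hFa _) hxF
      exact ((hout k (3 / 2) (by norm_num [abs_of_pos]) (by norm_num [abs_of_pos])).trans
        (h1.mono (hpiece k 1))).trans (h2.mono (hpiece k 0))
    · have h1 := he.joinedIn_image_piece hF hT' k 1 (axis_pos_mem (r := 3 / 2) (by norm_num)
        (by norm_num)) hx (hFa _) hxF
      exact (hout k (3 / 2) (by norm_num [abs_of_pos]) (by norm_num [abs_of_pos])).trans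
        (h1.mono (hpiece k 1))
    · have h1 := he.joinedIn_image_piece hF hT' k 2 (axis_neg_mem (r := 3 / 2) (by norm_num)
        (by norm_num)) hx (hFa _) hxF
      exact (hout k (-(3 / 2)) (by norm_num [abs_of_pos]) (by norm_num [abs_of_pos])).trans
        (h1.mono (hpiece k 2))

theorem outside_nonempty [Nonempty Y] : (outside e 1).Nonempty := by
  rcases c with _ | c
  · obtain ⟨y⟩ := ‹Nonempty Y›
    exact ⟨y, fun k => k.elim0⟩
  · refine ⟨e 0 (axis m (3 / 2)), ?_⟩
    rw [he.mem_outside_iff (axis_mem (by norm_num [abs_of_pos])), norm_axis]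
    norm_num [abs_of_pos]

theorem inter_outside_nonempty {bd : Set Y}
    (hbd : ∀ k, ∀ x ∈ halfBall m, (e k x ∈ bd ↔ x (Fin.last (m + 1)) = 0)) (hne : bd.Nonempty) :
    (bd ∩ outside e 1).Nonempty := by
  rcases c with _ | c
  · obtain ⟨y, hy⟩ := hne
    exact ⟨y, hy, fun k => k.elim0⟩
  · refine ⟨e 0 (axis m (3 / 2)), ?_, ?_⟩
    · rw [hbd 0 _ (axis_mem (by norm_num [abs_of_pos])), axis_last]
    · rw [he.mem_outside_iff (axis_mem (by norm_num [abs_of_pos])), norm_axis]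
      norm_num [abs_of_pos]

theorem isPathConnected_compl_domes [T2Space Y] [PathConnectedSpace Y] :
    IsPathConnected (domes e)ᶜ := by
  have h := he.isPathConnected_inter_compl (T := univ) (F := univ) convex_univ (by simp) (by simp)
    (by rw [univ_inter]; exact he.isPathConnected_outside he.outside_nonempty)
  rwa [univ_inter] at h

/-- Discs can be avoided by paths in the boundary. -/
theorem isPathConnected_inter_outside [T2Space Y] {bd : Set Y} (hm : 1 ≤ m)
    (hbd : ∀ k, ∀ x ∈ halfBall m, (e k x ∈ bd ↔ x (Fin.last (m + 1)) = 0))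
    (hconn : IsPathConnected bd) : IsPathConnected (bd ∩ outside e 1) := by
  have hbdc := isPathConnected_iff_pathConnectedSpace.1 hconn
  -- The flat annulus around a disc to be avoided. It is path connected because the flat face has
  -- dimension `m + 1 ≥ 2`.
  let shell : Set (EuclideanSpace ℝ (Fin (m + 2))) :=
    {x | x ∈ {x : EuclideanSpace ℝ (Fin (m + 2)) | x (Fin.last (m + 1)) = 0 ∧ x ≠ 0} ∧
      1 < ‖x‖ ∧ ‖x‖ < 2}
  have hshell : IsPathConnected shell := by
    refine isPathConnected_shell (isPathConnected_flat hm) (by simp) ?_ zero_le_one one_lt_two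
    rintro x ⟨h1, h2⟩ r hr
    exact ⟨by simp [h1], smul_ne_zero hr.ne' h2⟩
  have hshell_sub : shell ⊆ halfBall m := fun x hx => ⟨hx.2.2.le, hx.1.1.ge⟩
  have hshell_mem : ∀ k, e k '' shell ⊆ bd ∩ outside e 1 := by
    rintro k _ ⟨x, hx, rfl⟩
    exact ⟨(hbd k x (hshell_sub hx)).2 hx.1.1, (he.mem_outside_iff (hshell_sub hx)).2 hx.2.1⟩
  have hshell_im : ∀ k, IsPathConnected (e k '' shell) := fun k =>
    hshell.image' ((he.continuousOn k).mono hshell_sub)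
  -- `Adj x w` lets `w` stand for `x` in the exterior: exterior points stand for themselves, and a
  -- point of an open half-ball is represented in the annulus. Crossing a disc thus becomes a detour
  -- in its annulus.
  let Adj : bd → Y → Prop := fun x w => w ∈ bd ∩ outside e 1 ∧ ((x : Y) ∈ outside e 1 → w = x) ∧
    ∀ k, ∀ v ∈ halfBall m, e k v = x → ‖v‖ < 2 → w ∈ e k '' shell
  have hAdj : ∀ x : bd, ∃ w, Adj x w := by
    intro x
    by_cases hx : (x : Y) ∈ outside e 1
    · refine ⟨x, ⟨x.2, hx⟩, fun _ => rfl, fun k v hv hvx h2 => ⟨v, ?_, hvx⟩⟩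
      have h1 : 1 < ‖v‖ := hx k v hv hvx
      refine ⟨⟨(hbd k v hv).1 (hvx ▸ x.2), fun h => ?_⟩, h1, h2⟩
      rw [h, norm_zero] at h1
      linarith
    · have hx' := hx
      simp only [outside, mem_ofPred_eq, not_forall] at hx'
      obtain ⟨k, v, hv, hvx, -⟩ := hx'
      obtain ⟨w, hw⟩ := (hshell_im k).nonempty
      refine ⟨w, hshell_mem k hw, fun h => absurd h hx, fun l u hu hux _ => ?_⟩
      rwa [(he.injective l k u hu v hv (hux.trans hvx.symm)).1]
  have key : ∀ {x y : bd} (p : Path.Homotopic.Quotient x y), ∀ w w', Adj x w → Adj y w' →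
      JoinedIn (bd ∩ outside e 1) w w' := by
    intro x y p
    refine induction_cover (fun a : Option (Fin c) => Subtype.val ⁻¹'
      (a.elim (outside e 1) fun k => e k '' {x | x ∈ halfBall m ∧ ‖x‖ < 2})) ?_ ?_
      (fun {x y} _ => ∀ w w', Adj x w → Adj y w' → JoinedIn (bd ∩ outside e 1) w w') ?_ ?_ p
    · rintro (_ | k)
      exacts [(he.isOpen_outside 1).preimage continuous_subtype_val,
        (he.isOpen_image k).preimage continuous_subtype_val]
    · intro x
      by_cases hx : (x : Y) ∈ outside e 1
      · exact ⟨none, hx⟩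
      · simp only [outside, mem_ofPred_eq, not_forall, not_lt] at hx
        obtain ⟨k, v, hv, hvx, h1⟩ := hx
        exact ⟨some k, v, ⟨hv, by linarith⟩, hvx⟩
    · intro x y z _ _ hc hd w w' hw hw'
      obtain ⟨u, hu⟩ := hAdj y
      exact (hc w u hw hu).trans (hd u w' hu hw')
    · rintro (_ | k) x y p hp w w' hw hw'
      · have hx : (x : Y) ∈ outside e 1 := by simpa using hp 0
        have hy : (y : Y) ∈ outside e 1 := by simpa using hp 1
        obtain rfl := hw.2.1 hx
        obtain rfl := hw'.2.1 hy
        exact ⟨p.map continuous_subtype_val, fun t => ⟨(p t).2, hp t⟩⟩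
      · have hx := hp 0
        have hy := hp 1
        rw [p.source] at hx
        rw [p.target] at hy
        obtain ⟨v, hv, hvx⟩ := hx
        obtain ⟨v', hv', hvy⟩ := hy
        exact ((hshell_im k).joinedIn _ (hw.2.2 k v hv.1 hvx hv.2) _
          (hw'.2.2 k v' hv'.1 hvy hv'.2)).mono (hshell_mem k)
  rw [isPathConnected_iff]
  have hAdj' : ∀ x (hx : x ∈ bd ∩ outside e 1), Adj ⟨x, hx.1⟩ x := by
    intro x hx
    obtain ⟨w, hw⟩ := hAdj ⟨x, hx.1⟩
    obtain rfl := hw.2.1 hx.2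
    exact hw
  exact ⟨he.inter_outside_nonempty hbd hconn.nonempty, fun x hx y hy =>
    key (Path.Homotopic.Quotient.mk (PathConnectedSpace.somePath ⟨x, hx.1⟩ ⟨y, hy.1⟩)) x y (hAdj' x hx) (hAdj' y hy)⟩

theorem isPathConnected_inter_compl_domes [T2Space Y] {bd : Set Y} (hm : 1 ≤ m)
    (hbd : ∀ k, ∀ x ∈ halfBall m, (e k x ∈ bd ↔ x (Fin.last (m + 1)) = 0))
    (hconn : IsPathConnected bd) : IsPathConnected (bd ∩ (domes e)ᶜ) :=
  he.isPathConnected_inter_compl (convex_flat m) hbd (fun r => axis_last m r)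
    (he.isPathConnected_inter_outside hm hbd hconn)

/-- Loops in the complement of the domes can be pushed into the boundary. -/
theorem liesIn_boundary_of_outside [T2Space Y] [SimplyConnectedSpace Y] {bd : Set Y} (hm : 1 ≤ m)
    (hbd : ∀ k, ∀ x ∈ halfBall m, (e k x ∈ bd ↔ x (Fin.last (m + 1)) = 0))
    (hconn : IsPathConnected bd) {x₀ : ↥(domes e)ᶜ} (hx₀ : (x₀ : Y) ∈ bd ∩ outside e 1)
    (c : Path.Homotopic.Quotient x₀ x₀) : LiesIn (Subtype.val ⁻¹' bd) c := by
  have hO := he.isPathConnected_inter_outside hm hbd hconn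
  have hflat := fun k x hx hxF => (hbd k x hx).2 hxF
  -- The loops that can be pushed into `bd` form a subgroup, so it is enough to draw one generating
  -- loop for each half-ball inside `bd`. It follows the axis through `-3/2, -1/2, 1/2, 3/2`, which
  -- is flat, and returns through the exterior part of `bd`.
  have htop := he.subgroup_eq_top hx₀.2
    (subgroupLiesIn (Subtype.val ⁻¹' bd : Set ↥(domes e)ᶜ) hx₀.1) fun k => ?_
  · exact (htop.symm ▸ Subgroup.mem_top (FundamentalGroup.fromPath c) :
      FundamentalGroup.fromPath c ∈ subgroupLiesIn (Subtype.val ⁻¹' bd : Set ↥(domes e)ᶜ) hx₀.1)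
  have hmem : ∀ s r, axis m r ∈ halfBallPiece m s → e k (axis m r) ∈ (domes e)ᶜ := fun s r h =>
    he.cover_subset (some (k, s)) ⟨_, h, rfl⟩
  have hq := axis_pos_mem (m := m) (r := 3 / 2) (by norm_num) (by norm_num)
  have hq' := axis_neg_mem (m := m) (r := 3 / 2) (by norm_num) (by norm_num)
  have hz := axis_neg_mem (m := m) (r := 1 / 2) (by norm_num) (by norm_num)
  have hz' := axis_pos_mem (m := m) (r := 1 / 2) (by norm_num) (by norm_num)
  have hout : ∀ r, |r| = 3 / 2 → e k (axis m r) ∈ bd ∩ outside e 1 := by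
    intro r hr
    have h2 : |r| ≤ 2 := by rw [hr]; norm_num
    refine ⟨(hbd k _ (axis_mem h2)).2 (axis_last m r), ?_⟩
    rw [he.mem_outside_iff (axis_mem h2), norm_axis, hr]
    norm_num
  have hlift : ∀ {A : Set Y} {u v : Y} (hu : u ∈ (domes e)ᶜ) (hv : v ∈ (domes e)ᶜ),
      A ⊆ (domes e)ᶜ → JoinedIn (A ∩ bd) u v →
      ∃ d : Path.Homotopic.Quotient (⟨u, hu⟩ : ↥(domes e)ᶜ) ⟨v, hv⟩,
        LiesIn (Subtype.val ⁻¹' A) d ∧ LiesIn (Subtype.val ⁻¹' bd) d := by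
    rintro A u v hu hv hA ⟨p, hp⟩
    let p' : Path (⟨u, hu⟩ : ↥(domes e)ᶜ) ⟨v, hv⟩ :=
      ⟨⟨fun t => ⟨p t, hA (hp t).1⟩, by fun_prop⟩, by simp, by simp⟩
    exact ⟨Path.Homotopic.Quotient.mk p', ⟨p', fun t => (hp t).1, rfl⟩, ⟨p', fun t => (hp t).2, rfl⟩⟩
  have hO' : ∀ u ∈ bd ∩ outside e 1, ∀ v ∈ bd ∩ outside e 1, JoinedIn (outside e 1 ∩ bd) u v :=
    fun u hu v hv => by rw [inter_comm]; exact hO.joinedIn u hu v hv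
  have hP : ∀ s, e k '' halfBallPiece m s ⊆ (domes e)ᶜ := fun s => he.cover_subset (some (k, s))
  have hq3 := hout (3 / 2) (by norm_num [abs_of_pos])
  have hq3' := hout (-(3 / 2)) (by norm_num [abs_of_pos])
  obtain ⟨η, hη, hηb⟩ := hlift x₀.2 (hmem 1 _ hq) (outside_subset le_rfl) (hO' _ hx₀ _ hq3)
  obtain ⟨c₁, h₁, h₁b⟩ := hlift (hmem 1 _ hq) (hmem 2 _ hq') (outside_subset le_rfl)
    (hO' _ hq3 _ hq3')
  obtain ⟨c₂, h₂, h₂b⟩ := hlift (hmem 2 _ hq') (hmem 2 _ hz) (hP 2)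
    (he.joinedIn_image_piece (convex_flat m) hflat k 2 hq' hz (axis_last m _) (axis_last m _))
  obtain ⟨c₃, h₃, h₃b⟩ := hlift (hmem 2 _ hz) (hmem 1 _ hz') (hP 0)
    (he.joinedIn_image_piece (convex_flat m) hflat k 0 (axis_neg_half_mem m) (axis_half_mem m)
      (axis_last m _) (axis_last m _))
  obtain ⟨c₄, h₄, h₄b⟩ := hlift (hmem 1 _ hz') (hmem 1 _ hq) (hP 1)
    (he.joinedIn_image_piece (convex_flat m) hflat k 1 hz' hq (axis_last m _) (axis_last m _))
  exact ⟨_, _, _, _, η, c₁, c₂, c₃, c₄, hη, h₁, h₂, h₃, h₄,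
    (hηb.trans (h₁b.trans (h₂b.trans (h₃b.trans h₄b)))).trans hηb.symm⟩

/-- Paths in the complement of the domes with endpoints in the boundary can be pushed into the
boundary. -/
theorem liesIn_boundary [T2Space Y] [SimplyConnectedSpace Y] {bd : Set Y} (hm : 1 ≤ m)
    (hbd : ∀ k, ∀ x ∈ halfBall m, (e k x ∈ bd ↔ x (Fin.last (m + 1)) = 0))
    (hconn : IsPathConnected bd) {x y : ↥(domes e)ᶜ} (hx : (x : Y) ∈ bd) (hy : (y : Y) ∈ bd)
    (c : Path.Homotopic.Quotient x y) : LiesIn (Subtype.val ⁻¹' bd) c := by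
  obtain ⟨z, hz, hz'⟩ := he.inter_outside_nonempty hbd hconn.nonempty
  have hzd : z ∈ (domes e)ᶜ := outside_subset le_rfl hz'
  have hB := he.isPathConnected_inter_compl_domes hm hbd hconn
  have hjoin : ∀ w : ↥(domes e)ᶜ, (w : Y) ∈ bd →
      ∃ d : Path.Homotopic.Quotient (⟨z, hzd⟩ : ↥(domes e)ᶜ) w, LiesIn (Subtype.val ⁻¹' bd) d := by
    intro w hw
    exact exists_liesIn_of_joinedIn (((hB.preimage_coe inter_subset_right).joinedIn ⟨z, hzd⟩
      ⟨hz, hzd⟩ w ⟨hw, w.2⟩).mono (preimage_mono inter_subset_left))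
  obtain ⟨p, hp⟩ := hjoin x hx
  obtain ⟨q, hq⟩ := hjoin y hy
  -- Close the path up to a loop at a base point of `bd` in the exterior, using paths in `bd`.
  have h := he.liesIn_boundary_of_outside hm hbd hconn (x₀ := ⟨z, hzd⟩) ⟨hz, hz'⟩
    (trans p (trans c (symm q)))
  have h' := hp.symm.trans (h.trans hq)
  simpa [trans_assoc, symm_trans_cancel] using h'

/-- The fundamental group of the complement of the domes is generated by tethered loops around the
domes. -/
theorem exists_closure_eq_top [T2Space Y] [SimplyConnectedSpace Y] {x₀ : ↥(domes e)ᶜ}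
    (hx₀ : (x₀ : Y) ∈ outside e 1) (t₁ t₂ t₃ : unitInterval) (h₁₂ : t₁ ≤ t₂) (h₂₃ : t₂ ≤ t₃)
    (q : Fin c → ↥(domes e)ᶜ) (μ : ∀ k, Path (q k) (q k))
    (h₁ : ∀ k t, t ≤ t₁ → (μ k t : Y) ∈ outside e 1)
    (h₂ : ∀ k t, t₁ ≤ t → t ≤ t₂ → (μ k t : Y) ∈ e k '' halfBallPiece m 2)
    (h₃ : ∀ k t, t₂ ≤ t → t ≤ t₃ → (μ k t : Y) ∈ e k '' halfBallPiece m 0)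
    (h₄ : ∀ k t, t₃ ≤ t → (μ k t : Y) ∈ e k '' halfBallPiece m 1) :
    ∃ η : ∀ k, Path x₀ (q k), Subgroup.closure (range fun k =>
      FundamentalGroup.fromPath (Path.Homotopic.Quotient.mk (((η k).trans (μ k)).trans (η k).symm))) = ⊤ := by
  have hO := he.isPathConnected_outside ⟨_, hx₀⟩
  have hη : ∀ k, ∃ η : Path x₀ (q k), ∀ t, (η t : Y) ∈ outside e 1 := by
    intro k
    have hqk : (q k : Y) ∈ outside e 1 := by simpa using h₁ k 0 unitInterval.nonneg'
    obtain ⟨η, h⟩ := (hO.preimage_coe (outside_subset le_rfl)).joinedIn x₀ hx₀ (q k) hqk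
    exact ⟨η, h⟩
  choose η hη using hη
  refine ⟨η, he.subgroup_eq_top hx₀ _ fun k => ?_⟩
  obtain ⟨c₁, c₂, c₃, c₄, hμ, hc₁, hc₂, hc₃, hc₄⟩ := exists_split (μ k) t₁ t₂ t₃ h₁₂ h₂₃
  refine ⟨q k, _, _, _, Path.Homotopic.Quotient.mk (η k), c₁, c₂, c₃, c₄, LiesIn.of_path _ (hη k), hc₁ _ (h₁ k),
    hc₂ _ (h₂ k), hc₃ _ (h₃ k), hc₄ _ (h₄ k), ?_⟩
  rw [← hμ]
  exact Subgroup.subset_closure ⟨k, rfl⟩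

end

end IsHalfBallSystem

/-! ### Openness of half-balls -/

/-- An embedded half-ball is open in the ambient ball away from its spherical part if this holds in
the interior of the ambient ball, and if the interior is locally connected at the boundary. -/
theorem exists_isOpen_inter_subset_image_halfBall {m : ℕ} {S : Type*} [TopologicalSpace S] [T2Space S]
    {f : EuclideanSpace ℝ (Fin (m + 2)) → S} {X I : Set S} (hf : ContinuousOn f (halfBall m))
    (hinj : InjOn f (halfBall m)) (hX : X ⊆ closure I)
    (hI : ∀ x ∈ halfBall m, (f x ∈ I ↔ 0 < x (Fin.last (m + 1))))
    (hP : ∀ x ∈ halfBall m, ‖x‖ < 2 → 0 < x (Fin.last (m + 1)) → ∃ V, IsOpen V ∧ f x ∈ V ∧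
      V ∩ I ⊆ f '' {x | x ∈ halfBall m ∧ ‖x‖ < 2 ∧ 0 < x (Fin.last (m + 1))})
    (hloc : ∀ z ∈ X, ∀ U, IsOpen U → z ∈ U → ∃ V ⊆ U, IsOpen V ∧ z ∈ V ∧ IsPreconnected (V ∩ I))
    {x₀ : EuclideanSpace ℝ (Fin (m + 2))} (hx₀ : x₀ ∈ halfBall m) (hx₀n : ‖x₀‖ < 2)
    (hx₀X : f x₀ ∈ X) :
    ∃ V, IsOpen V ∧ f x₀ ∈ V ∧ V ∩ X ⊆ f '' {x | x ∈ halfBall m ∧ ‖x‖ < 2} := by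
  set A : Set (EuclideanSpace ℝ (Fin (m + 2))) :=
    {x | x ∈ halfBall m ∧ ‖x‖ < 2 ∧ 0 < x (Fin.last (m + 1))} with hA
  have hcl : ∀ B : Set (EuclideanSpace ℝ (Fin (m + 2))), IsClosed B → IsClosed (f '' (halfBall m ∩ B)) :=
    fun B hB => (((isCompact_halfBall m).inter_right hB).image_of_continuousOn
      (hf.mono inter_subset_left)).isClosed
  have hx₀S : f x₀ ∈ (f '' (halfBall m ∩ {x | ‖x‖ = 2}))ᶜ := by
    rintro ⟨y, ⟨hy, hy2⟩, hyx⟩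
    rw [hinj hy hx₀ hyx] at hy2
    exact hx₀n.ne hy2
  -- `V` avoids the compact spherical part and has connected trace on the interior `I`.
  obtain ⟨V, hVU, hVo, hzV, hVc⟩ := hloc _ hx₀X _
    (hcl _ (isClosed_eq continuous_norm continuous_const)).isOpen_compl hx₀S
  choose! W hWo hxW hWI using hP
  let O : Set S := ⋃ x ∈ A, W x
  have hOo : IsOpen O := isOpen_biUnion fun x hx => hWo x hx.1 hx.2.1 hx.2.2
  have hAO : f '' A ⊆ O := by
    rintro _ ⟨x, hx, rfl⟩
    exact mem_biUnion hx (hxW x hx.1 hx.2.1 hx.2.2)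
  have hOI : O ∩ I ⊆ f '' A := by
    rintro y ⟨hy, hyI⟩
    obtain ⟨x, hx, hyx⟩ := mem_iUnion₂.1 hy
    exact hWI x hx.1 hx.2.1 hx.2.2 ⟨hyx, hyI⟩
  have hAI : f '' A ⊆ I := by
    rintro _ ⟨x, hx, rfl⟩
    exact (hI x hx.1).2 hx.2.2
  -- The open segment from `x₀` towards the pole `w` lies in `A`.
  have hx₀A : x₀ ∈ closure A := by
    let w : EuclideanSpace ℝ (Fin (m + 2)) := EuclideanSpace.single (Fin.last (m + 1)) 1
    have hwn : ‖w‖ = 1 := by simp [w]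
    have hwl : w (Fin.last (m + 1)) = 1 := by simp [w]
    refine closure_mono ?_ (segment_subset_closure_openSegment (left_mem_segment ℝ x₀ w))
    rintro y ⟨a, b, ha, hb, hab, rfl⟩
    have hlast : 0 < (a • x₀ + b • w) (Fin.last (m + 1)) := by
      have : (a • x₀ + b • w) (Fin.last (m + 1)) = a * x₀ (Fin.last (m + 1)) + b := by
        simp [hwl]
      rw [this]
      have := mul_nonneg ha.le hx₀.2
      linarith
    have hnorm : ‖a • x₀ + b • w‖ < 2 := by
      refine (norm_add_le _ _).trans_lt ?_
      rw [norm_smul, norm_smul, Real.norm_of_nonneg ha.le, Real.norm_of_nonneg hb.le, hwn]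
      nlinarith
    exact ⟨⟨hnorm.le, hlast.le⟩, hnorm, hlast⟩
  have hne : (V ∩ I ∩ O).Nonempty := by
    have h1 : f x₀ ∈ closure (f '' A) :=
      ((hf x₀ hx₀).mono fun x hx => hx.1).mem_closure_image hx₀A
    obtain ⟨y, hyV, hyA⟩ := mem_closure_iff.1 h1 V hVo hzV
    exact ⟨y, ⟨hyV, hAI hyA⟩, hAO hyA⟩
  -- Inside `I`, the open set `O` and the complement of the compact half-ball are disjoint and cover
  -- `V ∩ I`. By connectedness one of them suffices, and `O` is met near `f x₀`.
  have hsub : V ∩ I ⊆ O := by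
    have hcov : V ∩ I ⊆ O ∪ (f '' (halfBall m ∩ univ))ᶜ := by
      rintro y ⟨hyV, hyI⟩
      by_cases hy : y ∈ f '' (halfBall m ∩ univ)
      · obtain ⟨x, ⟨hx, -⟩, rfl⟩ := hy
        exact Or.inl (hAO ⟨x, ⟨hx, lt_of_le_of_ne hx.1 fun h => hVU hyV ⟨x, ⟨hx, h⟩, rfl⟩,
          (hI x hx).1 hyI⟩, rfl⟩)
      · exact Or.inr hy
    intro y hy
    by_contra hyO
    obtain ⟨z, ⟨-, hzI⟩, hzO, hz⟩ := hVc O _ hOo (hcl univ isClosed_univ).isOpen_compl hcov hne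
      ⟨y, hy, (hcov hy).resolve_left hyO⟩
    obtain ⟨x, hx, rfl⟩ := hOI ⟨hzO, hzI⟩
    exact hz ⟨x, ⟨hx.1, trivial⟩, rfl⟩
  have hsub' : V ∩ I ⊆ f '' (halfBall m ∩ univ) := fun y hy => by
    obtain ⟨x, hx, rfl⟩ := hOI ⟨hsub hy, hy.2⟩
    exact ⟨x, ⟨hx.1, trivial⟩, rfl⟩
  refine ⟨V, hVo, hzV, ?_⟩
  rintro y ⟨hyV, hyX⟩
  -- Points of `X` are limits of interior points, and the image of the compact half-ball is closed.
  have h1 : y ∈ closure (V ∩ I) := hVo.inter_closure ⟨hyV, hX hyX⟩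
  obtain ⟨x, ⟨hx, -⟩, rfl⟩ := (hcl univ isClosed_univ).closure_subset_iff.2 hsub' h1
  refine ⟨x, ⟨hx, lt_of_le_of_ne hx.1 fun h => hVU hyV ⟨x, ⟨hx, h⟩, rfl⟩⟩, rfl⟩

/-! ### Cones over pieces of the sphere -/

section Cone

variable {E : Type*} [NormedAddCommGroup E] [NormedSpace ℝ E]

/-- Radial projection to the unit sphere; the value at the origin is the point `a`. -/
noncomputable def radial (a : Metric.sphere (0 : E) 1) (v : E) : Metric.sphere (0 : E) 1 :=
  open Classical in if h : v = 0 then a else ⟨‖v‖⁻¹ • v, by simp [norm_smul, h]⟩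

theorem radial_coe (a : Metric.sphere (0 : E) 1) {v : E} (h : v ≠ 0) :
    (radial a v : E) = ‖v‖⁻¹ • v := by
  simp [radial, h]

theorem radial_self (a p : Metric.sphere (0 : E) 1) : radial a (p : E) = p := by
  have hp : (p : E) ≠ 0 := ne_zero_of_mem_unit_sphere p
  apply Subtype.ext
  rw [radial_coe a hp, norm_eq_of_mem_sphere p]
  simp

theorem continuousOn_radial (a : Metric.sphere (0 : E) 1) : ContinuousOn (radial a) {0}ᶜ := by
  rw [Topology.IsInducing.subtypeVal.continuousOn_iff]
  have : ContinuousOn (fun v : E => ‖v‖⁻¹ • v) {0}ᶜ := by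
    refine ContinuousOn.smul (ContinuousOn.inv₀ continuous_norm.continuousOn ?_) continuousOn_id
    exact fun v hv => norm_ne_zero_iff.2 hv
  exact this.congr fun v hv => radial_coe a hv

/-- A cone without its apex projects radially onto its trace on the sphere. -/
theorem isPathConnected_sphere_inter {C : Set E} (hC : IsPathConnected C) (h0 : (0 : E) ∉ C)
    (hcone : ∀ x ∈ C, ∀ r : ℝ, 0 < r → r • x ∈ C) :
    IsPathConnected {p : Metric.sphere (0 : E) 1 | (p : E) ∈ C} := by
  have hne : ∀ v ∈ C, v ≠ 0 := fun v hv h => h0 (h ▸ hv)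
  obtain ⟨v, hv⟩ := hC.nonempty
  let a : Metric.sphere (0 : E) 1 := ⟨‖v‖⁻¹ • v, by simp [norm_smul, hne v hv]⟩
  have heq : {p : Metric.sphere (0 : E) 1 | (p : E) ∈ C} = radial a '' C := by
    ext p
    constructor
    · intro hp
      exact ⟨p, hp, radial_self a p⟩
    · rintro ⟨w, hw, rfl⟩
      change (radial a w : E) ∈ C
      rw [radial_coe a (hne w hw)]
      exact hcone w hw _ (inv_pos.2 (norm_pos_iff.2 (hne w hw)))
  rw [heq]
  exact hC.image' ((continuousOn_radial a).mono fun w hw => hne w hw)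

theorem isPreconnected_sphere_inter {C : Set E} (hC : Convex ℝ C) (h0 : (0 : E) ∉ C)
    (hcone : ∀ x ∈ C, ∀ r : ℝ, 0 < r → r • x ∈ C) :
    IsPreconnected {p : Metric.sphere (0 : E) 1 | (p : E) ∈ C} := by
  rcases C.eq_empty_or_nonempty with rfl | hne
  · simpa using isPreconnected_empty
  · exact (isPathConnected_sphere_inter (hC.isPathConnected hne) h0 hcone).isConnected.isPreconnected

/-- A part of the sphere that is star-shaped with respect to a direction is simply connected. -/
theorem isSimplyConnected_sphere_inter {C : Set E} (w : E)
    (hstar : ∀ x ∈ C, x ≠ 0 → ∀ t ∈ Icc (0 : ℝ) 1, (1 - t) • x + t • w ∈ C ∧ (1 - t) • x + t • w ≠ 0)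
    (hne : ∃ x ∈ C, x ≠ 0)
    (hcone : ∀ x ∈ C, ∀ r : ℝ, 0 < r → r • x ∈ C) :
    IsSimplyConnected {p : Metric.sphere (0 : E) 1 | (p : E) ∈ C} := by
  obtain ⟨x, hx, hx0⟩ := hne
  have hw := hstar x hx hx0 1 (by simp)
  simp only [sub_self, zero_smul, one_smul, zero_add] at hw
  let a : Metric.sphere (0 : E) 1 := ⟨‖x‖⁻¹ • x, by simp [norm_smul, hx0]⟩
  have hmem : ∀ v ∈ C, v ≠ 0 → (radial a v : E) ∈ C := fun v hv hv0 => by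
    rw [radial_coe a hv0]
    exact hcone v hv _ (inv_pos.2 (norm_pos_iff.2 hv0))
  let Z := {p : Metric.sphere (0 : E) 1 | (p : E) ∈ C}
  have hZ : ∀ (t : unitInterval) (p : Z), (1 - (t : ℝ)) • ((p : Metric.sphere (0 : E) 1) : E) + (t : ℝ) • w ∈ C ∧
      (1 - (t : ℝ)) • ((p : Metric.sphere (0 : E) 1) : E) + (t : ℝ) • w ≠ 0 := fun t p =>
    hstar _ p.2 (ne_zero_of_mem_unit_sphere p.1) t t.2
  -- The straight-line contraction to `w`, projected back to the sphere.
  let F : unitInterval × Z → Z := fun z => ⟨radial a ((1 - (z.1 : ℝ)) •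
    ((z.2 : Metric.sphere (0 : E) 1) : E) + (z.1 : ℝ) • w), hmem _ (hZ z.1 z.2).1 (hZ z.1 z.2).2⟩
  have hF : Continuous F := by
    refine Continuous.subtype_mk ((continuousOn_radial a).comp_continuous (by fun_prop) ?_) _
    exact fun z => (hZ z.1 z.2).2
  have : ContractibleSpace Z := by
    rw [contractible_iff_id_nullhomotopic]
    refine ⟨⟨radial a w, hmem w hw.1 hw.2⟩, ⟨⟨⟨F, hF⟩, ?_, ?_⟩⟩⟩
    · intro p
      apply Subtype.ext
      simp [F, radial_self]
    · intro p
      apply Subtype.ext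
      simp [F]
  exact (inferInstance : SimplyConnectedSpace Z)

end Cone

/-! ### The model trisection -/

/-- The first three coordinates on `ℝ⁵`. -/
noncomputable def coord (i : Fin 3) : EuclideanSpace ℝ (Fin 5) →L[ℝ] ℝ :=
  EuclideanSpace.proj (i.castLE (by norm_num))

/-- The sum of the basis vectors indexed by a subset of the first three indices. -/
noncomputable def dir (J : Finset (Fin 3)) : EuclideanSpace ℝ (Fin 5) :=
  ∑ i ∈ J, EuclideanSpace.single (i.castLE (by norm_num)) 1

theorem coord_dir (J : Finset (Fin 3)) (k : Fin 3) : coord k (dir J) = if k ∈ J then 1 else 0 := by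
  simp only [dir, map_sum, coord]
  have : ∀ i : Fin 3, (EuclideanSpace.proj (k.castLE (by norm_num : 3 ≤ 5)) :
      EuclideanSpace ℝ (Fin 5) →L[ℝ] ℝ) (EuclideanSpace.single (i.castLE (by norm_num)) 1) =
      if k = i then 1 else 0 := by
    intro i
    by_cases h : k = i
    · subst h; simp
    · simp [h]
  simp only [this]
  simp

/-- The cone on which the coordinates indexed by `J` are the largest of the first three. -/
def maxCone (J : Finset (Fin 3)) : Set (EuclideanSpace ℝ (Fin 5)) :=
  {v | ∀ i ∈ J, ∀ j, coord j v ≤ coord i v}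

/-- The cone on which the coordinates indexed by `J` are the largest of the first three, and larger
than the others. -/
def strictCone (J : Finset (Fin 3)) : Set (EuclideanSpace ℝ (Fin 5)) :=
  {v | v ∈ maxCone J ∧ ∀ i ∈ J, ∀ k ∉ J, coord k v < coord i v}

/-- The intersection of the pieces of the model trisection indexed by `J`. -/
def stratum (J : Finset (Fin 3)) : Set FourSphere := {p | p.1 ∈ maxCone J}

/-- The interior of a stratum. -/
def openStratum (J : Finset (Fin 3)) : Set FourSphere := {p | p.1 ∈ strictCone J}

theorem convex_maxCone (J : Finset (Fin 3)) : Convex ℝ (maxCone J) := by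
  intro x hx y hy a b ha hb _ i hi j
  simp only [map_add, map_smul, smul_eq_mul]
  exact add_le_add (mul_le_mul_of_nonneg_left (hx i hi j) ha)
    (mul_le_mul_of_nonneg_left (hy i hi j) hb)

theorem smul_mem_maxCone {J : Finset (Fin 3)} {x : EuclideanSpace ℝ (Fin 5)} (hx : x ∈ maxCone J)
    {r : ℝ} (hr : 0 < r) : r • x ∈ maxCone J := by
  intro i hi j
  simp only [map_smul, smul_eq_mul]
  exact mul_le_mul_of_nonneg_left (hx i hi j) hr.le

theorem smul_mem_strictCone {J : Finset (Fin 3)} {x : EuclideanSpace ℝ (Fin 5)}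
    (hx : x ∈ strictCone J) {r : ℝ} (hr : 0 < r) : r • x ∈ strictCone J := by
  refine ⟨smul_mem_maxCone hx.1 hr, fun i hi k hk => ?_⟩
  simp only [map_smul, smul_eq_mul]
  exact mul_lt_mul_of_pos_left (hx.2 i hi k hk) hr

theorem convex_strictCone (J : Finset (Fin 3)) : Convex ℝ (strictCone J) := by
  intro x hx y hy a b ha hb hab
  refine ⟨convex_maxCone J hx.1 hy.1 ha hb hab, fun i hi k hk => ?_⟩
  simp only [map_add, map_smul, smul_eq_mul]
  have h1 := hx.2 i hi k hk
  have h2 := hy.2 i hi k hk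
  rcases ha.eq_or_lt with rfl | ha
  · rw [zero_add] at hab
    subst hab
    linarith
  · exact add_lt_add_of_lt_of_le (mul_lt_mul_of_pos_left h1 ha) (mul_le_mul_of_nonneg_left h2.le hb)

theorem modelPiece_eq (i : Fin 3) : modelPiece i = stratum {i} := by
  ext p
  exact ⟨fun h k hk j => by rw [Finset.mem_singleton.1 hk]; exact h j,
    fun h j => h i (Finset.mem_singleton_self i) j⟩

theorem stratum_union (J J' : Finset (Fin 3)) : stratum (J ∪ J') = stratum J ∩ stratum J' := by
  ext p
  constructor
  · exact fun h => ⟨fun i hi => h i (Finset.mem_union_left _ hi),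
      fun i hi => h i (Finset.mem_union_right _ hi)⟩
  · rintro ⟨h1, h2⟩ i hi
    rcases Finset.mem_union.1 hi with hi | hi
    exacts [h1 i hi, h2 i hi]

theorem stratum_anti {J J' : Finset (Fin 3)} (h : J ⊆ J') : stratum J' ⊆ stratum J :=
  fun _ hp i hi => hp i (h hi)

theorem iInter_modelPiece : ⋂ i, modelPiece i = stratum Finset.univ := by
  ext p
  simp only [modelPiece_eq, mem_iInter]
  exact ⟨fun h i _ => h i i (Finset.mem_singleton_self i),
    fun h i => stratum_anti (Finset.subset_univ _) h⟩

theorem iUnion_modelPiece : ⋃ i, modelPiece i = univ := by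
  refine eq_univ_of_forall fun p => mem_iUnion.2 ?_
  obtain ⟨i, hi⟩ := Finite.exists_max (fun i : Fin 3 => coord i p.1)
  exact ⟨i, hi⟩

theorem isClosed_stratum (J : Finset (Fin 3)) : IsClosed (stratum J) := by
  have : stratum J = ⋂ i ∈ J, ⋂ j, {p : FourSphere | coord j p.1 ≤ coord i p.1} := by
    ext p; simp [stratum, maxCone]
  rw [this]
  exact isClosed_biInter fun i _ => isClosed_iInter fun j =>
    isClosed_le (by fun_prop) (by fun_prop)

/-- The cone is star-shaped about `dir J`, and the segments miss the origin because `J` is proper.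
If `(1 - t) x + t dir J = 0` with `t > 0`, then `x` vanishes in a coordinate outside `J` but is
negative in those of `J`, which should be the largest. For the full index set this fails, and the
stratum is a 2-sphere. -/
theorem isSimplyConnected_stratum {J : Finset (Fin 3)} (hJ : J.Nonempty) (hJ' : J ≠ Finset.univ) :
    IsSimplyConnected (stratum J) := by
  obtain ⟨i, hi⟩ := hJ
  obtain ⟨k, hk⟩ : ∃ k, k ∉ J := by
    by_contra! h
    exact hJ' (Finset.eq_univ_of_forall h)
  have hdir : dir J ∈ maxCone J := fun i hi j => by
    rw [coord_dir, coord_dir, if_pos hi]; split_ifs <;> norm_num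
  have hdir0 : dir J ≠ 0 := fun h => by
    have := coord_dir J i
    rw [h, if_pos hi, map_zero] at this
    norm_num at this
  refine isSimplyConnected_sphere_inter (dir J) (fun x hx _ t ht =>
    ⟨convex_maxCone J hx hdir (by linarith [ht.2]) ht.1 (by ring), fun h0 => ?_⟩)
    ⟨_, hdir, hdir0⟩ (fun x hx r hr => smul_mem_maxCone hx hr)
  have hi0 := congrArg (coord i) h0
  have hk0 := congrArg (coord k) h0
  simp only [map_add, map_smul, coord_dir, if_pos hi, if_neg hk, smul_eq_mul, map_zero] at hi0 hk0
  have hle := hx i hi k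
  have ht1 : t ≠ 1 := by
    rintro rfl
    norm_num at hi0
  have ht2 : 0 < 1 - t := by
    have := lt_of_le_of_ne ht.2 ht1
    linarith
  have hk1 : coord k x = 0 := by
    have : (1 - t) * coord k x = 0 := by linarith
    exact (mul_eq_zero.1 this).resolve_left ht2.ne'
  rw [hk1] at hle
  have ht0 : t = 0 := by
    have := mul_nonneg ht2.le hle
    linarith [ht.1]
  subst ht0
  simp at h0
  contradiction

/-- The cone of three equal coordinates is a 3-dimensional linear subspace, hence path connected
without the origin. -/
theorem isPathConnected_stratum_univ : IsPathConnected (stratum Finset.univ) := by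
  have h1 : IsPathConnected ({0}ᶜ : Set (Fin 3 → ℝ)) :=
    isPathConnected_compl_singleton_of_one_lt_rank (by simp) 0
  let f : (Fin 3 → ℝ) → EuclideanSpace ℝ (Fin 5) := fun x => !₂[x 0, x 0, x 0, x 1, x 2]
  have hf : Continuous f := by
    refine (PiLp.continuous_toLp 2 _).comp (continuous_pi fun i => ?_)
    fin_cases i <;> simp <;> fun_prop
  have heq : f '' {0}ᶜ = {v | v ∈ maxCone Finset.univ ∧ v ≠ 0} := by
    ext v
    constructor
    · rintro ⟨x, hx, rfl⟩
      refine ⟨fun i _ j => ?_, fun h => hx ?_⟩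
      · fin_cases i <;> fin_cases j <;> exact le_rfl
      · funext i
        fin_cases i
        · exact congrArg (fun w : EuclideanSpace ℝ (Fin 5) => w 0) h
        · exact congrArg (fun w : EuclideanSpace ℝ (Fin 5) => w 3) h
        · exact congrArg (fun w : EuclideanSpace ℝ (Fin 5) => w 4) h
    · rintro ⟨hv, hv0⟩
      have h01 : v 0 = v 1 := le_antisymm (hv 1 (Finset.mem_univ _) 0) (hv 0 (Finset.mem_univ _) 1)
      have h02 : v 0 = v 2 := le_antisymm (hv 2 (Finset.mem_univ _) 0) (hv 0 (Finset.mem_univ _) 2)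
      have hfv : f ![v 0, v 3, v 4] = v := by
        ext i
        fin_cases i
        · rfl
        · exact h01
        · exact h02
        · rfl
        · rfl
      refine ⟨![v 0, v 3, v 4], fun h => hv0 ?_, hfv⟩
      rw [← hfv, h]
      ext i
      fin_cases i <;> rfl
  have h2 := isPathConnected_sphere_inter (C := {v | v ∈ maxCone Finset.univ ∧ v ≠ 0})
    (heq ▸ h1.image hf) (by simp) (fun x hx r hr => ⟨smul_mem_maxCone hx.1 hr, smul_ne_zero hr.ne' hx.2⟩)
  convert h2 using 1
  ext p
  exact ⟨fun h => ⟨h, ne_zero_of_mem_unit_sphere p⟩, fun h => h.1⟩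

/-- Moving a point of the sphere a little in a fixed direction. -/
theorem exists_radial_add_smul_mem (p : FourSphere) (w : EuclideanSpace ℝ (Fin 5)) {U : Set FourSphere}
    (hU : IsOpen U) (hp : p ∈ U) : ∃ t : ℝ, 0 < t ∧ p.1 + t • w ≠ 0 ∧ radial p (p.1 + t • w) ∈ U := by
  have hp0 : p.1 ≠ 0 := ne_zero_of_mem_unit_sphere p
  have h1 : ContinuousAt (fun t : ℝ => p.1 + t • w) 0 := by fun_prop
  have h2 : ContinuousAt (radial p) (p.1 + (0 : ℝ) • w) := by
    refine (continuousOn_radial p).continuousAt (isOpen_compl_singleton.mem_nhds ?_)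
    simpa using hp0
  have h3 := ContinuousAt.comp (f := fun t : ℝ => p.1 + t • w) (x := (0 : ℝ)) h2 h1
  have h4 : ∀ᶠ t in nhds (0 : ℝ), radial p (p.1 + t • w) ∈ U := by
    refine h3.eventually_mem (hU.mem_nhds ?_)
    simpa [radial_self] using hp
  have h5 : ∀ᶠ t in nhds (0 : ℝ), p.1 + t • w ≠ 0 := by
    refine h1.eventually_ne ?_
    simpa using hp0
  obtain ⟨ε, hε, hball⟩ := Metric.eventually_nhds_iff.1 (h4.and h5)
  have := hball (y := ε / 2) (by rw [Real.dist_eq, sub_zero, abs_of_pos (by linarith)]; linarith)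
  exact ⟨ε / 2, by linarith, this.2, this.1⟩

/-- A small move in the direction `dir J` raises exactly the coordinates in `J`, so all the
inequalities against the others become strict. -/
theorem stratum_subset_closure {J : Finset (Fin 3)} : stratum J ⊆ closure (openStratum J) := by
  intro p hp
  rw [mem_closure_iff]
  intro U hU hpU
  obtain ⟨t, ht, ht0, htU⟩ := exists_radial_add_smul_mem p (dir J) hU hpU
  refine ⟨_, htU, ?_⟩
  change (radial p (p.1 + t • dir J)).1 ∈ strictCone J
  rw [radial_coe p ht0]
  refine smul_mem_strictCone ⟨fun i hi j => ?_, fun i hi k hk => ?_⟩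
    (inv_pos.2 (norm_pos_iff.2 ht0))
  · have := hp i hi j
    simp only [map_add, map_smul, coord_dir, if_pos hi, smul_eq_mul]
    split_ifs
    · linarith
    · linarith
  · have := hp i hi k
    simp only [map_add, map_smul, coord_dir, if_pos hi, if_neg hk, smul_eq_mul]
    linarith

/-- Small round caps are traces of convex cones, and so are their intersections with the open
stratum. -/
theorem exists_isPreconnected_inter_openStratum (J : Finset (Fin 3)) (z : FourSphere)
    (U : Set FourSphere) (hU : IsOpen U) (hz : z ∈ U) :
    ∃ V ⊆ U, IsOpen V ∧ z ∈ V ∧ IsPreconnected (V ∩ openStratum J) := by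
  obtain ⟨ε, hε, hball⟩ := Metric.isOpen_iff.1 hU z hz
  set δ := min ε 1 with hδ
  have hδ0 : 0 < δ := lt_min hε one_pos
  have hδ1 : δ ≤ 1 := min_le_right _ _
  -- On the unit sphere ‖p - z‖² = 2 - 2⟨p, z⟩, so `r < ⟨p, z⟩` describes the cap of radius `δ`.
  -- Since `δ ≤ 1`, `r` is positive, as the convexity of `C` requires.
  set r : ℝ := 1 - δ ^ 2 / 2 with hr
  have hr0 : 0 < r := by nlinarith
  have hz1 : ‖z.1‖ = 1 := norm_eq_of_mem_sphere z
  let C : Set (EuclideanSpace ℝ (Fin 5)) := {v | r * ‖v‖ < inner ℝ v z.1}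
  have hconv : Convex ℝ C := by
    intro x hx y hy a b ha hb hab
    change r * ‖a • x + b • y‖ < inner ℝ (a • x + b • y) z.1
    rw [inner_add_left, real_inner_smul_left, real_inner_smul_left]
    have h1 : ‖a • x + b • y‖ ≤ a * ‖x‖ + b * ‖y‖ := by
      refine (norm_add_le _ _).trans_eq ?_
      rw [norm_smul, norm_smul, Real.norm_of_nonneg ha, Real.norm_of_nonneg hb]
    have h2 := mul_le_mul_of_nonneg_left h1 hr0.le
    have hx' : 0 < inner ℝ x z.1 - r * ‖x‖ := sub_pos.2 hx
    have hy' : 0 < inner ℝ y z.1 - r * ‖y‖ := sub_pos.2 hy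
    have h3 : 0 < a * (inner ℝ x z.1 - r * ‖x‖) + b * (inner ℝ y z.1 - r * ‖y‖) := by
      rcases ha.eq_or_lt with rfl | ha
      · rw [zero_add] at hab
        subst hab
        linarith
      · exact add_pos_of_pos_of_nonneg (mul_pos ha hx') (mul_nonneg hb hy'.le)
    linarith
  refine ⟨{p : FourSphere | r < inner ℝ p.1 z.1}, ?_, ?_, ?_, ?_⟩
  · intro p hp
    refine hball ?_
    have hp1 : ‖p.1‖ = 1 := norm_eq_of_mem_sphere p
    have h1 : ‖p.1 - z.1‖ ^ 2 < δ ^ 2 := by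
      rw [norm_sub_sq_real, hp1, hz1]
      have : r < inner ℝ p.1 z.1 := hp
      rw [hr] at this
      linarith
    rw [Metric.mem_ball, Subtype.dist_eq, dist_eq_norm]
    exact lt_of_lt_of_le (lt_of_pow_lt_pow_left₀ 2 hδ0.le h1) (min_le_left _ _)
  · exact isOpen_lt continuous_const (by fun_prop)
  · change r < inner ℝ z.1 z.1
    rw [real_inner_self_eq_norm_sq, hz1, hr]
    have := pow_pos hδ0 2
    linarith
  · have h0 : (0 : EuclideanSpace ℝ (Fin 5)) ∉ C ∩ strictCone J := by
      rintro ⟨h, -⟩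
      simp [C] at h
    have := isPreconnected_sphere_inter (hconv.inter (convex_strictCone J)) h0 ?_
    · convert this using 1
      ext p
      have hp1 : ‖p.1‖ = 1 := norm_eq_of_mem_sphere p
      simp only [openStratum, C, mem_inter_iff, mem_ofPred_eq, hp1, mul_one]
    · rintro x ⟨hx, hx'⟩ s hs
      refine ⟨?_, smul_mem_strictCone hx' hs⟩
      change r * ‖s • x‖ < inner ℝ (s • x) z.1
      rw [norm_smul, Real.norm_of_nonneg hs.le, real_inner_smul_left]
      have : r * ‖x‖ < inner ℝ x z.1 := hx
      nlinarith

theorem mem_openStratum_singleton {i : Fin 3} {p : FourSphere} (hp : p ∈ stratum {i}) :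
    p ∈ openStratum {i} ↔ p ∉ frontier (stratum {i}) := by
  rw [(isClosed_stratum {i}).frontier_eq, mem_sdiff, not_and, not_not]
  constructor
  · intro h _
    have : openStratum {i} ⊆ interior (stratum {i}) := by
      refine interior_maximal (fun p hp => hp.1) ?_
      have heq : openStratum {i} = ⋂ k ∈ ({i} : Set (Fin 3))ᶜ,
          {p : FourSphere | coord k p.1 < coord i p.1} := by
        ext p
        simp only [mem_iInter]
        constructor
        · exact fun h k hk => h.2 i (Finset.mem_singleton_self i) k (by simpa using hk)
        · refine fun h => ⟨fun j hj k => ?_, fun j hj k hk => ?_⟩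
          · rw [Finset.mem_singleton.1 hj]
            by_cases hk : k = i
            · rw [hk]
            · exact (h k hk).le
          · rw [Finset.mem_singleton.1 hj]
            exact h k (by simpa using hk)
      rw [heq]
      exact (toFinite _).isOpen_biInter fun k _ => isOpen_lt (by fun_prop) (by fun_prop)
    exact this h
  · intro h
    have hint := h hp
    refine ⟨hp, fun j hj k hk => ?_⟩
    obtain rfl := Finset.mem_singleton.1 hj
    refine lt_of_le_of_ne (hp j hj k) fun heq => ?_
    -- If the `k`-th coordinate ties with the maximum, raising it slightly leaves the piece, so `p`
    -- is not an interior point.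
    obtain ⟨t, ht, ht0, htU⟩ := exists_radial_add_smul_mem p (dir {k}) isOpen_interior hint
    have h1 := interior_subset htU j hj k
    rw [radial_coe p ht0] at h1
    simp only [map_add, map_smul, coord_dir, smul_eq_mul, Finset.mem_singleton] at h1
    rw [if_pos trivial, if_neg (fun h => hk (by simp [h]))] at h1
    have h2 := inv_pos.2 (norm_pos_iff.2 ht0)
    have h3 := le_of_mul_le_mul_left h1 h2
    linarith

theorem frontier_stratum_singleton (i : Fin 3) :
    frontier (stratum {i}) = ⋃ k ∈ ({i} : Set (Fin 3))ᶜ, stratum {i, k} := by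
  ext p
  constructor
  · intro h
    have hp : p ∈ stratum {i} := (isClosed_stratum {i}).frontier_subset h
    have h1 : p ∉ openStratum {i} := fun h' => (mem_openStratum_singleton hp).1 h' h
    by_contra h2
    refine h1 ⟨hp, fun j hj k hk => ?_⟩
    obtain rfl := Finset.mem_singleton.1 hj
    refine lt_of_le_of_ne (hp j hj k) fun heq => h2 (mem_biUnion (x := k) (by simpa using hk) ?_)
    intro l hl m
    rcases Finset.mem_insert.1 hl with rfl | hl
    · exact hp l hj m
    · rw [Finset.mem_singleton.1 hl, heq]
      exact hp j hj m
  · intro h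
    obtain ⟨k, hk, hpk⟩ := mem_iUnion₂.1 h
    have hp : p ∈ stratum {i} := stratum_anti (by simp) hpk
    by_contra h'
    have h1 := ((mem_openStratum_singleton hp).2 h').2 i (by simp) k (by simpa using hk)
    have h2 := hpk k (by simp) i
    linarith

theorem mem_openStratum_pair {i j : Fin 3} (hij : i ≠ j) {p : FourSphere} (hp : p ∈ stratum {i, j}) :
    p ∈ openStratum {i, j} ↔ p ∉ stratum Finset.univ := by
  constructor
  · intro h h'
    obtain ⟨k, hk⟩ : ∃ k, k ∉ ({i, j} : Finset (Fin 3)) := by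
      by_contra! h
      have := Finset.card_le_two (a := i) (b := j)
      rw [Finset.eq_univ_of_forall h] at this
      simp at this
    have := h.2 i (by simp) k hk
    linarith [h' k (Finset.mem_univ k) i]
  · intro h
    refine ⟨hp, fun l hl k hk => lt_of_le_of_ne (hp l hl k) fun heq => h ?_⟩
    intro n _ o
    by_cases hn : n ∈ ({i, j} : Finset (Fin 3))
    · exact hp n hn o
    · have : n = k := by
        simp only [Finset.mem_insert, Finset.mem_singleton] at hn hk
        omega
      rw [this, heq]
      exact hp l hl o

/-- The boundary of a piece is the union of two 3-balls that share the central sphere. -/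
theorem isPathConnected_frontier_stratum (i : Fin 3) : IsPathConnected (frontier (stratum {i})) := by
  obtain ⟨j, k, hj, hk, h⟩ : ∃ j k : Fin 3, j ≠ i ∧ k ≠ i ∧ ({i} : Set (Fin 3))ᶜ = {j, k} := by
    fin_cases i
    · exact ⟨1, 2, by decide, by decide, by ext x; fin_cases x <;> simp⟩
    · exact ⟨0, 2, by decide, by decide, by ext x; fin_cases x <;> simp⟩
    · exact ⟨0, 1, by decide, by decide, by ext x; fin_cases x <;> simp⟩
  have hne : ∀ l : Fin 3, ({i, l} : Finset (Fin 3)) ≠ Finset.univ := fun l h => by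
    have := Finset.card_le_two (a := i) (b := l)
    rw [h] at this
    simp at this
  rw [frontier_stratum_singleton, h, biUnion_insert, biUnion_singleton]
  refine (isSimplyConnected_stratum (by simp) (hne j)).isPathConnected.union
    (isSimplyConnected_stratum (by simp) (hne k)).isPathConnected ?_
  obtain ⟨p, hp⟩ := isPathConnected_stratum_univ.nonempty
  exact ⟨p, stratum_anti (Finset.subset_univ _) hp, stratum_anti (Finset.subset_univ _) hp⟩

/-! ### Immersed half-balls are open -/

/-- An immersion into the unit sphere of a subspace, of the same dimension, is open. -/
theorem exists_nhds_sphere_subset_image {E V : Type*} [NormedAddCommGroup E] [NormedSpace ℝ E]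
    [FiniteDimensional ℝ E] [NormedAddCommGroup V] [InnerProductSpace ℝ V] [FiniteDimensional ℝ V]
    {F : E → V} {N : Submodule ℝ V} {x : E} (hF : ContDiffAt ℝ 1 F x)
    (hinj : Function.Injective (fderiv ℝ F x))
    (hmem : ∀ᶠ y in nhds x, F y ∈ Nᗮ ∧ ‖F y‖ = 1)
    (hdim : Module.finrank ℝ E + 1 + Module.finrank ℝ N = Module.finrank ℝ V)
    {A : Set E} (hA : A ∈ nhds x) :
    ∃ O ∈ nhds (F x), ∀ v ∈ O, v ∈ Nᗮ → ‖v‖ = 1 → v ∈ F '' A := by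
  have hFs : HasStrictFDerivAt F (fderiv ℝ F x) x := hF.hasStrictFDerivAt one_ne_zero
  have hx := hmem.self_of_nhds
  have hort : ∀ v, fderiv ℝ F x v ∈ Nᗮ := by
    intro v
    rw [Submodule.mem_orthogonal]
    intro u hu
    have h1 : HasFDerivAt (fun y => inner ℝ u (F y)) ((innerSL ℝ u).comp (fderiv ℝ F x)) x :=
      (innerSL ℝ u).hasFDerivAt.comp x hFs.hasFDerivAt
    have h2 : HasFDerivAt (fun y => inner ℝ u (F y)) (0 : E →L[ℝ] ℝ) x := by
      refine (hasFDerivAt_const (0 : ℝ) x).congr_of_eventuallyEq ?_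
      filter_upwards [hmem] with y hy
      exact (Submodule.mem_orthogonal _ _).1 hy.1 u hu
    simpa using DFunLike.congr_fun (h1.unique h2) v
  have htan : ∀ v, inner ℝ (F x) (fderiv ℝ F x v) = 0 := by
    intro v
    have h1 := hFs.hasFDerivAt.norm_sq
    have h2 : HasFDerivAt (fun y => ‖F y‖ ^ 2) (0 : E →L[ℝ] ℝ) x := by
      refine (hasFDerivAt_const (1 : ℝ) x).congr_of_eventuallyEq ?_
      filter_upwards [hmem] with y hy
      simp [hy.2]
    simpa using DFunLike.congr_fun (h1.unique h2) v
  -- Thicken `F` by a radial coordinate and by the normal directions `N`. The dimensions now agree,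
  -- so an injective derivative is bijective and `G` is open at the point.
  let G : E × ℝ × N → V := fun z => (1 + z.2.1) • F z.1 + (z.2.2 : V)
  let G' : E × ℝ × N →L[ℝ] V := (fderiv ℝ F x).comp (ContinuousLinearMap.fst ℝ E (ℝ × N)) +
    (((ContinuousLinearMap.fst ℝ ℝ N).comp (ContinuousLinearMap.snd ℝ E (ℝ × N))).smulRight (F x)) +
    N.subtypeL.comp ((ContinuousLinearMap.snd ℝ ℝ N).comp (ContinuousLinearMap.snd ℝ E (ℝ × N)))
  have hG : HasStrictFDerivAt G G' (x, 0, 0) := by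
    have h1 : HasStrictFDerivAt (fun z : E × ℝ × N => F z.1)
        ((fderiv ℝ F x).comp (ContinuousLinearMap.fst ℝ E (ℝ × N))) (x, 0, 0) :=
      HasStrictFDerivAt.comp (x, (0 : ℝ), (0 : N)) hFs hasStrictFDerivAt_fst
    have h2 : HasStrictFDerivAt (fun z : E × ℝ × N => 1 + z.2.1)
        ((ContinuousLinearMap.fst ℝ ℝ N).comp (ContinuousLinearMap.snd ℝ E (ℝ × N))) (x, 0, 0) :=
      ((ContinuousLinearMap.fst ℝ ℝ N).comp
        (ContinuousLinearMap.snd ℝ E (ℝ × N))).hasStrictFDerivAt.const_add 1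
    have h3 := (N.subtypeL.comp ((ContinuousLinearMap.snd ℝ ℝ N).comp
        (ContinuousLinearMap.snd ℝ E (ℝ × N)))).hasStrictFDerivAt (x := (x, (0 : ℝ), (0 : N)))
    have h4 := (h2.smul h1).add h3
    refine h4.congr_fderiv ?_
    ext z <;> simp [G']
  have hG'inj : Function.Injective G' := by
    rw [injective_iff_map_eq_zero]
    rintro ⟨v, s, u⟩ h
    have h' : fderiv ℝ F x v + s • F x + (u : V) = 0 := h
    have hu : (u : V) = 0 := by
      have h1 : inner ℝ (u : V) (fderiv ℝ F x v + s • F x + (u : V)) = 0 := by rw [h', inner_zero_right]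
      rw [inner_add_right, inner_add_right, inner_smul_right,
        (Submodule.mem_orthogonal _ _).1 (hort v) u u.2,
        (Submodule.mem_orthogonal _ _).1 hx.1 u u.2] at h1
      simpa using h1
    have hs : s = 0 := by
      have h1 : inner ℝ (F x) (fderiv ℝ F x v + s • F x + (u : V)) = 0 := by rw [h', inner_zero_right]
      rw [inner_add_right, inner_add_right, inner_smul_right, htan, hu,
        real_inner_self_eq_norm_sq, hx.2] at h1
      simpa using h1
    have hv : v = 0 := by
      rw [hu, hs] at h'
      exact (injective_iff_map_eq_zero _).1 hinj v (by simpa using h')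
    simp [hv, hs, Subtype.ext_iff, hu]
  have hrange : (G' : E × ℝ × N →ₗ[ℝ] V).range = ⊤ := by
    rw [LinearMap.range_eq_top]
    refine (LinearMap.injective_iff_surjective_of_finrank_eq_finrank ?_).1 hG'inj
    rw [Module.finrank_prod, Module.finrank_prod, Module.finrank_self, ← hdim]
    ring
  have hmap := hG.map_nhds_eq_of_surj hrange
  have hGx : G (x, 0, 0) = F x := by simp [G]
  rw [hGx] at hmap
  -- The bound `-1 < s` keeps the radial factor positive. Then a point of `G '' B` in `Nᗮ` of norm 1
  -- must have `u = 0` and `s = 0`, so it lies in the image of `F`.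
  let B : Set (E × ℝ × N) := {z | z.1 ∈ A ∩ {y | F y ∈ Nᗮ ∧ ‖F y‖ = 1} ∧ -1 < z.2.1}
  have hB : B ∈ nhds (x, (0 : ℝ), (0 : N)) := by
    refine Filter.inter_mem ?_ ?_
    · exact continuous_fst.continuousAt.preimage_mem_nhds (Filter.inter_mem hA hmem)
    · exact (isOpen_lt continuous_const (by fun_prop :
        Continuous fun z : E × ℝ × N => z.2.1)).mem_nhds (by simp)
  refine ⟨G '' B, hmap ▸ Filter.image_mem_map hB, ?_⟩
  rintro _ ⟨⟨y, s, u⟩, ⟨⟨hyA, hyN, hy1⟩, hs⟩, rfl⟩ hvN hv1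
  change -1 < s at hs
  change (1 + s) • F y + (u : V) ∈ Nᗮ at hvN
  change ‖(1 + s) • F y + (u : V)‖ = 1 at hv1
  have hu : (u : V) = 0 := by
    have h1 := (Submodule.mem_orthogonal _ _).1 hvN u u.2
    rw [inner_add_right, inner_smul_right, (Submodule.mem_orthogonal _ _).1 hyN u u.2] at h1
    simpa using h1
  rw [hu, add_zero, norm_smul, hy1, mul_one, Real.norm_of_nonneg (by linarith)] at hv1
  refine ⟨y, hyA, ?_⟩
  change F y = (1 + s) • F y + (u : V)
  rw [hu, hv1, one_smul, add_zero]

theorem Diffeomorph.injective_mfderiv_coe_comp (Φ : Diffeomorph (𝓡 4) (𝓡 4) FourSphere FourSphere ∞)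
    (p : FourSphere) : ContMDiff (𝓡 4) 𝓘(ℝ, EuclideanSpace ℝ (Fin 5)) ∞
      (fun q : FourSphere => (Φ q : EuclideanSpace ℝ (Fin 5))) ∧
    Function.Injective (mfderiv (𝓡 4) 𝓘(ℝ, EuclideanSpace ℝ (Fin 5))
      (fun q : FourSphere => (Φ q : EuclideanSpace ℝ (Fin 5))) p) := by
  have hc : ContMDiff (𝓡 4) 𝓘(ℝ, EuclideanSpace ℝ (Fin 5)) ∞
      ((↑) : FourSphere → EuclideanSpace ℝ (Fin 5)) := contMDiff_coe_sphere
  refine ⟨hc.comp Φ.contMDiff_toFun, ?_⟩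
  have h1 : mfderiv (𝓡 4) 𝓘(ℝ, EuclideanSpace ℝ (Fin 5))
      (((↑) : FourSphere → EuclideanSpace ℝ (Fin 5)) ∘ Φ) p = _ :=
    mfderiv_comp p ((hc.mdifferentiable (by simp)) (Φ p)) (Φ.mdifferentiable (by simp) p)
  change Function.Injective (mfderiv (𝓡 4) 𝓘(ℝ, EuclideanSpace ℝ (Fin 5))
      (((↑) : FourSphere → EuclideanSpace ℝ (Fin 5)) ∘ Φ) p)
  rw [h1]
  exact (injective_mvfderiv_subtypeVal_sphere (Φ p)).comp
    (Φ.mfderivToContinuousLinearEquiv (by simp) (x := p)).injective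

section HalfBall

variable {m : ℕ}

theorem halfBall_mem_nhds {x : EuclideanSpace ℝ (Fin (m + 2))} (hx2 : ‖x‖ < 2)
    (hx : 0 < x (Fin.last (m + 1))) :
    {x | x ∈ halfBall m ∧ ‖x‖ < 2 ∧ 0 < x (Fin.last (m + 1))} ∈ nhds x := by
  have h : IsOpen {x : EuclideanSpace ℝ (Fin (m + 2)) | ‖x‖ < 2 ∧ 0 < x (Fin.last (m + 1))} :=
    (isOpen_lt continuous_norm continuous_const).inter (isOpen_lt continuous_const
      (by fun_prop : Continuous fun x : EuclideanSpace ℝ (Fin (m + 2)) => x (Fin.last (m + 1))))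
  refine Filter.mem_of_superset (h.mem_nhds ⟨hx2, hx⟩) fun y hy => ⟨⟨hy.1.le, hy.2.le⟩, hy⟩

/-- At interior points, an embedded half-ball is an immersion. -/
theorem contMDiffAt_of_interior {f : EuclideanSpace ℝ (Fin (m + 2)) → FourSphere}
    {x : EuclideanSpace ℝ (Fin (m + 2))} (hx2 : ‖x‖ < 2) (hx : 0 < x (Fin.last (m + 1)))
    (hf : ContMDiffWithinAt 𝓘(ℝ, EuclideanSpace ℝ (Fin (m + 2))) (𝓡 4) ∞ f (halfBall m) x ∧
      Function.Injective
        (mfderivWithin 𝓘(ℝ, EuclideanSpace ℝ (Fin (m + 2))) (𝓡 4) f (halfBall m) x)) :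
    ContMDiffAt 𝓘(ℝ, EuclideanSpace ℝ (Fin (m + 2))) (𝓡 4) ∞ f x ∧
      Function.Injective (mfderiv 𝓘(ℝ, EuclideanSpace ℝ (Fin (m + 2))) (𝓡 4) f x) := by
  have hn : halfBall m ∈ nhds x := Filter.mem_of_superset (halfBall_mem_nhds hx2 hx) fun y hy => hy.1
  refine ⟨hf.1.contMDiffAt hn, ?_⟩
  rw [← mfderivWithin_of_mem_nhds hn]
  exact hf.2

/-- The data of a trivial ball system in a piece of a trisection. -/
theorem exists_isOpen_inter_subset_of_trivial {J : Finset (Fin 3)}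
    {N : Submodule ℝ (EuclideanSpace ℝ (Fin 5))} (hN : maxCone J ⊆ (Nᗮ : Set _))
    (hdim : m + 3 + Module.finrank ℝ N = 5)
    (Φ : Diffeomorph (𝓡 4) (𝓡 4) FourSphere FourSphere ∞)
    {f : EuclideanSpace ℝ (Fin (m + 2)) → FourSphere} {bd : Set FourSphere}
    (hf : ContinuousOn f (halfBall m)) (hinj : InjOn f (halfBall m))
    (hmaps : MapsTo f (halfBall m) (Φ '' stratum J))
    (hbd : ∀ x ∈ halfBall m, (f x ∈ bd ↔ x (Fin.last (m + 1)) = 0))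
    (hI : ∀ p ∈ Φ '' stratum J, (p ∈ Φ '' openStratum J ↔ p ∉ bd))
    (hsmooth : ∀ x ∈ halfBall m, f x ∉ bd →
      ContMDiffWithinAt 𝓘(ℝ, EuclideanSpace ℝ (Fin (m + 2))) (𝓡 4) ∞ f (halfBall m) x ∧
      Function.Injective
        (mfderivWithin 𝓘(ℝ, EuclideanSpace ℝ (Fin (m + 2))) (𝓡 4) f (halfBall m) x))
    {x₀ : EuclideanSpace ℝ (Fin (m + 2))} (hx₀ : x₀ ∈ halfBall m) (hx₀n : ‖x₀‖ < 2) :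
    ∃ V, IsOpen V ∧ f x₀ ∈ V ∧ V ∩ Φ '' stratum J ⊆ f '' {x | x ∈ halfBall m ∧ ‖x‖ < 2} := by
  refine exists_isOpen_inter_subset_image_halfBall (I := Φ '' openStratum J) hf hinj ?_ ?_ ?_ ?_ hx₀
    hx₀n (hmaps hx₀)
  · have := Φ.toHomeomorph.image_closure (openStratum J)
    exact (image_mono stratum_subset_closure).trans this.subset
  · intro x hx
    rw [hI _ (hmaps hx), hbd x hx]
    exact ⟨fun h => lt_of_le_of_ne hx.2 (Ne.symm h), fun h => h.ne'⟩
  · intro x hx hx2 hxl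
    obtain ⟨h1, h2⟩ := contMDiffAt_of_interior hx2 hxl
      (hsmooth x hx fun h => hxl.ne' ((hbd x hx).1 h))
    -- Back in the model, the half-ball is an immersion into the unit sphere of `Nᗮ`, which by
    -- `hdim` has the dimension of the half-ball.
    let F : EuclideanSpace ℝ (Fin (m + 2)) → EuclideanSpace ℝ (Fin 5) := fun y => (Φ.symm (f y)).1
    obtain ⟨h3, h4⟩ := Φ.symm.injective_mfderiv_coe_comp (f x)
    have hF : ContMDiffAt 𝓘(ℝ, EuclideanSpace ℝ (Fin (m + 2))) 𝓘(ℝ, EuclideanSpace ℝ (Fin 5)) ∞ F x :=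
      ContMDiffAt.comp (g := fun q : FourSphere => (Φ.symm q : EuclideanSpace ℝ (Fin 5))) x
        (h3.contMDiffAt) h1
    have hFinj : Function.Injective (fderiv ℝ F x) := by
      rw [← mfderiv_eq_fderiv]
      have := mfderiv_comp x ((h3.mdifferentiable (by simp)) (f x)) (h1.mdifferentiableAt (by simp))
      change Function.Injective (mfderiv _ _ ((fun q : FourSphere =>
        (Φ.symm q : EuclideanSpace ℝ (Fin 5))) ∘ f) x)
      rw [this]
      exact h4.comp h2
    have hA := halfBall_mem_nhds hx2 hxl
    have hFmem : ∀ y ∈ halfBall m, F y ∈ maxCone J := by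
      intro y hy
      obtain ⟨p, hp, hpy⟩ := hmaps hy
      change (Φ.symm (f y)).1 ∈ maxCone J
      rw [← hpy, Φ.symm_apply_apply]
      exact hp
    obtain ⟨O, hO, hOsub⟩ := exists_nhds_sphere_subset_image (N := N)
      ((contMDiffAt_iff_contDiffAt.1 hF).of_le (by simp)) hFinj
      (by filter_upwards [hA] with y hy using ⟨hN (hFmem y hy.1), norm_eq_of_mem_sphere _⟩)
      (by rw [finrank_euclideanSpace_fin, finrank_euclideanSpace_fin]; omega) hA
    obtain ⟨O', hO'O, hO'o, hxO'⟩ := mem_nhds_iff.1 hO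
    refine ⟨(fun p : FourSphere => (Φ.symm p).1) ⁻¹' O', hO'o.preimage
      (continuous_subtype_val.comp Φ.symm.continuous), hxO', ?_⟩
    rintro _ ⟨hpO, q, hq, rfl⟩
    have hq1 : q.1 ∈ O' := by simpa using hpO
    obtain ⟨y, hy, hyq⟩ := hOsub q.1 (hO'O hq1) (hN hq.1) (norm_eq_of_mem_sphere q)
    refine ⟨y, hy, ?_⟩
    have : Φ.symm (f y) = q := Subtype.ext hyq
    rw [← this, Φ.apply_symm_apply]
  · rintro z - U hU hz
    obtain ⟨V, hVU, hVo, hzV, hVc⟩ := exists_isPreconnected_inter_openStratum J (Φ.symm z) (Φ ⁻¹' U)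
      (hU.preimage Φ.continuous) (by simpa using hz)
    refine ⟨Φ '' V, image_subset_iff.2 hVU, Φ.toHomeomorph.isOpenMap V hVo, ⟨_, hzV, by simp⟩, ?_⟩
    rw [← image_inter (f := Φ) Φ.injective]
    exact hVc.image _ Φ.continuous.continuousOn

end HalfBall

/-! ### From trivial ball systems to half-ball systems -/

/-- A trivial ball system as a system of half-balls in the ambient ball. -/
noncomputable def halfBallMap {m c : ℕ} {X : Set FourSphere}
    (e : Fin c → EuclideanSpace ℝ (Fin (m + 2)) → FourSphere)
    (h : ∀ k, MapsTo (e k) (halfBall m) X) (k : Fin c) (x : EuclideanSpace ℝ (Fin (m + 2))) : X :=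
  -- Values off the half-ball are never used; the image of the centre is a default.
  open Classical in if hx : x ∈ halfBall m then ⟨e k x, h k hx⟩ else
    ⟨e k 0, h k ⟨by simp, by simp⟩⟩

theorem halfBallMap_coe {m c : ℕ} {X : Set FourSphere}
    {e : Fin c → EuclideanSpace ℝ (Fin (m + 2)) → FourSphere}
    (h : ∀ k, MapsTo (e k) (halfBall m) X) (k : Fin c) {x : EuclideanSpace ℝ (Fin (m + 2))}
    (hx : x ∈ halfBall m) : (halfBallMap e h k x : FourSphere) = e k x := by
  simp [halfBallMap, hx]

/-- Only openness has content. Smoothness is needed off `bd` alone, so the corner plays no role. The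
dimension count covers 4-balls with `N = ⊥` and 3-balls with `N` a line. -/
theorem isHalfBallSystem_of_trivial {m c : ℕ} {J : Finset (Fin 3)}
    {N : Submodule ℝ (EuclideanSpace ℝ (Fin 5))} (hN : maxCone J ⊆ (Nᗮ : Set _))
    (hdim : m + 3 + Module.finrank ℝ N = 5)
    (Φ : Diffeomorph (𝓡 4) (𝓡 4) FourSphere FourSphere ∞)
    {e : Fin c → EuclideanSpace ℝ (Fin (m + 2)) → FourSphere} {bd : Set FourSphere}
    (hcont : ∀ k, ContinuousOn (e k) (halfBall m))
    (hinj : ∀ k l, ∀ x ∈ halfBall m, ∀ y ∈ halfBall m, e k x = e l y → k = l ∧ x = y)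
    (hmaps : ∀ k, MapsTo (e k) (halfBall m) (Φ '' stratum J))
    (hbd : ∀ k, ∀ x ∈ halfBall m, e k x ∈ bd ↔ x (Fin.last (m + 1)) = 0)
    (hI : ∀ p ∈ Φ '' stratum J, (p ∈ Φ '' openStratum J ↔ p ∉ bd))
    (hsmooth : ∀ k, ∀ x ∈ halfBall m, e k x ∉ bd →
      ContMDiffWithinAt 𝓘(ℝ, EuclideanSpace ℝ (Fin (m + 2))) (𝓡 4) ∞ (e k) (halfBall m) x ∧
      Function.Injective
        (mfderivWithin 𝓘(ℝ, EuclideanSpace ℝ (Fin (m + 2))) (𝓡 4) (e k) (halfBall m) x)) :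
    IsHalfBallSystem (halfBallMap e hmaps) where
  continuousOn k := by
    rw [Topology.IsInducing.subtypeVal.continuousOn_iff]
    exact (hcont k).congr fun x hx => halfBallMap_coe hmaps k hx
  injective k l x hx y hy h := by
    refine hinj k l x hx y hy ?_
    rw [← halfBallMap_coe hmaps k hx, ← halfBallMap_coe hmaps l hy, h]
  isOpen_image k := by
    rw [isOpen_iff_mem_nhds]
    rintro _ ⟨x, ⟨hx, hx2⟩, rfl⟩
    obtain ⟨V, hVo, hxV, hV⟩ := exists_isOpen_inter_subset_of_trivial hN hdim Φ (hcont k)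
      (fun x hx y hy h => (hinj k k x hx y hy h).2) (hmaps k) (hbd k) hI (hsmooth k) hx hx2
    refine Filter.mem_of_superset ((hVo.preimage continuous_subtype_val).mem_nhds
      (by rw [mem_preimage, halfBallMap_coe hmaps k hx]; exact hxV)) ?_
    intro p hp
    obtain ⟨y, hy, hyp⟩ := hV ⟨hp, p.2⟩
    exact ⟨y, hy, Subtype.ext (by rw [halfBallMap_coe hmaps k hy.1, hyp])⟩

/-! ### Meridians of domes -/

/-- An immersion of a four-dimensional vector space into the 4-sphere is open. -/
theorem image_mem_nhds_of_immersion {h : EuclideanSpace ℝ (Fin 4) → FourSphere}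
    {u : EuclideanSpace ℝ (Fin 4)} (hs : ContMDiffAt 𝓘(ℝ, EuclideanSpace ℝ (Fin 4)) (𝓡 4) ∞ h u)
    (hinj : Function.Injective (mfderiv 𝓘(ℝ, EuclideanSpace ℝ (Fin 4)) (𝓡 4) h u))
    {A : Set (EuclideanSpace ℝ (Fin 4))} (hA : A ∈ nhds u) : h '' A ∈ nhds (h u) := by
  have hc : ContMDiff (𝓡 4) 𝓘(ℝ, EuclideanSpace ℝ (Fin 5)) ∞
      ((↑) : FourSphere → EuclideanSpace ℝ (Fin 5)) := contMDiff_coe_sphere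
  let F : EuclideanSpace ℝ (Fin 4) → EuclideanSpace ℝ (Fin 5) := fun y => (h y).1
  have hF : ContMDiffAt 𝓘(ℝ, EuclideanSpace ℝ (Fin 4)) 𝓘(ℝ, EuclideanSpace ℝ (Fin 5)) ∞ F u :=
    ContMDiffAt.comp (g := ((↑) : FourSphere → EuclideanSpace ℝ (Fin 5))) u hc.contMDiffAt hs
  have hFinj : Function.Injective (fderiv ℝ F u) := by
    rw [← mfderiv_eq_fderiv]
    have := mfderiv_comp u ((hc.mdifferentiable (by simp)) (h u)) (hs.mdifferentiableAt (by simp))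
    change Function.Injective (mfderiv _ _ (((↑) : FourSphere → EuclideanSpace ℝ (Fin 5)) ∘ h) u)
    rw [this]
    exact (injective_mvfderiv_subtypeVal_sphere (h u)).comp hinj
  obtain ⟨O, hO, hsub⟩ := exists_nhds_sphere_subset_image (N := ⊥)
    ((contMDiffAt_iff_contDiffAt.1 hF).of_le (by simp)) hFinj
    (Filter.Eventually.of_forall fun y => ⟨by simp, norm_eq_of_mem_sphere _⟩) (by simp) hA
  refine Filter.mem_of_superset (continuous_subtype_val.continuousAt.preimage_mem_nhds hO) ?_
  intro p hp
  obtain ⟨y, hy, hyp⟩ := hsub p.1 hp (by simp) (norm_eq_of_mem_sphere p)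
  exact ⟨y, hy, Subtype.ext hyp⟩

/-- An injective immersion of an open subset of `ℝ⁴` into the 4-sphere is inverse to a smooth
chart. -/
theorem exists_chart_of_immersion {h : EuclideanSpace ℝ (Fin 4) → FourSphere}
    {U : Set (EuclideanSpace ℝ (Fin 4))} (hU : IsOpen U) (hinj : InjOn h U)
    (hs : ∀ u ∈ U, ContMDiffAt 𝓘(ℝ, EuclideanSpace ℝ (Fin 4)) (𝓡 4) ∞ h u)
    (hd : ∀ u ∈ U, Function.Injective (mfderiv 𝓘(ℝ, EuclideanSpace ℝ (Fin 4)) (𝓡 4) h u)) :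
    ∃ φ ∈ IsManifold.maximalAtlas (𝓡 4) ∞ FourSphere,
      φ.target = U ∧ φ.source = h '' U ∧ ∀ u ∈ U, φ.symm u = h u := by
  have hopen : IsOpenMap (U.domRestrict h) := by
    rw [isOpenMap_iff_nhds_le]
    intro u
    rw [Filter.le_map_iff]
    intro S hS
    rw [nhds_subtype_eq_comap] at hS
    obtain ⟨A, hA, hAS⟩ := Filter.mem_comap.1 hS
    refine Filter.mem_of_superset (image_mem_nhds_of_immersion (hs u u.2) (hd u u.2)
      (Filter.inter_mem hA (hU.mem_nhds u.2))) ?_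
    rintro _ ⟨v, ⟨hvA, hvU⟩, rfl⟩
    exact ⟨⟨v, hvU⟩, hAS hvA, rfl⟩
  let ψ : OpenPartialHomeomorph (EuclideanSpace ℝ (Fin 4)) FourSphere :=
    OpenPartialHomeomorph.ofContinuousOpenRestrict (hinj.toPartialEquiv)
      (fun u hu => (hs u hu).continuousAt.continuousWithinAt) hopen hU
  refine ⟨ψ.symm, ?_, rfl, rfl, fun u _ => rfl⟩
  intro f hf
  have hfmax : f ∈ IsManifold.maximalAtlas (𝓡 4) ∞ FourSphere :=
    IsManifold.subset_maximalAtlas hf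
  have hcd : ContDiffOn ℝ ∞ (ψ.trans f) (ψ.trans f).source := by
    rw [← contMDiffOn_iff_contDiffOn]
    refine (contMDiffOn_of_mem_maximalAtlas hfmax).comp
      (fun u hu => (hs u (inter_subset_left hu)).contMDiffWithinAt) ?_
    exact fun u hu => hu.2
  have hcda : ∀ u ∈ (ψ.trans f).source, ContDiffAt ℝ ∞ (ψ.trans f) u := fun u hu =>
    (hcd u hu).contDiffAt ((ψ.trans f).open_source.mem_nhds hu)
  have hdinj : ∀ u ∈ (ψ.trans f).source, Function.Injective (fderiv ℝ (ψ.trans f) u) := by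
    intro u hu
    rw [← mfderiv_eq_fderiv]
    have hfm := mdifferentiable_of_mem_atlas (I := 𝓡 4) hf
    have := mfderiv_comp (I := 𝓡 4) (I' := 𝓡 4) (I'' := 𝓡 4) (g := f) (f := h) u
      (hfm.mdifferentiableAt hu.2) ((hs u (inter_subset_left hu)).mdifferentiableAt (by simp))
    change Function.Injective (mfderiv _ _ (f ∘ h) u)
    rw [this]
    exact (hfm.mfderiv_injective hu.2).comp (hd u (inter_subset_left hu))
  -- An injective endomorphism of ℝ⁴ is invertible, so the inverse function theorem makes the
  -- inverse transition map smooth as well.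
  have hcds : ContDiffOn ℝ ∞ (ψ.trans f).symm (ψ.trans f).target := by
    intro v hv
    have hu := (ψ.trans f).map_target hv
    let L : EuclideanSpace ℝ (Fin 4) ≃L[ℝ] EuclideanSpace ℝ (Fin 4) :=
      (LinearEquiv.ofInjectiveEndo (fderiv ℝ (ψ.trans f) ((ψ.trans f).symm v)).toLinearMap
        (hdinj _ hu)).toContinuousLinearEquiv
    refine ((ψ.trans f).contDiffAt_symm (f₀' := L) hv ?_ (hcda _ hu)).contDiffWithinAt
    have : (L : EuclideanSpace ℝ (Fin 4) →L[ℝ] EuclideanSpace ℝ (Fin 4)) =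
        fderiv ℝ (ψ.trans f) ((ψ.trans f).symm v) := by
      ext1 x; rfl
    rw [this]
    exact ((hcda _ hu).differentiableAt (by simp)).hasFDerivAt
  have h1 : ψ.trans f ∈ contDiffGroupoid ∞ (𝓡 4) := by
    rw [contDiffGroupoid, mem_groupoid_of_pregroupoid]
    refine ⟨?_, ?_⟩
    · simpa [contDiffPregroupoid] using hcd
    · simpa [contDiffPregroupoid] using hcds
  refine ⟨by simpa using h1, ?_⟩
  have h2 := (contDiffGroupoid ∞ (𝓡 4)).symm h1
  rwa [OpenPartialHomeomorph.trans_symm_eq_symm_trans_symm] at h2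

/-- Coordinates of `ℝ⁴` near the pole of the dome in which the dome is a coordinate plane. -/
noncomputable def domeShear (u : EuclideanSpace ℝ (Fin 4)) : EuclideanSpace ℝ (Fin 4) :=
  !₂[u 2, u 0, u 1, u 3 + Real.sqrt (1 - u 0 ^ 2 - u 1 ^ 2)]

/-- The inverse of `domeShear`. -/
noncomputable def domeUnshear (x : EuclideanSpace ℝ (Fin 4)) : EuclideanSpace ℝ (Fin 4) :=
  !₂[x 1, x 2, x 0, x 3 - Real.sqrt (1 - x 1 ^ 2 - x 2 ^ 2)]

theorem domeUnshear_domeShear (u : EuclideanSpace ℝ (Fin 4)) : domeUnshear (domeShear u) = u := by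
  ext i
  fin_cases i <;> simp [domeShear, domeUnshear]

theorem contDiffAt_domeShear {u : EuclideanSpace ℝ (Fin 4)} (hu : u 0 ^ 2 + u 1 ^ 2 < 1) :
    ContDiffAt ℝ ∞ domeShear u := by
  have h3 : ContDiffAt ℝ ∞ (fun u : EuclideanSpace ℝ (Fin 4) =>
      Real.sqrt (1 - u 0 ^ 2 - u 1 ^ 2)) u := ContDiffAt.sqrt (by fun_prop) (by linarith)
  unfold domeShear
  rw [contDiffAt_euclidean]
  intro i
  fin_cases i <;> simp <;> fun_prop

theorem contDiffAt_domeUnshear {x : EuclideanSpace ℝ (Fin 4)} (hx : x 1 ^ 2 + x 2 ^ 2 < 1) :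
    ContDiffAt ℝ ∞ domeUnshear x := by
  have h3 : ContDiffAt ℝ ∞ (fun u : EuclideanSpace ℝ (Fin 4) =>
      Real.sqrt (1 - u 1 ^ 2 - u 2 ^ 2)) x := ContDiffAt.sqrt (by fun_prop) (by linarith)
  unfold domeUnshear
  rw [contDiffAt_euclidean]
  intro i
  fin_cases i <;> simp <;> fun_prop

/-- The chain rule for the smooth left inverse `domeUnshear` provides a left inverse of the
derivative. -/
theorem injective_fderiv_domeShear {u : EuclideanSpace ℝ (Fin 4)} (hu : u 0 ^ 2 + u 1 ^ 2 < 1) :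
    Function.Injective (fderiv ℝ domeShear u) := by
  have h1 := ((contDiffAt_domeShear hu).differentiableAt (by simp)).hasFDerivAt
  have h2 : HasFDerivAt domeUnshear (fderiv ℝ domeUnshear (domeShear u)) (domeShear u) :=
    ((contDiffAt_domeUnshear (x := domeShear u) hu).differentiableAt (by simp)).hasFDerivAt
  have h3 := h2.comp u h1
  have h4 : domeUnshear ∘ domeShear = id := funext domeUnshear_domeShear
  rw [h4] at h3
  have h5 := h3.unique (hasFDerivAt_id u)
  exact Function.LeftInverse.injective (g := fderiv ℝ domeUnshear (domeShear u))
    fun v => DFunLike.congr_fun h5 v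

/-- The circle of radius `r` around the pole of the dome in the normal plane. -/
noncomputable def poleCircle (r θ : ℝ) : EuclideanSpace ℝ (Fin 4) :=
  !₂[r * Real.cos θ, 0, 0, 1 + r * Real.sin θ]

theorem domeShear_normalCircle (r θ : ℝ) : domeShear (normalCircle r θ) = poleCircle r θ := by
  ext i
  fin_cases i <;> simp [domeShear, normalCircle, poleCircle, add_comm]

theorem norm_sq_poleCircle (r θ : ℝ) : ‖poleCircle r θ‖ ^ 2 = 1 + 2 * r * Real.sin θ + r ^ 2 := by
  rw [EuclideanSpace.real_norm_sq_eq, Fin.sum_univ_four]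
  simp [poleCircle]
  linear_combination r ^ 2 * Real.sin_sq_add_cos_sq θ

/-- The shear measures `u 3` from the graph of the upper hemisphere. Positivity of the last
coordinate excludes the lower one, which also solves the norm equation. -/
theorem mem_halfBallDome_domeShear {u : EuclideanSpace ℝ (Fin 4)} (hu : u 0 ^ 2 + u 1 ^ 2 < 1)
    (hpos : 0 < domeShear u 3) : domeShear u ∈ halfBallDome 2 ↔ u 2 = 0 ∧ u 3 = 0 := by
  set s := Real.sqrt (1 - u 0 ^ 2 - u 1 ^ 2) with hs
  have hs0 : 0 < s := Real.sqrt_pos.2 (by linarith)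
  have hss : s ^ 2 = 1 - u 0 ^ 2 - u 1 ^ 2 := Real.sq_sqrt (by linarith)
  have h3 : domeShear u 3 = u 3 + s := by simp [domeShear, hs]
  have hnorm : ‖domeShear u‖ ^ 2 = u 2 ^ 2 + u 0 ^ 2 + u 1 ^ 2 + (u 3 + s) ^ 2 := by
    rw [EuclideanSpace.real_norm_sq_eq, Fin.sum_univ_four]
    simp [domeShear, hs]
  rw [h3] at hpos
  constructor
  · rintro ⟨h1, h2, -⟩
    have h2' : u 2 = 0 := h2
    have hn : ‖domeShear u‖ = 1 := h1
    refine ⟨h2', ?_⟩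
    rw [hn, h2'] at hnorm
    have : (u 3 + s) ^ 2 = s ^ 2 := by rw [hss]; linarith
    have := (pow_left_inj₀ hpos.le hs0.le two_ne_zero).1 this
    linarith
  · rintro ⟨h2, h4⟩
    refine ⟨?_, h2, ?_⟩
    · change ‖domeShear u‖ = 1
      have : ‖domeShear u‖ ^ 2 = 1 ^ 2 := by rw [hnorm, h2, h4, zero_add, hss]; ring
      exact (pow_left_inj₀ (norm_nonneg _) zero_le_one two_ne_zero).1 this
    · change 0 ≤ domeShear u 3
      rw [h3]
      exact hpos.le

/-- The round circle around the pole of a dome is a meridian. -/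
theorem isMeridian_of_dome {K : Set FourSphere} {f : EuclideanSpace ℝ (Fin 4) → FourSphere}
    (hinj : InjOn f (halfBall 2))
    (hs : ∀ x : EuclideanSpace ℝ (Fin 4), ‖x‖ < 2 → 0 < x 3 →
      ContMDiffAt 𝓘(ℝ, EuclideanSpace ℝ (Fin 4)) (𝓡 4) ∞ f x ∧
      Function.Injective (mfderiv 𝓘(ℝ, EuclideanSpace ℝ (Fin 4)) (𝓡 4) f x))
    (hK : ∀ x : EuclideanSpace ℝ (Fin 4), ‖x‖ < 2 → 0 < x 3 → (f x ∈ K ↔ x ∈ halfBallDome 2))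
    {q : ↥Kᶜ} (μ : Path q q)
    (hμ : ∀ t : unitInterval, (μ t : FourSphere) = f (poleCircle (1 / 2) (2 * Real.pi * t))) :
    IsMeridian K μ := by
  -- The region where the square root is smooth and the shear lands in the open interior of the
  -- half-ball.
  let U : Set (EuclideanSpace ℝ (Fin 4)) := {u | u 0 ^ 2 + u 1 ^ 2 < 1} ∩
    domeShear ⁻¹' {x | ‖x‖ < 2 ∧ 0 < x 3}
  have hcont : ContinuousOn domeShear {u | u 0 ^ 2 + u 1 ^ 2 < 1} := fun u hu =>
    (contDiffAt_domeShear hu).continuousAt.continuousWithinAt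
  have hU : IsOpen U := by
    refine hcont.isOpen_inter_preimage (isOpen_lt (by fun_prop) continuous_const) ?_
    exact (isOpen_lt continuous_norm continuous_const).inter (isOpen_lt continuous_const
      (by fun_prop : Continuous fun x : EuclideanSpace ℝ (Fin 4) => x 3))
  have hUinj : InjOn (f ∘ domeShear) U := by
    intro u hu v hv huv
    have h1 : domeShear u ∈ halfBall 2 := ⟨hu.2.1.le, hu.2.2.le⟩
    have h2 : domeShear v ∈ halfBall 2 := ⟨hv.2.1.le, hv.2.2.le⟩
    rw [← domeUnshear_domeShear u, ← domeUnshear_domeShear v, hinj h1 h2 huv]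
  have hcm : ∀ u ∈ U, ContMDiffAt 𝓘(ℝ, EuclideanSpace ℝ (Fin 4)) 𝓘(ℝ, EuclideanSpace ℝ (Fin 4)) ∞
      domeShear u := fun u hu => contMDiffAt_iff_contDiffAt.2 (contDiffAt_domeShear hu.1)
  obtain ⟨φ, hφ, hφt, hφs, hφsymm⟩ := exists_chart_of_immersion (h := f ∘ domeShear) hU hUinj
    (fun u hu => (hs _ hu.2.1 hu.2.2).1.comp u (hcm u hu)) (fun u hu => by
      have := mfderiv_comp u ((hs _ hu.2.1 hu.2.2).1.mdifferentiableAt (by simp))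
        ((hcm u hu).mdifferentiableAt (by simp))
      rw [this, mfderiv_eq_fderiv]
      exact (hs _ hu.2.1 hu.2.2).2.comp (injective_fderiv_domeShear hu.1))
  have hφapply : ∀ u ∈ U, φ (f (domeShear u)) = u := by
    intro u hu
    have h1 := φ.right_inv (hφt ▸ hu : u ∈ φ.target)
    rwa [hφsymm u hu] at h1
  have hslice : ∀ u ∈ U, f (domeShear u) ∈ K ↔ u 2 = 0 ∧ u 3 = 0 := fun u hu => by
    rw [hK _ hu.2.1 hu.2.2, mem_halfBallDome_domeShear hu.1 hu.2.2]
  -- For `s ≤ 1/2` the squared norm is at most `9/4 < 4`, and the last coordinate at least `1/2`.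
  have hcirc : ∀ s ∈ Icc (0 : ℝ) (1 / 2), ∀ θ, normalCircle s θ ∈ U := by
    intro s hs θ
    have h1 := Real.sin_le_one θ
    have h2 := Real.neg_one_le_sin θ
    refine ⟨by simp [normalCircle], ?_⟩
    rw [mem_preimage, domeShear_normalCircle]
    constructor
    · refine lt_of_pow_lt_pow_left₀ 2 (by norm_num) ?_
      rw [norm_sq_poleCircle]
      nlinarith [hs.1, hs.2]
    · simp only [poleCircle]
      simp
      nlinarith [hs.1, hs.2]
  have h0 : normalCircle 0 0 = 0 := by
    ext i; fin_cases i <;> simp [normalCircle]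
  have h0U : (0 : EuclideanSpace ℝ (Fin 4)) ∈ U := h0 ▸ hcirc 0 (by norm_num) 0
  have hp : φ (f (domeShear 0)) = 0 := hφapply 0 h0U
  -- The meridian is centred at the pole `domeShear 0` of the dome, which has chart coordinate 0.
  refine ⟨φ, ⟨hφ, ?_⟩, f (domeShear 0), ⟨(hslice 0 h0U).2 (by simp), ?_⟩, 1 / 2, by norm_num, ?_, ?_⟩
  · rw [hφs]
    rintro _ ⟨u, hu, rfl⟩
    rw [Function.comp_apply, hφapply u hu]
    exact hslice u hu
  · rw [hφs]
    exact ⟨0, h0U, rfl⟩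
  · intro s hs θ
    rw [hp, zero_add, hφt]
    exact hcirc s hs θ
  · intro t
    rw [hp, zero_add, hφsymm _ (hcirc _ (by norm_num) _), hμ t, Function.comp_apply,
      domeShear_normalCircle]

/-! ### Path classes and convex covers -/

/-- A transitive relation which holds on intervals inside the members of a finite family of closed
order connected sets holds on all intervals covered by the family. -/
theorem rel_of_Icc_subset_biUnion {ι : Type*} (Q : ℝ → ℝ → Prop) (D : ι → Set ℝ)
    (htrans : ∀ r s t, r ≤ s → s ≤ t → Q r s → Q s t → Q r t) (hD : ∀ a, IsClosed (D a))
    (hD' : ∀ a, (D a).OrdConnected) (hbase : ∀ a r s, r ≤ s → Icc r s ⊆ D a → Q r s)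
    (F : Finset ι) (r s : ℝ) (hrs : r ≤ s) (h : Icc r s ⊆ ⋃ a ∈ F, D a) : Q r s := by
  classical
  induction F using Finset.induction_on generalizing r s with
  | empty => simpa using h (left_mem_Icc.2 hrs)
  | insert a F _ ih =>
    rw [Finset.set_biUnion_insert] at h
    have hcl : IsClosed (⋃ a ∈ F, D a) := isClosed_biUnion_finset fun a _ => hD a
    by_cases hne : (Icc r s ∩ D a).Nonempty
    · have hcomp : IsCompact (Icc r s ∩ D a) := isCompact_Icc.inter_right (hD a)
      have h0 := hcomp.sInf_mem hne
      have h1 := hcomp.sSup_mem hne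
      set t₀ := sInf (Icc r s ∩ D a)
      set t₁ := sSup (Icc r s ∩ D a)
      have h01 : t₀ ≤ t₁ := csInf_le hcomp.bddBelow h1
      have hmid : Q t₀ t₁ := hbase a _ _ h01 ((hD' a).out h0.2 h1.2)
      have hright : Q t₀ s := by
        rcases h1.1.2.eq_or_lt with heq | hlt
        · rwa [← heq]
        refine htrans _ _ _ h01 h1.1.2 hmid (ih _ _ h1.1.2 ?_)
        rw [← closure_Ioc hlt.ne]
        refine closure_minimal (fun t ht => ?_) hcl
        refine (h ⟨h1.1.1.trans ht.1.le, ht.2⟩).resolve_left fun hta => ?_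
        exact ht.1.not_ge (le_csSup hcomp.bddAbove ⟨⟨h1.1.1.trans ht.1.le, ht.2⟩, hta⟩)
      rcases h0.1.1.eq_or_lt with heq | hlt
      · rwa [heq]
      refine htrans _ _ _ h0.1.1 h0.1.2 (ih _ _ h0.1.1 ?_) hright
      rw [← closure_Ico hlt.ne]
      refine closure_minimal (fun t ht => ?_) hcl
      refine (h ⟨ht.1, ht.2.le.trans h0.1.2⟩).resolve_left fun hta => ?_
      exact ht.2.not_ge (csInf_le hcomp.bddBelow ⟨⟨ht.1, ht.2.le.trans h0.1.2⟩, hta⟩)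
    · refine ih _ _ hrs fun t ht => (h ht).resolve_left fun hta => hne ⟨t, ht, hta⟩

namespace PathClass

variable {M V ι : Type*} [TopologicalSpace M] [NormedAddCommGroup V] [NormedSpace ℝ V]

theorem map_trans {N : Type*} [TopologicalSpace N] {x y z : M} (c : Path.Homotopic.Quotient x y)
    (d : Path.Homotopic.Quotient y z) (f : C(M, N)) :
    (c.trans d).map f = (c.map f).trans (d.map f) := by
  induction c using Path.Homotopic.Quotient.ind with | mk c =>
  induction d using Path.Homotopic.Quotient.ind with | mk d =>
  rw [← Path.Homotopic.Quotient.mk_trans, ← Path.Homotopic.Quotient.mk_map, Path.map_trans]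
  rfl

/-- The segment between two points of a convex set. -/
noncomputable def segmentPath {B : Set V} (hB : Convex ℝ B) (u v : B) : Path u v where
  toFun t := ⟨AffineMap.lineMap (u : V) (v : V) (t : ℝ), hB.lineMap_mem u.2 v.2 t.2⟩
  continuous_toFun := by
    refine Continuous.subtype_mk ?_ _
    exact AffineMap.lineMap_continuous.comp continuous_subtype_val
  source' := by ext; simp
  target' := by ext; simp

/-- In the contractible set `B` every path class is that of a segment, and a segment meets each
closed convex member in an interval. This avoids paths that cross between closed sets infinitely
often. -/
theorem map_convex_of_cover [Finite ι] {B : Set V} (hB : Convex ℝ B) (g : C(B, M)) (C : ι → Set V)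
    (hC : ∀ a, IsClosed (C a)) (hC' : ∀ a, Convex ℝ (C a)) (hcov : ⋃ a, C a = univ) (Z : ι → Set M)
    (T : Set M) (hgT : ∀ u, g u ∈ T) (hgZ : ∀ a (u : B), (u : V) ∈ C a → g u ∈ Z a)
    (P : ∀ {x y : M}, Path.Homotopic.Quotient x y → Prop)
    (htrans : ∀ {x y z : M} (c : Path.Homotopic.Quotient x y) (d : Path.Homotopic.Quotient y z),
      y ∈ T → P c → P d → P (c.trans d))
    (hbase : ∀ a {x y : M} (c : Path.Homotopic.Quotient x y), LiesIn (Z a) c → P c)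
    {u v : B} (c : Path.Homotopic.Quotient u v) : P (c.map g) := by
  classical
  have : Fintype ι := Fintype.ofFinite ι
  have : Nonempty B := ⟨u⟩
  have : ContractibleSpace B := hB.contractibleSpace ⟨u, u.2⟩
  let Q : ℝ → ℝ → Prop := fun r s => ∀ {x y : B} (c : Path.Homotopic.Quotient x y),
    (x : V) = AffineMap.lineMap (u : V) (v : V) r → (y : V) = AffineMap.lineMap (u : V) (v : V) s →
    P (c.map g)
  let D : ι → Set ℝ := fun a => Icc 0 1 ∩ (AffineMap.lineMap (u : V) (v : V)) ⁻¹' C a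
  have hline : Continuous (AffineMap.lineMap (u : V) (v : V) : ℝ → V) :=
    AffineMap.lineMap_continuous
  have hconv : ∀ a, Convex ℝ (D a) := fun a =>
    (convex_Icc 0 1).inter ((hC' a).affine_preimage (AffineMap.lineMap (u : V) (v : V)))
  have key : Q 0 1 := by
    refine rel_of_Icc_subset_biUnion Q D ?_ (fun a => isClosed_Icc.inter ((hC a).preimage hline))
      (fun a => (hconv a).ordConnected) ?_ Finset.univ 0 1 zero_le_one ?_
    · intro r s t hrs hst h1 h2 x z c hx hz
      have hy : AffineMap.lineMap (u : V) (v : V) s ∈ B :=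
        (hB.affine_preimage (AffineMap.lineMap (u : V) (v : V))).ordConnected.out
          (show AffineMap.lineMap (u : V) (v : V) r ∈ B from hx ▸ x.2)
          (show AffineMap.lineMap (u : V) (v : V) t ∈ B from hz ▸ z.2) ⟨hrs, hst⟩
      let y : B := ⟨_, hy⟩
      rw [Subsingleton.elim c (Path.Homotopic.Quotient.trans
        (Path.Homotopic.Quotient.mk (segmentPath hB x y))
        (Path.Homotopic.Quotient.mk (segmentPath hB y z)))]
      rw [map_trans]
      exact htrans _ _ (hgT y) (h1 (Path.Homotopic.Quotient.mk (segmentPath hB x y)) hx rfl)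
        (h2 (Path.Homotopic.Quotient.mk (segmentPath hB y z)) rfl hz)
    · intro a r s hrs hsub x y c hx hy
      have h1 : (x : V) ∈ C a := hx ▸ (hsub (left_mem_Icc.2 hrs)).2
      have h2 : (y : V) ∈ C a := hy ▸ (hsub (right_mem_Icc.2 hrs)).2
      rw [Subsingleton.elim c (Path.Homotopic.Quotient.mk (segmentPath hB x y))]
      refine hbase a _ (LiesIn.map g (A := Subtype.val ⁻¹' C a) (fun w hw => hgZ a w hw) ?_)
      exact LiesIn.of_path _ fun t => (hC' a).lineMap_mem h1 h2 t.2
    · intro t ht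
      have : (AffineMap.lineMap (u : V) (v : V) t : V) ∈ ⋃ a, C a := hcov ▸ mem_univ _
      obtain ⟨a, ha⟩ := mem_iUnion.1 this
      exact mem_biUnion (Finset.mem_univ a) ⟨ht, ha⟩
  exact key c (by simp) (by simp)

/-- Suppose that a set `T` of a space is locally parametrised by convex sets, compatibly with a
finite cover by closed convex sets. Then the path classes in `T` are generated by those in the
images of the members of the cover. -/
theorem induction_convex [Finite ι] (C : ι → Set V)
    (hC : ∀ a, IsClosed (C a)) (hC' : ∀ a, Convex ℝ (C a)) (hcov : ⋃ a, C a = univ) (Z : ι → Set M)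
    (T : Set M) (ψ : M → V) (hψ : ContinuousOn ψ T)
    (hloc : ∀ z ∈ T, ∃ W ∈ nhds z, ∃ B : Set V, Convex ℝ B ∧ ∃ σ : V → M, ContinuousOn σ B ∧
      MapsTo σ B T ∧ (∀ w ∈ W ∩ T, ψ w ∈ B ∧ σ (ψ w) = w) ∧ ∀ a, MapsTo σ (B ∩ C a) (Z a))
    (P : ∀ {x y : M}, Path.Homotopic.Quotient x y → Prop)
    (htrans : ∀ {x y z : M} (c : Path.Homotopic.Quotient x y) (d : Path.Homotopic.Quotient y z),
      y ∈ T → P c → P d → P (c.trans d))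
    (hbase : ∀ a {x y : M} (c : Path.Homotopic.Quotient x y), LiesIn (Z a) c → P c)
    {x y : M} (c : Path.Homotopic.Quotient x y) (hc : LiesIn T c) : P c := by
  obtain ⟨p, hp, rfl⟩ := hc
  choose W hW B hB σ hσ hσT hσψ hσZ using fun z : T => hloc z z.2
  let incl : C(T, M) := ⟨Subtype.val, continuous_subtype_val⟩
  have key : ∀ {u v : T} (c : Path.Homotopic.Quotient u v), P (c.map incl) := by
    intro u v c
    refine induction_cover (fun z : T => Subtype.val ⁻¹' interior (W z))
      (fun z => isOpen_interior.preimage continuous_subtype_val)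
      (fun z => ⟨z, mem_interior_iff_mem_nhds.2 (hW z)⟩) (fun c => P (c.map incl)) ?_ ?_ c
    · intro x y z c d hc hd
      rw [map_trans]
      exact htrans _ _ y.2 hc hd
    · intro z x y q hq
      have h1 : ∀ t, ψ (q t) ∈ B z ∧ σ z (ψ (q t)) = q t := fun t =>
        hσψ z _ ⟨interior_subset (hq t), (q t).2⟩
      let g : C(B z, M) := ⟨fun u => σ z u, (hσ z).domRestrict⟩
      have hx : ψ x ∈ B z ∧ σ z (ψ x) = x := by simpa using h1 0
      have hy : ψ y ∈ B z ∧ σ z (ψ y) = y := by simpa using h1 1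
      let q' : Path (⟨ψ x, hx.1⟩ : B z) ⟨ψ y, hy.1⟩ :=
        { toFun := fun t => ⟨ψ (q t), (h1 t).1⟩
          continuous_toFun := Continuous.subtype_mk
            (hψ.comp_continuous (continuous_subtype_val.comp q.continuous) fun t => (q t).2) _
          source' := by simp
          target' := by simp }
      have h2 := map_convex_of_cover (hB z) g C hC hC' hcov Z T (fun u => hσT z u.2)
        (fun a u hu => hσZ z a ⟨u.2, hu⟩) P htrans hbase (Path.Homotopic.Quotient.mk q')
      -- `σ z ∘ ψ` fixes the path pointwise, but its endpoints agree only propositionally.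
      have cast : ∀ {x' y' : M} (r : Path x' y') (r' : Path (x : M) y), x' = x → y' = y →
          (∀ t, r t = r' t) → P (Path.Homotopic.Quotient.mk r) →
          P (Path.Homotopic.Quotient.mk r') := by
        rintro _ _ r r' rfl rfl h hr
        rwa [← Path.ext (funext h)]
      exact cast (q'.map g.continuous) (q.map incl.continuous) hx.2 hy.2 (fun t => (h1 t).2) h2
  let p' : Path (⟨x, by simpa using hp 0⟩ : T) ⟨y, by simpa using hp 1⟩ :=
    { toFun := fun t => ⟨p t, hp t⟩
      continuous_toFun := Continuous.subtype_mk p.continuous _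
      source' := by simp
      target' := by simp }
  exact key (Path.Homotopic.Quotient.mk p')

end PathClass

/-! ### Path classes in the pieces of a trisection -/

open PathClass in
/-- Path classes in the complement of a closed subset of the 4-sphere, in a set parametrised by
vectors. -/
theorem induction_radial {ι : Type*} [Finite ι] {K : Set FourSphere} (hK : IsClosed K)
    (Φ : FourSphere ≃ₜ FourSphere) (T : Set FourSphere) (C : ι → Set (EuclideanSpace ℝ (Fin 5)))
    (Z : ι → Set FourSphere) (hC : ∀ a, IsClosed (C a)) (hC' : ∀ a, Convex ℝ (C a))
    (hcov : ⋃ a, C a = univ) {G : EuclideanSpace ℝ (Fin 5) → EuclideanSpace ℝ (Fin 5)}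
    (hG : Continuous G) (hGT : ∀ p ∈ T, G (Φ.symm p) = Φ.symm p)
    (hT : ∀ q v, G v ≠ 0 → Φ (radial q (G v)) ∈ T)
    (hZ : ∀ a q, ∀ v ∈ C a, G v ≠ 0 → Φ (radial q (G v)) ∈ Z a)
    (P : ∀ {x y : ↥Kᶜ}, Path.Homotopic.Quotient x y → Prop)
    (htrans : ∀ {x y z : ↥Kᶜ} (c : Path.Homotopic.Quotient x y) (d : Path.Homotopic.Quotient y z),
      y ∈ (Subtype.val ⁻¹' T : Set ↥Kᶜ) → P c → P d → P (c.trans d))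
    (hbase : ∀ a {x y : ↥Kᶜ} (c : Path.Homotopic.Quotient x y), LiesIn (Subtype.val ⁻¹' Z a) c → P c)
    {x y : ↥Kᶜ} (c : Path.Homotopic.Quotient x y) (hc : LiesIn (Subtype.val ⁻¹' T) c) : P c := by
  classical
  have hψ : Continuous fun z : ↥Kᶜ => ((Φ.symm z.1).1 : EuclideanSpace ℝ (Fin 5)) := by fun_prop
  refine induction_convex C hC hC' hcov (fun a => Subtype.val ⁻¹' Z a) (Subtype.val ⁻¹' T)
    (fun z : ↥Kᶜ => ((Φ.symm z.1).1 : EuclideanSpace ℝ (Fin 5))) hψ.continuousOn ?_ P htrans hbase c hc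
  intro z hz
  set v₀ : EuclideanSpace ℝ (Fin 5) := (Φ.symm z.1).1 with hv₀
  have hv0 : G v₀ ≠ 0 := by
    rw [hGT _ hz]
    exact ne_zero_of_mem_unit_sphere _
  -- Apply `G`, normalise, and return by `Φ`: this extends the inverse of the coordinate map from
  -- the image of `T`, which is not convex, to a ball of ℝ⁵, which is.
  let τ : EuclideanSpace ℝ (Fin 5) → FourSphere := fun v => Φ (radial (Φ.symm z.1) (G v))
  have hτ : ∀ v, G v ≠ 0 → ContinuousAt τ v := fun v hv =>
    Φ.continuous.continuousAt.comp (((continuousOn_radial _).continuousAt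
      (isOpen_compl_singleton.mem_nhds hv)).comp hG.continuousAt)
  have hτψ : ∀ p ∈ T, τ (Φ.symm p).1 = p := fun p hp => by
    simp only [τ]
    rw [hGT p hp, radial_self, Φ.apply_symm_apply]
  -- As `K` is closed, the extension still avoids `K` on a small ball around `v₀`.
  have hnhds : {v | G v ≠ 0 ∧ τ v ∈ Kᶜ} ∈ nhds v₀ := by
    refine Filter.inter_mem (hG.continuousAt.preimage_mem_nhds
      (isOpen_compl_singleton.mem_nhds hv0)) ((hτ v₀ hv0).preimage_mem_nhds
      (hK.isOpen_compl.mem_nhds ?_))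
    rw [hv₀, hτψ _ hz]
    exact z.2
  obtain ⟨ε, hε, hball⟩ := Metric.mem_nhds_iff.1 hnhds
  let σ : EuclideanSpace ℝ (Fin 5) → ↥Kᶜ := fun v =>
    if hv : v ∈ Metric.ball v₀ ε then ⟨τ v, (hball hv).2⟩ else z
  have hσ : ∀ v ∈ Metric.ball v₀ ε, (σ v : FourSphere) = τ v := fun v hv => by
    simp only [σ, dif_pos hv]
  refine ⟨_, hψ.continuousAt.preimage_mem_nhds (Metric.ball_mem_nhds v₀ hε), Metric.ball v₀ ε,
    convex_ball _ _, σ, ?_, ?_, ?_, ?_⟩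
  · rw [Topology.IsInducing.subtypeVal.continuousOn_iff]
    exact ContinuousOn.congr (fun v hv => (hτ v (hball hv).1).continuousWithinAt) hσ
  · intro v hv
    change (σ v : FourSphere) ∈ T
    rw [hσ v hv]
    exact hT _ _ (hball hv).1
  · rintro w ⟨hw, hwT⟩
    exact ⟨hw, Subtype.ext (by rw [hσ _ hw, hτψ _ hwT])⟩
  · rintro a v ⟨hv, hva⟩
    change (σ v : FourSphere) ∈ Z a
    rw [hσ v hv]
    exact hZ a _ v hva (hball hv).1

theorem isClosed_maxCone (J : Finset (Fin 3)) : IsClosed (maxCone J) := by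
  have : maxCone J = ⋂ i ∈ J, ⋂ j, {v | coord j v ≤ coord i v} := by
    ext v; simp [maxCone]
  rw [this]
  exact isClosed_biInter fun i _ => isClosed_iInter fun j =>
    isClosed_le (by fun_prop) (by fun_prop)

theorem radial_mem_stratum {J : Finset (Fin 3)} {v : EuclideanSpace ℝ (Fin 5)} (hv : v ∈ maxCone J)
    (hv0 : v ≠ 0) (q : FourSphere) : radial q v ∈ stratum J := by
  change (radial q v).1 ∈ maxCone J
  rw [radial_coe q hv0]
  exact smul_mem_maxCone hv (inv_pos.2 (norm_pos_iff.2 hv0))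

-- Here `G` is the identity: ℝ⁵ is the union of the three closed convex cones over the pieces.
open PathClass in
theorem induction_pieces {K : Set FourSphere} (hK : IsClosed K) (Φ : FourSphere ≃ₜ FourSphere)
    (P : ∀ {x y : ↥Kᶜ}, Path.Homotopic.Quotient x y → Prop)
    (htrans : ∀ {x y z : ↥Kᶜ} (c : Path.Homotopic.Quotient x y) (d : Path.Homotopic.Quotient y z),
      P c → P d → P (c.trans d))
    (hbase : ∀ i {x y : ↥Kᶜ} (c : Path.Homotopic.Quotient x y),
      LiesIn (Subtype.val ⁻¹' (Φ '' stratum {i})) c → P c)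
    {x y : ↥Kᶜ} (c : Path.Homotopic.Quotient x y) : P c := by
  obtain ⟨p, rfl⟩ := Path.Homotopic.Quotient.mk_surjective c
  refine induction_radial hK Φ univ (fun i : Fin 3 => maxCone {i}) (fun i => Φ '' stratum {i})
    (fun i => isClosed_maxCone _) (fun i => convex_maxCone _) ?_ (G := id) continuous_id
    (fun _ _ => rfl) (fun _ _ _ => mem_univ _)
    (fun i q v hv hv0 => mem_image_of_mem _ (radial_mem_stratum hv hv0 q)) P
    (fun c d _ => htrans c d) hbase _ (LiesIn.of_path p fun _ => mem_univ _)
  refine eq_univ_of_forall fun v => mem_iUnion.2 ?_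
  obtain ⟨i, hi⟩ := Finite.exists_max (fun i : Fin 3 => coord i v)
  exact ⟨i, fun k hk j => by rw [Finset.mem_singleton.1 hk]; exact hi j⟩

theorem compl_singleton_nonempty (i : Fin 3) : ({i}ᶜ : Finset (Fin 3)).Nonempty := by
  fin_cases i <;> decide

/-- Replace the `i`-th coordinate by the larger one of the other two among the first three. -/
noncomputable def faceProj (i : Fin 3) (v : EuclideanSpace ℝ (Fin 5)) : EuclideanSpace ℝ (Fin 5) :=
  v + (({i}ᶜ : Finset (Fin 3)).sup' (compl_singleton_nonempty i) (fun k => coord k v) - coord i v) •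
    dir {i}

theorem continuous_faceProj (i : Fin 3) : Continuous (faceProj i) := by
  unfold faceProj
  have : Continuous fun v : EuclideanSpace ℝ (Fin 5) =>
      ({i}ᶜ : Finset (Fin 3)).sup' (compl_singleton_nonempty i) (fun k => coord k v) :=
    Continuous.finset_sup'_apply _ fun k _ => (coord k).continuous
  fun_prop

theorem sup'_coord_eq {i k : Fin 3} (hk : k ≠ i) {v : EuclideanSpace ℝ (Fin 5)}
    (hv : ∀ j, j ≠ i → coord j v ≤ coord k v) :
    ({i}ᶜ : Finset (Fin 3)).sup' (compl_singleton_nonempty i) (fun k => coord k v) = coord k v := by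
  refine le_antisymm (Finset.sup'_le _ _ fun j hj => hv j (by simpa using hj))
    (Finset.le_sup' (fun k => coord k v) (by simpa using hk))

theorem faceProj_mem {i k : Fin 3} (hk : k ≠ i) {v : EuclideanSpace ℝ (Fin 5)}
    (hv : ∀ j, j ≠ i → coord j v ≤ coord k v) : faceProj i v ∈ maxCone {i, k} := by
  have hc : ∀ j, coord j (faceProj i v) = if j = i then coord k v else coord j v := by
    intro j
    rw [faceProj, sup'_coord_eq hk hv, map_add, map_smul, coord_dir]
    by_cases h : j = i <;> simp [h]
  have hmax : ∀ j, coord j (faceProj i v) ≤ coord k v := fun j => by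
    rw [hc]
    split_ifs with h
    exacts [le_rfl, hv j h]
  intro l hl j
  have : coord l (faceProj i v) = coord k v := by
    rw [hc]
    rcases Finset.mem_insert.1 hl with rfl | hl
    · simp
    · rw [Finset.mem_singleton.1 hl, if_neg hk]
  rw [this]
  exact hmax j

theorem faceProj_eq_self {i k : Fin 3} (hk : k ≠ i) {v : EuclideanSpace ℝ (Fin 5)}
    (hv : v ∈ maxCone {i, k}) : faceProj i v = v := by
  rw [faceProj, sup'_coord_eq hk fun j _ => hv k (by simp) j,
    le_antisymm (hv i (by simp) k) (hv k (by simp) i), sub_self, zero_smul, add_zero]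

-- Here `G` is `faceProj i`, a retraction of ℝ⁵ onto the cone over the boundary of the piece. The
-- convex sets record which of the other two coordinates is larger, hence onto which face a vector
-- is sent.
open PathClass in
theorem induction_faces {K : Set FourSphere} (hK : IsClosed K) (Φ : FourSphere ≃ₜ FourSphere)
    (i : Fin 3) (P : ∀ {x y : ↥Kᶜ}, Path.Homotopic.Quotient x y → Prop)
    (htrans : ∀ {x y z : ↥Kᶜ} (c : Path.Homotopic.Quotient x y) (d : Path.Homotopic.Quotient y z),
      (y : FourSphere) ∈ frontier (Φ '' stratum {i}) → P c → P d → P (c.trans d))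
    (hbase : ∀ k, k ≠ i → ∀ {x y : ↥Kᶜ} (c : Path.Homotopic.Quotient x y),
      LiesIn (Subtype.val ⁻¹' (Φ '' stratum {i, k})) c → P c)
    {x y : ↥Kᶜ} (c : Path.Homotopic.Quotient x y)
    (hc : LiesIn (Subtype.val ⁻¹' frontier (Φ '' stratum {i})) c) : P c := by
  have hfr : frontier (Φ '' stratum {i}) = ⋃ k ∈ ({i} : Set (Fin 3))ᶜ, Φ '' stratum {i, k} := by
    rw [← Φ.image_frontier, frontier_stratum_singleton, image_iUnion₂]
  have hmax : ∀ v : EuclideanSpace ℝ (Fin 5), ∃ k, k ≠ i ∧ ∀ j, j ≠ i → coord j v ≤ coord k v := by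
    intro v
    obtain ⟨k, hk, h⟩ := ({i}ᶜ : Finset (Fin 3)).exists_max_image (fun k => coord k v)
      (compl_singleton_nonempty i)
    exact ⟨k, by simpa using hk, fun j hj => h j (by simpa using hj)⟩
  have hmem : ∀ k, k ≠ i → ∀ q v, (∀ j, j ≠ i → coord j v ≤ coord k v) → faceProj i v ≠ 0 →
      Φ (radial q (faceProj i v)) ∈ Φ '' stratum {i, k} := fun k hk q v hv hv0 =>
    mem_image_of_mem _ (radial_mem_stratum (faceProj_mem hk hv) hv0 q)
  refine induction_radial hK Φ (frontier (Φ '' stratum {i}))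
    (fun k : {k : Fin 3 // k ≠ i} => {v | ∀ j, j ≠ i → coord j v ≤ coord k v})
    (fun k => Φ '' stratum {i, k.1}) ?_ ?_ ?_ (continuous_faceProj i) ?_ ?_
    (fun k q v hv hv0 => hmem k k.2 q v hv hv0) P htrans (fun k => hbase k k.2) c hc
  · intro k
    simp only [ofPred_forall]
    exact isClosed_iInter fun j => isClosed_iInter fun _ => isClosed_le (by fun_prop) (by fun_prop)
  · intro k x hx y hy a b ha hb _ j hj
    simp only [map_add, map_smul, smul_eq_mul]
    exact add_le_add (mul_le_mul_of_nonneg_left (hx j hj) ha)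
      (mul_le_mul_of_nonneg_left (hy j hj) hb)
  · refine eq_univ_of_forall fun v => mem_iUnion.2 ?_
    obtain ⟨k, hk, h⟩ := hmax v
    exact ⟨⟨k, hk⟩, h⟩
  · intro p hp
    rw [hfr] at hp
    obtain ⟨k, hk, w, hw, rfl⟩ := mem_iUnion₂.1 hp
    rw [Φ.symm_apply_apply]
    exact faceProj_eq_self hk hw
  · intro q v hv0
    obtain ⟨k, hk, h⟩ := hmax v
    rw [hfr]
    exact mem_biUnion (x := k) hk (hmem k hk q v h hv0)

/-! ### Generators of fundamental groups -/

namespace PathClass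

open Path.Homotopic.Quotient (trans symm refl mk trans_assoc)

variable {M : Type*} [TopologicalSpace M]

/-- Conjugation by `p` is an isomorphism of fundamental groups that takes the tethered loops to the
extended ones. -/
theorem closure_range_change_base {ι : Type*} {x₀ x₁ : M} (p : Path x₀ x₁) {q : ι → M}
    (η : ∀ k, Path x₁ (q k)) (μ : ∀ k, Path (q k) (q k))
    (h : Subgroup.closure (range fun k => FundamentalGroup.fromPath
      (mk (((η k).trans (μ k)).trans (η k).symm))) = ⊤) :
    Subgroup.closure (range fun k => FundamentalGroup.fromPath
      (mk (((p.trans (η k)).trans (μ k)).trans (p.trans (η k)).symm))) = ⊤ := by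
  set H := Subgroup.closure (range fun k => FundamentalGroup.fromPath
      (mk (((p.trans (η k)).trans (μ k)).trans (p.trans (η k)).symm))) with hH
  have key : ∀ g : FundamentalGroup M x₁,
      FundamentalGroup.fromPath (trans (trans (mk p) g) (symm (mk p))) ∈ H := by
    intro g
    have hg : g ∈ Subgroup.closure (range fun k => FundamentalGroup.fromPath
      (mk (((η k).trans (μ k)).trans (η k).symm))) := h ▸ Subgroup.mem_top g
    induction hg using Subgroup.closure_induction with
    | mem g hg =>
      obtain ⟨k, rfl⟩ := hg
      refine Subgroup.subset_closure ⟨k, ?_⟩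
      simp [trans_assoc, Path.Homotopic.Quotient.mk_trans, Path.Homotopic.Quotient.mk_symm]
    | one =>
      convert H.one_mem
      change trans (trans (mk p) (refl x₁)) (symm (mk p)) = refl x₀
      simp
    -- The product `g * g'` is the path `g'` followed by `g`.
    | mul g g' _ _ hg hg' =>
      convert H.mul_mem hg hg' using 1
      change trans (trans (mk p) (trans g' g)) (symm (mk p)) =
        trans (trans (trans (mk p) g') (symm (mk p))) (trans (trans (mk p) g) (symm (mk p)))
      simp [trans_assoc, symm_trans_cancel]
    | inv g _ hg =>
      convert H.inv_mem hg using 1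
      change trans (trans (mk p) (symm g)) (symm (mk p)) =
        symm (trans (trans (mk p) g) (symm (mk p)))
      simp [symm_trans_rev, trans_assoc, symm_symm']
  refine eq_top_iff.2 fun g _ => ?_
  have := key (trans (trans (symm (mk p)) g) (mk p))
  simpa [trans_assoc, trans_symm_cancel] using this

/-- `hf` says that the induced homomorphism is onto, so generators go to generators. -/
theorem closure_range_map {N ι : Type*} [TopologicalSpace N] {x : N} (f : C(N, M))
    (hf : ∀ c : Path.Homotopic.Quotient (f x) (f x), ∃ d : Path.Homotopic.Quotient x x, d.map f = c)
    {q : ι → N} (η : ∀ k, Path x (q k)) (μ : ∀ k, Path (q k) (q k))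
    (h : Subgroup.closure (range fun k => FundamentalGroup.fromPath
      (mk (((η k).trans (μ k)).trans (η k).symm))) = ⊤) :
    Subgroup.closure (range fun k => FundamentalGroup.fromPath
      (mk ((((η k).map f.continuous).trans ((μ k).map f.continuous)).trans
        ((η k).map f.continuous).symm))) = ⊤ := by
  have h1 := congrArg (Subgroup.map (FundamentalGroup.map f x)) h
  rw [MonoidHom.map_closure, ← range_comp] at h1
  have h2 : Subgroup.map (FundamentalGroup.map f x) ⊤ = ⊤ := by
    refine eq_top_iff.2 fun c _ => ?_
    obtain ⟨d, hd⟩ := hf c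
    exact ⟨d, trivial, hd⟩
  rw [h2] at h1
  convert h1 using 3
  funext k
  rw [← Path.map_trans, Path.map_symm, ← Path.map_trans]
  rfl

end PathClass

/-- Take the whole kernel of the map from the free group as the set of relators. -/
theorem exists_presentation {G : Type*} [Group G] {n : ℕ} (g : Fin n → G)
    (h : Subgroup.closure (range g) = ⊤) : ∃ (rels : Set (FreeGroup (Fin n)))
    (f : PresentedGroup rels ≃* G), ∀ i, f (PresentedGroup.of i) = g i := by
  let φ : FreeGroup (Fin n) →* G := FreeGroup.lift g
  have hφ : ∀ r ∈ (φ.ker : Set (FreeGroup (Fin n))), FreeGroup.lift g r = 1 := fun r hr => hr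
  refine ⟨φ.ker, MulEquiv.ofBijective (PresentedGroup.toGroup hφ) ⟨?_, ?_⟩, fun i => ?_⟩
  · rw [injective_iff_map_eq_one]
    intro x hx
    induction x using PresentedGroup.induction_on with | _ w =>
    refine PresentedGroup.one_of_mem ?_
    exact hx
  · rw [← MonoidHom.range_eq_top, eq_top_iff, ← h, Subgroup.closure_le]
    rintro _ ⟨i, rfl⟩
    exact ⟨PresentedGroup.of i, PresentedGroup.toGroup.of hφ⟩
  · exact PresentedGroup.toGroup.of hφ

theorem meridionalRank_le {K : Set FourSphere} {x₀ : ↥Kᶜ} {n : ℕ} {q : Fin n → ↥Kᶜ}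
    (η : ∀ k, Path x₀ (q k)) (μ : ∀ k, Path (q k) (q k)) (hμ : ∀ k, IsMeridian K (μ k))
    (h : Subgroup.closure (range fun k => FundamentalGroup.fromPath
      (Path.Homotopic.Quotient.mk (((η k).trans (μ k)).trans (η k).symm))) = ⊤) :
    meridionalRank K x₀ ≤ n := by
  obtain ⟨rels, f, hf⟩ := exists_presentation _ h
  exact iInf₂_le n ⟨rels, f, fun i => ⟨q i, η i, μ i, hμ i, hf i⟩⟩

/-! ### Trivial pairs in the complement of a knotted surface -/

open PathClass

/-- A piece `Y` of the 4-sphere with boundary `bd` in which the complement of `K` is path connected,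
also in the boundary, and all of whose path classes can be pushed into the boundary. -/
structure IsTrivialPair (K Y bd : Set FourSphere) : Prop where
  isPathConnected_diff : IsPathConnected (Y \ K)
  isPathConnected_boundary_diff : IsPathConnected (bd \ K)
  push : ∀ {x y : ↥Kᶜ} (c : Path.Homotopic.Quotient x y), (x : FourSphere) ∈ bd →
    (y : FourSphere) ∈ bd → LiesIn (Subtype.val ⁻¹' Y) c → LiesIn (Subtype.val ⁻¹' bd) c

/-- The inclusion of the complement of `K` in a subspace. -/
def complInclusion {K Y : Set FourSphere} {D : Set Y} (h : ∀ y : Y, y ∈ D ↔ (y : FourSphere) ∈ K) :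
    C(↥Dᶜ, ↥Kᶜ) :=
  ⟨fun y => ⟨y.1.1, fun hy => y.2 ((h y.1).2 hy)⟩, by fun_prop⟩

theorem exists_map_complInclusion {K Y : Set FourSphere} {D : Set Y}
    (h : ∀ y : Y, y ∈ D ↔ (y : FourSphere) ∈ K) {x y : ↥Dᶜ}
    (c : Path.Homotopic.Quotient (complInclusion h x) (complInclusion h y))
    (hc : LiesIn (Subtype.val ⁻¹' Y) c) :
    ∃ d : Path.Homotopic.Quotient x y, d.map (complInclusion h) = c := by
  obtain ⟨p, hp, rfl⟩ := hc
  let q : Path x y :=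
    { toFun := fun t => ⟨⟨(p t).1, hp t⟩, fun ht => (p t).2 ((h _).1 ht)⟩
      continuous_toFun := by fun_prop
      source' := Subtype.ext (Subtype.ext (congrArg (fun z : ↥Kᶜ => (z : FourSphere)) p.source))
      target' := Subtype.ext (Subtype.ext (congrArg (fun z : ↥Kᶜ => (z : FourSphere)) p.target)) }
  refine ⟨Path.Homotopic.Quotient.mk q, ?_⟩
  rw [← Path.Homotopic.Quotient.mk_map]
  rfl

theorem mem_domes_halfBallMap {m c : ℕ} {K Y : Set FourSphere}
    {e : Fin c → EuclideanSpace ℝ (Fin (m + 2)) → FourSphere}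
    (hmaps : ∀ k, MapsTo (e k) (halfBall m) Y) (hD : K ∩ Y = ⋃ k, e k '' halfBallDome m) (y : Y) :
    y ∈ IsHalfBallSystem.domes (halfBallMap e hmaps) ↔ (y : FourSphere) ∈ K := by
  have h1 : (y : FourSphere) ∈ K ↔ (y : FourSphere) ∈ ⋃ k, e k '' halfBallDome m := by
    rw [← hD]
    exact ⟨fun h => ⟨h, y.2⟩, fun h => h.1⟩
  rw [h1]
  simp only [IsHalfBallSystem.domes, mem_iUnion, mem_image]
  refine exists_congr fun k => exists_congr fun x => and_congr_right fun hx => ?_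
  rw [← halfBallMap_coe hmaps k (halfBallDome_subset m hx), Subtype.ext_iff]

/-- The results on half-ball systems, read in the subspace `Y` and carried to the complement of `K`
by `complInclusion`. -/
theorem isTrivialPair_of_isHalfBallSystem {m c : ℕ} (hm : 1 ≤ m) {K Y bd : Set FourSphere}
    (hY : IsSimplyConnected Y) (hbdY : bd ⊆ Y) (hbdc : IsPathConnected bd)
    {e : Fin c → EuclideanSpace ℝ (Fin (m + 2)) → FourSphere}
    (hmaps : ∀ k, MapsTo (e k) (halfBall m) Y) (hD : K ∩ Y = ⋃ k, e k '' halfBallDome m)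
    (he : IsHalfBallSystem (halfBallMap e hmaps))
    (hbd : ∀ k, ∀ x ∈ halfBall m, e k x ∈ bd ↔ x (Fin.last (m + 1)) = 0) : IsTrivialPair K Y bd := by
  have : SimplyConnectedSpace Y := hY
  have hmem := mem_domes_halfBallMap hmaps hD
  have hbd' : ∀ k, ∀ x ∈ halfBall m, (halfBallMap e hmaps k x ∈ (Subtype.val ⁻¹' bd : Set Y) ↔
      x (Fin.last (m + 1)) = 0) := fun k x hx => by
    rw [mem_preimage, halfBallMap_coe hmaps k hx, hbd k x hx]
  have hconn : IsPathConnected (Subtype.val ⁻¹' bd : Set Y) := hbdc.preimage_coe hbdY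
  refine ⟨?_, ?_, ?_⟩
  · convert he.isPathConnected_compl_domes.image continuous_subtype_val using 1
    ext p
    constructor
    · exact fun hp => ⟨⟨p, hp.1⟩, fun h => hp.2 ((hmem _).1 h), rfl⟩
    · rintro ⟨y, hy, rfl⟩
      exact ⟨y.2, fun h => hy ((hmem _).2 h)⟩
  · convert (he.isPathConnected_inter_compl_domes hm hbd' hconn).image continuous_subtype_val using 1
    ext p
    constructor
    · exact fun hp => ⟨⟨p, hbdY hp.1⟩, ⟨hp.1, fun h => hp.2 ((hmem _).1 h)⟩, rfl⟩
    · rintro ⟨y, hy, rfl⟩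
      exact ⟨hy.1, fun h => hy.2 ((hmem _).2 h)⟩
  · intro x y c hx hy hc
    have hlift : ∀ z : ↥Kᶜ, ∀ hz : (z : FourSphere) ∈ Y,
        (⟨z, hz⟩ : Y) ∈ (IsHalfBallSystem.domes (halfBallMap e hmaps))ᶜ := fun z hz h =>
      z.2 ((hmem _).1 h)
    obtain ⟨d, rfl⟩ := exists_map_complInclusion hmem (x := ⟨⟨x, hbdY hx⟩, hlift x (hbdY hx)⟩)
      (y := ⟨⟨y, hbdY hy⟩, hlift y (hbdY hy)⟩) c hc
    exact (he.liesIn_boundary hm hbd' hconn (x := ⟨⟨x, hbdY hx⟩, hlift x (hbdY hx)⟩)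
      (y := ⟨⟨y, hbdY hy⟩, hlift y (hbdY hy)⟩) hx hy d).map (complInclusion hmem) fun z hz => hz

/-- If the pieces of a trisection and their double intersections are trivial pairs, then all loops
in the complement of `K` can be pushed into each piece. -/
theorem liesIn_of_isTrivialPair {K : Set FourSphere} (hK : IsClosed K) (Φ : FourSphere ≃ₜ FourSphere)
    (hX : ∀ i : Fin 3, IsTrivialPair K (Φ '' stratum {i}) (frontier (Φ '' stratum {i})))
    (hY : ∀ i j : Fin 3, i ≠ j →
      IsTrivialPair K (Φ '' stratum {i, j}) (Φ '' stratum Finset.univ))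
    {x₀ : ↥Kᶜ} (hx₀ : (x₀ : FourSphere) ∈ Φ '' stratum Finset.univ)
    (c : Path.Homotopic.Quotient x₀ x₀) :
    LiesIn (Subtype.val ⁻¹' (Φ '' stratum Finset.univ)) c := by
  have hmono : ∀ {J J' : Finset (Fin 3)}, J ⊆ J' → Φ '' stratum J' ⊆ Φ '' stratum J := fun h =>
    image_mono (stratum_anti h)
  have hfr : ∀ i, frontier (Φ '' stratum {i}) =
      ⋃ k ∈ ({i} : Set (Fin 3))ᶜ, Φ '' stratum {i, k} := fun i => by
    rw [← Φ.image_frontier, frontier_stratum_singleton, image_iUnion₂]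
  have hinter : ∀ {J J' : Finset (Fin 3)} {p : FourSphere}, p ∈ Φ '' stratum J →
      p ∈ Φ '' stratum J' → p ∈ Φ '' stratum (J ∪ J') := by
    intro J J' p h h'
    rw [stratum_union, image_inter Φ.injective]
    exact ⟨h, h'⟩
  have hcfr : ∀ i, Φ '' stratum Finset.univ ⊆ frontier (Φ '' stratum {i}) := by
    intro i p hp
    obtain ⟨k, hk⟩ := compl_singleton_nonempty i
    rw [hfr]
    exact mem_biUnion (x := k) (by simpa using hk) (hmono (Finset.subset_univ _) hp)
  have hjoin : ∀ {A : Set FourSphere} {x : ↥Kᶜ}, IsPathConnected (A \ K) →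
      (x₀ : FourSphere) ∈ A → (x : FourSphere) ∈ A →
      ∃ p : Path.Homotopic.Quotient x₀ x, LiesIn (Subtype.val ⁻¹' A) p := by
    intro A x hA h0 hx
    have h1 : IsPathConnected (Subtype.val ⁻¹' (A \ K) : Set ↥Kᶜ) :=
      hA.preimage_coe fun p hp => hp.2
    exact exists_liesIn_of_joinedIn ((h1.joinedIn x₀ ⟨h0, x₀.2⟩ x ⟨hx, x.2⟩).mono
      (preimage_mono sdiff_subset))
  have hcc : IsPathConnected (Φ '' stratum Finset.univ \ K) :=
    (hY 0 1 (by decide)).isPathConnected_boundary_diff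
  -- First stage, inside the boundary of one piece: the strata are its two faces, whose loops can be
  -- pushed into the central sphere.
  have hface : ∀ i (c : Path.Homotopic.Quotient x₀ x₀),
      LiesIn (Subtype.val ⁻¹' frontier (Φ '' stratum {i})) c →
      LiesIn (Subtype.val ⁻¹' (Φ '' stratum Finset.univ)) c := by
    intro i c hc
    refine liesIn_of_strata (fun k : {k : Fin 3 // k ≠ i} => Subtype.val ⁻¹' (Φ '' stratum {i, k.1}))
      _ (Subtype.val ⁻¹' frontier (Φ '' stratum {i}))
      (fun k c hc => (hY i k k.2.symm).push c hx₀ hx₀ hc) ?_ ?_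
      (fun k => hmono (Finset.subset_univ _) hx₀) c hc
    · intro x hx
      -- The tether must lie in every face that contains `x`. On the central sphere it is taken in
      -- that sphere; any other point is in one face only.
      by_cases hxc : (x : FourSphere) ∈ Φ '' stratum Finset.univ
      · obtain ⟨p, hp⟩ := hjoin hcc hx₀ hxc
        exact ⟨p, fun k _ => hp.mono (preimage_mono (hmono (Finset.subset_univ _)))⟩
      · rw [hfr, mem_preimage] at hx
        obtain ⟨k, hk, hxk⟩ := mem_iUnion₂.1 hx
        obtain ⟨p, hp⟩ := hjoin (hY i k (Ne.symm hk)).isPathConnected_diff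
          (hmono (Finset.subset_univ _) hx₀) hxk
        refine ⟨p, fun l hl => ?_⟩
        by_cases hlk : l.1 = k
        · rwa [hlk]
        refine absurd ?_ hxc
        have h := hinter hxk hl
        have heq : ∀ i k l : Fin 3, k ≠ i → l ≠ i → l ≠ k →
            ({i, k} ∪ {i, l} : Finset (Fin 3)) = Finset.univ := by decide
        rwa [heq i k l hk l.2 hlk] at h
    · intro P htrans hbase x y c hc
      exact induction_faces hK Φ i P (fun c d hy => htrans c d hy)
        (fun k hk {x y} c hc => hbase ⟨k, hk⟩ c hc) c hc
  -- Second stage: the strata are the three pieces. A loop in a piece goes to the boundary of the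
  -- piece, and then to the central sphere by the first stage.
  refine liesIn_of_strata (fun i : Fin 3 => Subtype.val ⁻¹' (Φ '' stratum {i})) _ univ
    (fun i c hc => hface i c ((hX i).push c (hcfr i hx₀) (hcfr i hx₀) hc)) ?_ ?_
    (fun i => hmono (Finset.subset_univ _) hx₀) c ?_
  · intro x _
    by_cases hxc : (x : FourSphere) ∈ Φ '' stratum Finset.univ
    · obtain ⟨p, hp⟩ := hjoin hcc hx₀ hxc
      exact ⟨p, fun i _ => hp.mono (preimage_mono (hmono (Finset.subset_univ _)))⟩
    -- Off the central sphere, a point in two pieces is tethered in their intersection, and any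
    -- other point lies in one piece only.
    by_cases hxY : ∃ i j, i ≠ j ∧ (x : FourSphere) ∈ Φ '' stratum {i, j}
    · obtain ⟨i, j, hij, hx⟩ := hxY
      obtain ⟨p, hp⟩ := hjoin (hY i j hij).isPathConnected_diff
        (hmono (Finset.subset_univ _) hx₀) hx
      refine ⟨p, fun l hl => ?_⟩
      by_cases hlk : l ∈ ({i, j} : Finset (Fin 3))
      · exact hp.mono (preimage_mono (hmono (Finset.singleton_subset_iff.2 hlk)))
      refine absurd ?_ hxc
      have h := hinter hx hl
      have heq : ∀ i j l : Fin 3, i ≠ j → l ∉ ({i, j} : Finset (Fin 3)) →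
          ({i, j} ∪ {l} : Finset (Fin 3)) = Finset.univ := by decide
      rwa [heq i j l hij hlk] at h
    · obtain ⟨i, hi⟩ := mem_iUnion.1 (iUnion_modelPiece.symm ▸ mem_univ (Φ.symm x))
      rw [modelPiece_eq] at hi
      have hxi : (x : FourSphere) ∈ Φ '' stratum {i} := ⟨_, hi, Φ.apply_symm_apply _⟩
      obtain ⟨p, hp⟩ := hjoin (hX i).isPathConnected_diff (hmono (Finset.subset_univ _) hx₀) hxi
      refine ⟨p, fun l hl => ?_⟩
      by_cases hli : l = i
      · rwa [hli]
      exact absurd ⟨i, l, Ne.symm hli, hinter hxi hl⟩ hxY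
  · intro P htrans hbase x y c _
    exact induction_pieces hK Φ P (fun c d => htrans c d (mem_univ _)) hbase c
  · obtain ⟨p, rfl⟩ := Path.Homotopic.Quotient.mk_surjective c
    exact LiesIn.of_path p fun _ => mem_univ _

/-! ### Bridge trisections -/

open PathClass

theorem poleCircle_zero (r θ : ℝ) : poleCircle r θ 0 = r * Real.cos θ := rfl

theorem poleCircle_three (r θ : ℝ) : poleCircle r θ 3 = 1 + r * Real.sin θ := rfl

theorem continuous_poleCircle (r : ℝ) : Continuous (poleCircle r) := by
  refine (PiLp.continuous_toLp 2 _).comp (continuous_pi fun i => ?_)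
  fin_cases i <;> simp <;> fun_prop

theorem poleCircle_mem_halfBall (θ : ℝ) : poleCircle (1 / 2) θ ∈ halfBall 2 ∧
    ‖poleCircle (1 / 2) θ‖ < 2 := by
  have h1 := Real.sin_le_one θ
  have h2 := Real.neg_one_le_sin θ
  have h : ‖poleCircle (1 / 2) θ‖ < 2 := by
    refine lt_of_pow_lt_pow_left₀ 2 (by norm_num) ?_
    rw [norm_sq_poleCircle]
    linarith
  refine ⟨⟨h.le, ?_⟩, h⟩
  change 0 ≤ poleCircle (1 / 2) θ 3
  rw [poleCircle_three]
  linarith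

/-- Norm 1 forces `sin θ = -1/4`, while vanishing of the first coordinate forces `cos θ = 0`. -/
theorem poleCircle_notMem_halfBallDome (θ : ℝ) : poleCircle (1 / 2) θ ∉ halfBallDome 2 := by
  rintro ⟨h1, h2, -⟩
  have h3 := norm_sq_poleCircle (1 / 2) θ
  rw [h1] at h3
  have h4 : 1 / 2 * Real.cos θ = 0 := h2
  nlinarith [Real.sin_sq_add_cos_sq θ]

theorem one_lt_norm_poleCircle {θ : ℝ} (h : 0 ≤ Real.sin θ) : 1 < ‖poleCircle (1 / 2) θ‖ := by
  refine lt_of_pow_lt_pow_left₀ 2 (norm_nonneg _) ?_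
  rw [norm_sq_poleCircle]
  linarith

/-- The angle is within `π/4` of `3π/2`; comparison with `π/3` gives a rational bound that is good
enough. -/
theorem sin_le_of_mem {θ : ℝ} (h₁ : 5 / 4 * Real.pi ≤ θ) (h₂ : θ ≤ 7 / 4 * Real.pi) :
    Real.sin θ ≤ -(1 / 2) := by
  have hpi := Real.pi_pos
  have h : Real.cos (3 / 2 * Real.pi - θ) = -Real.sin θ := by
    rw [show 3 / 2 * Real.pi - θ = Real.pi / 2 - θ + Real.pi by ring, Real.cos_add_pi,
      Real.cos_pi_div_two_sub]
  have h3 : Real.cos (Real.pi / 3) ≤ Real.cos (3 / 2 * Real.pi - θ) := by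
    rw [← Real.cos_abs (3 / 2 * Real.pi - θ)]
    refine Real.cos_le_cos_of_nonneg_of_le_pi (abs_nonneg _) (by linarith) ?_
    rw [abs_le]
    constructor <;> linarith
  rw [Real.cos_pi_div_three, h] at h3
  linarith

/-- The meridional rank is at most the number of disks in a piece which contains all loops in the
complement, up to homotopy. -/
theorem meridionalRank_le_of_disks {K X corner : Set FourSphere} {c : ℕ} [PathConnectedSpace ↥Kᶜ]
    (hX : IsSimplyConnected X) (hcorner : corner ⊆ frontier X)
    {e : Fin c → EuclideanSpace ℝ (Fin 4) → FourSphere}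
    (hinj : ∀ k l, ∀ x ∈ halfBall 2, ∀ y ∈ halfBall 2, e k x = e l y → k = l ∧ x = y)
    (hmaps : ∀ k, MapsTo (e k) (halfBall 2) X)
    (hbd : ∀ k, ∀ x ∈ halfBall 2, e k x ∈ frontier X ↔ x (Fin.last 3) = 0)
    (hsmooth : ∀ k, ∀ x ∈ halfBall 2, e k x ∉ corner →
      ContMDiffWithinAt 𝓘(ℝ, EuclideanSpace ℝ (Fin 4)) (𝓡 4) ∞ (e k) (halfBall 2) x ∧
      Function.Injective
        (mfderivWithin 𝓘(ℝ, EuclideanSpace ℝ (Fin 4)) (𝓡 4) (e k) (halfBall 2) x))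
    (hD : K ∩ X = ⋃ k, e k '' halfBallDome 2) (he : IsHalfBallSystem (halfBallMap e hmaps))
    (hpush : ∀ x : ↥Kᶜ, (x : FourSphere) ∈ X → ∀ c : Path.Homotopic.Quotient x x,
      LiesIn (Subtype.val ⁻¹' X) c) (x₀ : ↥Kᶜ) : meridionalRank K x₀ ≤ c := by
  have : SimplyConnectedSpace X := hX
  have hmem := mem_domes_halfBallMap hmaps hD
  obtain ⟨z, hz⟩ := he.outside_nonempty
  let x₁ : ↥(IsHalfBallSystem.domes (halfBallMap e hmaps))ᶜ :=
    ⟨z, IsHalfBallSystem.outside_subset le_rfl hz⟩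
  have hdome : ∀ k θ, halfBallMap e hmaps k (poleCircle (1 / 2) θ) ∈
      (IsHalfBallSystem.domes (halfBallMap e hmaps))ᶜ := fun k θ h =>
    poleCircle_notMem_halfBallDome θ ((he.mem_domes_iff (poleCircle_mem_halfBall θ).1).1 h)
  let loop : ∀ k, Path (⟨_, hdome k 0⟩ : ↥(IsHalfBallSystem.domes (halfBallMap e hmaps))ᶜ)
      ⟨_, hdome k 0⟩ := fun k =>
    { toFun := fun t => ⟨_, hdome k (2 * Real.pi * t)⟩
      continuous_toFun := by
        refine Continuous.subtype_mk ?_ _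
        exact (he.continuousOn k).comp_continuous
          ((continuous_poleCircle _).comp (by fun_prop)) fun t => (poleCircle_mem_halfBall _).1
      source' := by simp
      target' := by simp [poleCircle] }
  have hpi := Real.pi_pos
  obtain ⟨η, hη⟩ : ∃ η : ∀ k, Path x₁ _, Subgroup.closure (range fun k =>
      FundamentalGroup.fromPath (Path.Homotopic.Quotient.mk
        (((η k).trans (loop k)).trans (η k).symm))) = ⊤ := by
    -- The circle around the pole is cut at the angles `π`, `5π/4` and `7π/4`. Its arcs have, in
    -- turn, norm above 1, negative first coordinate, norm below 1 and positive first coordinate.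
    refine he.exists_closure_eq_top (x₀ := x₁) hz ⟨1 / 2, by norm_num, by norm_num⟩
      ⟨5 / 8, by norm_num, by norm_num⟩ ⟨7 / 8, by norm_num, by norm_num⟩
      (Subtype.mk_le_mk.2 (by norm_num)) (Subtype.mk_le_mk.2 (by norm_num)) _ loop
      (fun k t ht => ?_) (fun k t ht ht' => ?_) (fun k t ht ht' => ?_) (fun k t ht => ?_)
    · refine (he.mem_outside_iff (poleCircle_mem_halfBall _).1).2 (one_lt_norm_poleCircle ?_)
      have h0 := t.2.1
      have h1 : (t : ℝ) ≤ 1 / 2 := ht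
      exact Real.sin_nonneg_of_nonneg_of_le_pi (by positivity) (by nlinarith)
    · have h0 : 1 / 2 ≤ (t : ℝ) := ht
      have h1 : (t : ℝ) ≤ 5 / 8 := ht'
      refine mem_image_of_mem _ ⟨(poleCircle_mem_halfBall _).1, (poleCircle_mem_halfBall _).2, ?_⟩
      rw [poleCircle_zero]
      have := Real.cos_neg_of_pi_div_two_lt_of_lt (x := 2 * Real.pi * t) (by nlinarith) (by nlinarith)
      linarith
    · have h0 : 5 / 8 ≤ (t : ℝ) := ht
      have h1 : (t : ℝ) ≤ 7 / 8 := ht'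
      refine mem_image_of_mem _ ⟨(poleCircle_mem_halfBall _).1, ?_⟩
      have := sin_le_of_mem (θ := 2 * Real.pi * t) (by nlinarith) (by nlinarith)
      refine lt_of_pow_lt_pow_left₀ 2 zero_le_one ?_
      rw [norm_sq_poleCircle]
      linarith
    · have h0 : 7 / 8 ≤ (t : ℝ) := ht
      have h1 := t.2.2
      refine mem_image_of_mem _ ⟨(poleCircle_mem_halfBall _).1, (poleCircle_mem_halfBall _).2, ?_⟩
      rw [poleCircle_zero, ← Real.cos_sub_two_pi]
      have := Real.cos_pos_of_mem_Ioo (x := 2 * Real.pi * t - 2 * Real.pi)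
        ⟨by nlinarith, by nlinarith⟩
      linarith
  -- The circles generate in the piece. By `hpush` they generate in the complement of `K`, first at
  -- `x₁` and then at `x₀`.
  have h1 := closure_range_map (complInclusion hmem) (fun c =>
    exists_map_complInclusion hmem c (hpush _ z.2 c)) η loop hη
  have h2 := closure_range_change_base (PathConnectedSpace.somePath x₀ _) _ _ h1
  refine meridionalRank_le _ _ (fun k => ?_) h2
  refine isMeridian_of_dome (f := e k) (fun x hx y hy h => (hinj k k x hx y hy h).2) ?_ ?_ _ ?_
  · intro x hx2 hx
    have hxh : x ∈ halfBall 2 := ⟨hx2.le, hx.le⟩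
    exact contMDiffAt_of_interior hx2 hx (hsmooth k x hxh fun h =>
      hx.ne' ((hbd k x hxh).1 (hcorner h)))
  · intro x hx2 hx
    have hxh : x ∈ halfBall 2 := ⟨hx2.le, hx.le⟩
    rw [← he.mem_domes_iff (k := k) hxh, hmem, halfBallMap_coe hmaps k hxh]
  · intro t
    exact halfBallMap_coe hmaps k (poleCircle_mem_halfBall _).1

/-- Two tied maximal coordinates are equal, so the cone is orthogonal to the difference of the two
basis vectors. This places the double intersection in a 3-sphere, where immersed 3-dimensional
half-balls are open. -/
theorem exists_orthogonal_maxCone_pair {i j : Fin 3} (hij : i ≠ j) :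
    ∃ N : Submodule ℝ (EuclideanSpace ℝ (Fin 5)),
      maxCone {i, j} ⊆ (Nᗮ : Set (EuclideanSpace ℝ (Fin 5))) ∧ Module.finrank ℝ N = 1 := by
  have hne : dir {i} - dir {j} ≠ 0 := fun h => by
    have := congrArg (coord i) h
    rw [map_sub, coord_dir, coord_dir] at this
    simp [hij] at this
  refine ⟨Submodule.span ℝ {dir {i} - dir {j}}, fun v hv => ?_, finrank_span_singleton hne⟩
  rw [SetLike.mem_coe, Submodule.mem_orthogonal_singleton_iff_inner_right]
  have hinner : ∀ k, inner ℝ (dir {k}) v = coord k v := fun k => by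
    simp [dir, coord, EuclideanSpace.inner_single_left]
  rw [inner_sub_left, hinner, hinner,
    le_antisymm (hv j (by simp) i) (hv i (by simp) j), sub_self]

theorem mainTheorem12 (K : Set FourSphere) (hK : IsKnottedSurface K) (b c₁ c₂ c₃ : ℕ)
    (hT : AdmitsBridgeTrisection K b c₁ c₂ c₃) (x₀ : ↥Kᶜ) :
    meridionalRank K x₀ ≤ ((min c₁ (min c₂ c₃) : ℕ) : ℕ∞) := by
  obtain ⟨X, ⟨Φ, hΦ⟩, hdisks, htangles⟩ := hT
  have hKc : IsClosed K := hK.1.isClosed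
  have hΦi : Function.Injective Φ := Φ.injective
  have hsingle : ∀ i : Fin 3, ({i} : Finset (Fin 3)) ≠ Finset.univ := by decide
  have hdouble : ∀ i j : Fin 3, ({i, j} : Finset (Fin 3)) ≠ Finset.univ := by decide
  have hX : ∀ i, X i = Φ '' stratum {i} := fun i => by rw [hΦ, modelPiece_eq]
  have hXX : ∀ i j, X i ∩ X j = Φ '' stratum {i, j} := fun i j => by
    rw [hX, hX, ← image_inter hΦi, ← stratum_union, Finset.insert_eq]
  have hcor : ⋂ k, X k = Φ '' stratum Finset.univ := by
    rw [← iInter_modelPiece, image_iInter (show Function.Bijective Φ from Φ.bijective)]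
    exact iInter_congr hΦ
  have hmono : ∀ {J J' : Finset (Fin 3)}, J ⊆ J' → Φ '' stratum J' ⊆ Φ '' stratum J := fun h =>
    image_mono (stratum_anti h)
  have hsc : ∀ J : Finset (Fin 3), J.Nonempty → J ≠ Finset.univ →
      IsSimplyConnected (Φ '' stratum J) := fun J h h' =>
    Φ.toHomeomorph.isSimplyConnected_image.2 (isSimplyConnected_stratum h h')
  have hfr : ∀ i, frontier (X i) = Φ '' frontier (stratum {i}) := fun i => by
    rw [hX]; exact (Φ.toHomeomorph.image_frontier _).symm
  have hcfr : ∀ i, ⋂ k, X k ⊆ frontier (X i) := fun i => by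
    rw [hcor, hfr, frontier_stratum_singleton]
    obtain ⟨k, hk⟩ := compl_singleton_nonempty i
    exact image_mono fun p hp => mem_biUnion (x := k) (by simpa using hk)
      (stratum_anti (Finset.subset_univ _) hp)
  have hsys : ∀ i, ∃ e : Fin (![c₁, c₂, c₃] i) → EuclideanSpace ℝ (Fin 4) → FourSphere,
      ∃ hmaps : ∀ k, MapsTo (e k) (halfBall 2) (X i), IsHalfBallSystem (halfBallMap e hmaps) ∧
      (∀ k l, ∀ x ∈ halfBall 2, ∀ y ∈ halfBall 2, e k x = e l y → k = l ∧ x = y) ∧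
      (∀ k, ∀ x ∈ halfBall 2, e k x ∈ frontier (X i) ↔ x (Fin.last 3) = 0) ∧
      (∀ k, ∀ x ∈ halfBall 2, e k x ∉ ⋂ k, X k →
        ContMDiffWithinAt 𝓘(ℝ, EuclideanSpace ℝ (Fin 4)) (𝓡 4) ∞ (e k) (halfBall 2) x ∧
        Function.Injective
          (mfderivWithin 𝓘(ℝ, EuclideanSpace ℝ (Fin 4)) (𝓡 4) (e k) (halfBall 2) x)) ∧
      K ∩ X i = ⋃ k, e k '' halfBallDome 2 := by
    intro i
    obtain ⟨e, hcont, hinj, hmaps, hbd, hsmooth, hD⟩ := hdisks i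
    refine ⟨e, hmaps, ?_, hinj, hbd, hsmooth, hD⟩
    have hXi := hX i
    have hfri := hfr i
    have hcfri := hcfr i
    generalize frontier (X i) = F at *
    generalize X i = Y at *
    subst hXi
    -- The corner lies in the boundary, so the disks are smooth wherever openness requires it.
    refine isHalfBallSystem_of_trivial (N := ⊥) (by simp) (by simp) Φ hcont hinj hmaps hbd ?_
      fun k x hx h => hsmooth k x hx fun h' => h (hcfri h')
    rintro _ ⟨p, hp, rfl⟩
    rw [hfri, hΦi.mem_set_image, hΦi.mem_set_image, mem_openStratum_singleton hp]
  have hXpair : ∀ i, IsTrivialPair K (Φ '' stratum {i}) (frontier (Φ '' stratum {i})) := by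
    intro i
    obtain ⟨e, hmaps, he, -, hbd, -, hD⟩ := hsys i
    rw [← hX]
    refine isTrivialPair_of_isHalfBallSystem (by norm_num) ?_ ?_ ?_ hmaps hD he hbd
    · rw [hX]
      exact hsc _ (by simp) (hsingle i)
    · rw [hX]
      exact (Φ.toHomeomorph.isClosedMap _ (isClosed_stratum _)).frontier_subset
    · rw [hfr]
      exact (isPathConnected_frontier_stratum i).image Φ.continuous
  have hYpair : ∀ i j, i ≠ j →
      IsTrivialPair K (Φ '' stratum {i, j}) (Φ '' stratum Finset.univ) := by
    intro i j hij
    obtain ⟨e, hcont, hinj, hmaps, hbd, hsmooth, hD⟩ := htangles i j hij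
    have hD' : K ∩ (X i ∩ X j) = ⋃ k, e k '' halfBallDome 1 := by
      rw [← hD, inter_inter_distrib_left]
    rw [hcor] at hbd
    rw [hXX] at hmaps hD'
    obtain ⟨N, hN, hNdim⟩ := exists_orthogonal_maxCone_pair hij
    refine isTrivialPair_of_isHalfBallSystem le_rfl (hsc _ (by simp) (hdouble i j))
      (hmono (Finset.subset_univ _)) (isPathConnected_stratum_univ.image Φ.continuous) hmaps hD'
      (isHalfBallSystem_of_trivial hN (by rw [hNdim]) Φ hcont hinj hmaps hbd ?_
        fun k x hx _ => hsmooth k x hx (notMem_empty _)) hbd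
    rintro _ ⟨p, hp, rfl⟩
    rw [hΦi.mem_set_image, hΦi.mem_set_image, mem_openStratum_pair hij hp]
  -- A base point on the central sphere off `K` lies in all three pieces.
  obtain ⟨z, hz, hzK⟩ := (hYpair 0 1 (by decide)).isPathConnected_boundary_diff.nonempty
  let y₀ : ↥Kᶜ := ⟨z, hzK⟩
  have hpush := liesIn_of_isTrivialPair hKc Φ.toHomeomorph hXpair hYpair (x₀ := y₀) hz
  have hjoin : ∀ i, ∀ x : ↥Kᶜ, (x : FourSphere) ∈ X i →
      ∃ p : Path.Homotopic.Quotient y₀ x, LiesIn (Subtype.val ⁻¹' X i) p := by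
    intro i x hx
    have h1 : IsPathConnected (Subtype.val ⁻¹' (X i \ K) : Set ↥Kᶜ) := by
      rw [hX]
      exact (hXpair i).isPathConnected_diff.preimage_coe fun p hp => hp.2
    exact exists_liesIn_of_joinedIn ((h1.joinedIn y₀ ⟨hX i ▸ hmono (Finset.subset_univ _) hz, hzK⟩ x
      ⟨hx, x.2⟩).mono (preimage_mono sdiff_subset))
  have hpc : PathConnectedSpace ↥Kᶜ := by
    have h : ∀ x, Joined y₀ x := by
      intro x
      obtain ⟨i, hi⟩ := mem_iUnion.1 (iUnion_modelPiece.symm ▸ mem_univ (Φ.symm x))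
      obtain ⟨_, p, -⟩ := hjoin i x (by rw [hΦ]; exact ⟨_, hi, Φ.apply_symm_apply _⟩)
      exact ⟨p⟩
    exact ⟨⟨y₀⟩, fun x y => (h x).symm.trans (h y)⟩
  have hmain : ∀ i, meridionalRank K x₀ ≤ ((![c₁, c₂, c₃] i : ℕ) : ℕ∞) := by
    intro i
    obtain ⟨e, hmaps, he, hinj, hbd, hsmooth, hD⟩ := hsys i
    refine meridionalRank_le_of_disks (by rw [hX]; exact hsc _ (by simp) (hsingle i))
      (hcfr i) hinj hmaps hbd hsmooth hD he (fun x hx d => ?_) x₀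
    obtain ⟨p, hp⟩ := hjoin i x hx
    -- Conjugate `d` to a loop at `y₀`, push that loop into the central sphere, and return along
    -- `p`, which stays in `X i`.
    have h := (hpush (p.trans (d.trans p.symm))).mono
      (preimage_mono (show Φ '' stratum Finset.univ ⊆ X i by
        rw [hX]; exact hmono (Finset.subset_univ _)))
    have h' := hp.symm.trans (h.trans hp)
    simpa [Path.Homotopic.Quotient.trans_assoc, symm_trans_cancel] using h'
  rcases min_choice c₁ (min c₂ c₃) with h | h
  · rw [h]
    exact hmain 0
  rw [h]
  rcases min_choice c₂ c₃ with h' | h'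
  · rw [h']
    exact hmain 1
  · rw [h']
    exact hmain 2
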